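/- For integers $M, F, k$ let $\mathcal L=\mathcal L_{M,F,k}$ be the set of bit strings of length $M$ whose Hamming weight $|x|$ satisfies $F-k\le |x|\le F+k$, let $\mathcal H_{M,F,k}$ be the Fock space spanned by the Fock states $|\mathbf b\rangle_f$, $\mathbf b\in\mathcal L$, and let $\mathcal I=\lceil\log_2\binom MF\rceil$. A fermion data structure of size $M$ and capacity $F,k$ on $n$ qubits consists of an injective linear map $\mathcal E:\mathcal H_{M,F,k}\to(\mathbb C^2)^{\otimes n}$ that sends Fock states to computational basis states, and of $n$-qubit circuits $F_j,R_j$ ($1\le j\le M$) of one- and two-qubit gates such that, writing $|\mathbf b\rangle=\mathcal E(|\mathbf b\rangle_f)$, $F_j|\mathbf b\rangle=|\text{bit-flip}(j,\mathbf b)\rangle$ whenever $\mathbf b$ and $\text{bit-flip}(j,\mathbf b)$ (the string $\mathbf b$ with its $j$-th bit negated) both lie in $\mathcal L$, and $R_j|\mathbf b\rangle=\prod_{i\le j}(-1)^{b_i}|\mathbf b\rangle$ for $\mathbf b\in\mathcal L$. Ancillas are counted in $n$; the gate complexity is the largest gate count of an $F_j$ or $R_j$. For $0\le j\le M$ let $<_j$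 be the ordering that compares strings by Hamming weight, then by the Hamming weight of the suffix after the first $j$ bits, then lexicographically after reversing the prefix of length $j$. Theorem. Let $\varepsilon>0$. There is a constant $C=C(\varepsilon)$, and for every integer $k\ge1$ a constant $C'=C'(\varepsilon,k)$, such that for all integers $M,F$ with $1\le F\le(1-\varepsilon)M$ there is a fermion data structure of size $M$ and capacity $F,k$ on $$n\le\mathcal I+C\,k\log_2(M/F)$$ qubits with gate complexity at most $C'\,M F\,\mathcal I$, and with the following structure. It stores a configuration $x\in\mathcal L$ as the $n$-bit binary expansion of its rank $l_0(x)$ in $\mathcal L$ under $<_0$ (weight, then lexicographic order). There are labellings $l_j:\mathcal L\to\{0,\dots,2^n-1\}$, $0\le j\le M$, which are strictly increasing with respect to $<_j$ and consecutive on each block (the strings of a given weight with a given prefix of length $j$), and $n$-qubit circuits $P_0,\dots,P_{M-1}$, $X_1,\dots,X_M$, $Z_1,\dots,Z_M$ such that, for all $x\in\mathcal L$, $P_j|l_j(x)\rangle=|l_{j+1}(x)\rangle$; $X_j|l_j(x)\rangle=|l_j(\text{bit-flip}(j,x))\rangle$ if $\text{bit-flip}(j,x)\in\mathcal L$ and $X_j|l_j(x)\rangle=|l_j(x)\rangle$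 otherwise; $Z_j|l_j(x)\rangle=(-1)^{x_j}|l_j(x)\rangle$. The circuit $F_j$ applies $P_0,\dots,P_{j-1}$, then $X_j$, then the inverses of $P_{j-1},\dots,P_0$; the circuit $R_j$ applies $P_0,Z_1,P_1,Z_2,\dots,P_{j-1},Z_j$, then the inverses of $P_{j-1},\dots,P_0$. On labels $l_j$, flipping bit $j$ is a block swap: for all $m$ with $F-k\le m$, $m+1\le F+k$ and all $f$, the labels of the strings in $\mathcal L$ of weight $m$ with bit $j$ equal to $0$ and with $f$ ones after bit $j$ are exactly the labels in some interval, those of the strings of weight $m+1$ with bit $j$ equal to $1$ and $f$ ones after bit $j$ are exactly the labels in a disjoint interval of the same length, and the flip carries the first to the second by a translation. Likewise bit $j$ is read off by comparisons: for all $m,f$ the labels of the strings in $\mathcal L$ of weight $m$ with bit $j$ equal to $1$ and $f$ ones after bit $j$ are exactly the labels in some interval. -/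

import Mathlib

noncomputable section

namespace FermionEncoding

/-! ### Bit strings -/

/-- Bit strings `b₁ … b_M`; the bit written `b_{i+1}` in 1-based notation is `b i`, `i : Fin M`. -/
abbrev BitString (M : ℕ) : Type := Fin M → Bool

/-- The Hamming weight. -/
def weight {M : ℕ} (b : BitString M) : ℕ :=
  (Finset.univ.filter fun i : Fin M => b i = true).card

/-- The Hamming weight of the suffix that is left after the first `j` bits are removed. -/
def suffixWeight {M : ℕ} (j : ℕ) (b : BitString M) : ℕ :=
  (Finset.univ.filter fun i : Fin M => j ≤ (i : ℕ) ∧ b i = true).card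

/-- `bit-flip(j, b)`: the `j`-th bit is negated. -/
def bitFlip {M : ℕ} (j : Fin M) (b : BitString M) : BitString M :=
  Function.update b j (!(b j))

/-- `sgn-rank(j, b)`: the parity sign of the bits up to and including the `j`-th one. -/
def sgnRank {M : ℕ} (j : Fin M) (b : BitString M) : ℂ :=
  ∏ i ∈ Finset.Iic j, (-1 : ℂ) ^ (b i).toNat

/-- The configurations: bit strings of length `M` and weight between `F - k` and `F + k`. -/
def configs (M F k : ℕ) : Finset (BitString M) :=
  Finset.univ.filter fun b => F ≤ weight b + k ∧ weight b ≤ F + k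

/-- `⌈log₂ (M choose F)⌉`. -/
def infoBound (M F : ℕ) : ℕ := ⌈Real.logb 2 (M.choose F : ℝ)⌉₊

/-! ### Quantum circuits -/

/-- The Hilbert space of `n` qubits. -/
abbrev QubitSpace (n : ℕ) : Type := EuclideanSpace ℂ (BitString n)

/-- Computational basis states. -/
def ket {n : ℕ} (s : BitString n) : QubitSpace n := EuclideanSpace.single s 1

/-- The `n` least significant binary digits of `r`. -/
def bits (n r : ℕ) : BitString n := fun i => r.testBit i

/-- A gate on `n` qubits: an arbitrary unitary on one qubit or on two distinct qubits. -/
inductive Gate (n : ℕ) : Type where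
  | one (p : Fin n) (U : Matrix.unitaryGroup Bool ℂ) : Gate n
  | two (p q : Fin n) (hpq : p ≠ q) (U : Matrix.unitaryGroup (Bool × Bool) ℂ) : Gate n

/-- The matrix by which a gate acts on the whole register. -/
def Gate.toMatrix {n : ℕ} : Gate n → Matrix (BitString n) (BitString n) ℂ
  | .one p U => fun x y =>
      if ∀ r, r ≠ p → x r = y r then U.1 (x p) (y p) else 0
  | .two p q _ U => fun x y =>
      if ∀ r, r ≠ p → r ≠ q → x r = y r then U.1 (x p, x q) (y p, y q) else 0

/-- The inverse gate. -/
def Gate.inv {n : ℕ} : Gate n → Gate n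
  | .one p U => .one p U⁻¹
  | .two p q hpq U => .two p q hpq U⁻¹

/-- A circuit is a list of gates (the head is applied first); its gate count is its length. -/
abbrev Circuit (n : ℕ) : Type := List (Gate n)

/-- The unitary matrix of a circuit. -/
def Circuit.toMatrix {n : ℕ} : Circuit n → Matrix (BitString n) (BitString n) ℂ
  | [] => 1
  | g :: c => Circuit.toMatrix c * g.toMatrix

/-- The action of a circuit on states of `n` qubits. -/
def Circuit.run {n : ℕ} (c : Circuit n) : QubitSpace n →ₗ[ℂ] QubitSpace n :=
  Matrix.toEuclideanLin (Circuit.toMatrix c)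

/-- The inverse circuit. -/
def Circuit.inv {n : ℕ} (c : Circuit n) : Circuit n := (c.map Gate.inv).reverse

/-! ### Fermion data structures -/

/-- The Fock space of `M` modes restricted to occupations between `F - k` and `F + k`, with the
occupation number (Fock) states as orthonormal basis. -/
abbrev FockSpace (M F k : ℕ) : Type := EuclideanSpace ℂ {b : BitString M // b ∈ configs M F k}

/-- The Fock state of an occupation string. -/
def fockState {M F k : ℕ} (b : BitString M) (hb : b ∈ configs M F k) : FockSpace M F k :=
  EuclideanSpace.single ⟨b, hb⟩ 1

/-- Fermion data structures of size `M` and capacity `F, k` on `n` qubits. The query circuits act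
on exactly these `n` qubits, so that their ancillas are counted in `n`. -/
structure FermionDataStructure (M F k n : ℕ) where
  /-- The encoding of states. -/
  enc : FockSpace M F k →ₗ[ℂ] QubitSpace n
  enc_injective : Function.Injective enc
  enc_fockState : ∀ b (hb : b ∈ configs M F k), ∃ s : BitString n, enc (fockState b hb) = ket s
  /-- The circuits that answer `bit-flip` queries. -/
  flipCircuit : Fin M → Circuit n
  /-- The circuits that answer `sgn-rank` queries. -/
  rankCircuit : Fin M → Circuit n
  flip_spec : ∀ (j : Fin M) b (hb : b ∈ configs M F k) (hb' : bitFlip j b ∈ configs M F k),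
    (flipCircuit j).run (enc (fockState b hb)) = enc (fockState (bitFlip j b) hb')
  rank_spec : ∀ (j : Fin M) b (hb : b ∈ configs M F k),
    (rankCircuit j).run (enc (fockState b hb)) = sgnRank j b • enc (fockState b hb)

/-- The gate complexity: the largest gate count of a query circuit. -/
def FermionDataStructure.gateComplexity {M F k n : ℕ} (D : FermionDataStructure M F k n) : ℕ :=
  Finset.univ.sup fun j : Fin M => max (D.flipCircuit j).length (D.rankCircuit j).length

/-! ### The orderings `<_j` and labellings sorted by them -/

/-- The reversal of the length-`j` prefix, followed by the remaining suffix. -/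
def reversePrefix {M : ℕ} (j : ℕ) (x : BitString M) : List Bool :=
  ((List.ofFn x).take j).reverse ++ (List.ofFn x).drop j

/-- The ordering `<_j`: by weight, then by the weight of the suffix after the first `j` bits, then
lexicographically after reversal of the length-`j` prefix. -/
def layerLT {M : ℕ} (j : ℕ) (x y : BitString M) : Prop :=
  weight x < weight y ∨
  (weight x = weight y ∧ suffixWeight j x < suffixWeight j y) ∨
  (weight x = weight y ∧ suffixWeight j x = suffixWeight j y ∧
    reversePrefix j x < reversePrefix j y)

open Classical in
/-- The rank of `x` in the initial ordering (by weight, then lexicographically). -/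
def initialRank (M F k : ℕ) (x : BitString M) : ℕ :=
  ((configs M F k).filter fun y => layerLT 0 y x).card

/-- Two strings lie in the same block at level `j`: same weight, same length-`j` prefix. -/
def SameBlock {M : ℕ} (j : ℕ) (x y : BitString M) : Prop :=
  weight x = weight y ∧ ∀ i : Fin M, (i : ℕ) < j → x i = y i

open Classical in
/-- `l` labels the configurations in the order `<_j`; the labels of each block are consecutive, and
vacuous (padding) labels may occur outside the blocks. -/
structure IsLayerLabelling (M F k j : ℕ) (l : BitString M → ℕ) : Prop where
  lt_iff : ∀ x ∈ configs M F k, ∀ y ∈ configs M F k, (l x < l y ↔ layerLT j x y)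
  consecutive : ∀ x ∈ configs M F k, ∀ y ∈ configs M F k, SameBlock j x y → layerLT j x y →
    l y = l x + ((configs M F k).filter fun z =>
      SameBlock j x z ∧ ¬ layerLT j z x ∧ layerLT j z y).card

/-- Flipping the bit `j` acts on labels by exchanging, for every pair of weights `m`, `m + 1` within
the capacity and every weight `f` of the suffix after that bit, two disjoint label intervals of
equal length by a translation: those of the strings of weight `m` with bit `0`, and those of the
strings of weight `m + 1` with bit `1`. -/
def FlipIsBlockSwap (M F k : ℕ) (j : Fin M) (l : BitString M → ℕ) : Prop :=
  ∀ m f : ℕ, F ≤ m + k → m + 1 ≤ F + k → ∃ a b d : ℕ, a + d ≤ b ∧ ∀ x ∈ configs M F k,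
    ((weight x = m ∧ suffixWeight (j + 1) x = f ∧ x j = false) ↔ l x ∈ Set.Ico a (a + d)) ∧
    ((weight x = m + 1 ∧ suffixWeight (j + 1) x = f ∧ x j = true) ↔ l x ∈ Set.Ico b (b + d)) ∧
    (l x ∈ Set.Ico a (a + d) → l (bitFlip j x) + a = l x + b)

/-- For every weight `m` and every weight `f` of the suffix after the bit `j`, whether this bit is
`1` is decided by comparing the label with the two ends of an interval. -/
def PhaseIsCompare (M F k : ℕ) (j : Fin M) (l : BitString M → ℕ) : Prop :=
  ∀ m f : ℕ, ∃ a d : ℕ, ∀ x ∈ configs M F k,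
    ((weight x = m ∧ suffixWeight (j + 1) x = f ∧ x j = true) ↔ l x ∈ Set.Ico a (a + d))

/-- Pass from level `0` to level `j` by the reordering circuits `P i` from level `i` to `i + 1`. -/
def ascend {n : ℕ} (P : ℕ → Circuit n) : ℕ → Circuit n
  | 0 => []
  | j + 1 => ascend P j ++ P j

/-- Pass from level `0` to level `j` and apply the circuit `Z i` on reaching level `i`,
for `i = 1, …, j`. -/
def ascendWith {n : ℕ} (P Z : ℕ → Circuit n) : ℕ → Circuit n
  | 0 => []
  | j + 1 => ascendWith P Z j ++ P j ++ Z (j + 1)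

/-- The data structure `D` stores the rank of a configuration in the initial ordering, and answers
queries by cycling through labellings `l j` in the orderings `<_j`, `0 ≤ j ≤ M`: `P j` reorders
from level `j` to level `j + 1`, while `X (j + 1)` and `Z (j + 1)` flip, respectively put a sign on,
the bit `j : Fin M` (the `(j + 1)`-st one), which at level `j + 1` is a block swap, respectively a
comparison. -/
structure CyclesThroughOrderings {M F k n : ℕ} (D : FermionDataStructure M F k n)
    (l : ℕ → BitString M → ℕ) (P X Z : ℕ → Circuit n) : Prop where
  label_lt : ∀ j ≤ M, ∀ x ∈ configs M F k, l j x < 2 ^ n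
  label_zero : ∀ x ∈ configs M F k, l 0 x = initialRank M F k x
  labelling : ∀ j ≤ M, IsLayerLabelling M F k j (l j)
  enc_eq : ∀ b (hb : b ∈ configs M F k), D.enc (fockState b hb) = ket (bits n (l 0 b))
  swap : ∀ j : Fin M, FlipIsBlockSwap M F k j (l (j + 1))
  compare : ∀ j : Fin M, PhaseIsCompare M F k j (l (j + 1))
  reorder : ∀ j < M, ∀ x ∈ configs M F k,
    (P j).run (ket (bits n (l j x))) = ket (bits n (l (j + 1) x))
  flip : ∀ j : Fin M, ∀ x ∈ configs M F k, bitFlip j x ∈ configs M F k →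
    (X (j + 1)).run (ket (bits n (l (j + 1) x))) = ket (bits n (l (j + 1) (bitFlip j x)))
  flip_outside : ∀ j : Fin M, ∀ x ∈ configs M F k, bitFlip j x ∉ configs M F k →
    (X (j + 1)).run (ket (bits n (l (j + 1) x))) = ket (bits n (l (j + 1) x))
  phase : ∀ j : Fin M, ∀ x ∈ configs M F k,
    (Z (j + 1)).run (ket (bits n (l (j + 1) x))) =
      (-1 : ℂ) ^ (x j).toNat • ket (bits n (l (j + 1) x))
  flipCircuit_eq : ∀ j : Fin M,
    D.flipCircuit j = ascend P (j + 1) ++ X (j + 1) ++ Circuit.inv (ascend P (j + 1))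
  rankCircuit_eq : ∀ j : Fin M,
    D.rankCircuit j = ascendWith P Z (j + 1) ++ Circuit.inv (ascend P (j + 1))

end FermionEncoding

end

open FermionEncoding

noncomputable section

namespace FermionEncoding

/-! ### The action of circuits on basis states -/

section Semantics

variable {n : ℕ}

/-! The labels are arranged so that flipping bit j becomes a translation. In the ordering `<_j` a
string is described, in decreasing significance, by its weight m, the weight f of the suffix, the
last bit e before the suffix, the rank of the rest of the reversed prefix, and the rank of the
suffix. Its padded label is a base depending on the key (m, f, e) plus a number composed of the two
ranks. At level j + 1 the bit e is the bit to be flipped: the key (m, f, 0) becomes (m + 1, f, 1),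
both ranks stay (`bitFlip_labels`), and the two intervals have equal length. The sign of the bit is
a function of the interval.

Going up one level takes the first bit off the suffix and pushes the former bit e into the prefix
rank. Both are single steps of the recursion for the lexicographic rank at fixed weight
(`listRank`): a leading one contributes a binomial coefficient, a leading zero nothing, and
comparison with the coefficient recovers the bit (`suffixRank_compare`, `prefixRank_compare`). A
level change is therefore a compare-and-subtract, a change of interval, and a reversed
compare-and-subtract (`mImpl_reorder`), with constants that depend on the key only.

To make this cheap, intervals are padded to aligned powers of two of length at least 2^(L-T). The T
topmost bits, T being log F up to a constant depending on k, then identify the interval, and bases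
are removed or exchanged by xor. By Vandermonde the key counts at a level sum to at most 2(2k+1)
times the largest binomial coefficient involved (`sum_keyCount_le`), so padding costs O(k) bits
(`levelsFit`). Binomial coefficients near F exceed M choose F by at most 2^((k+1)(S+c)) with S =
⌈log₂(M/F)⌉ and c depending on ε (`choose_le_near`).

There is no room for a second register of L bits. Addends are loaded one digit of S bits at a time,
and the missing upper bits of a short addend are replaced by borrowed qubits of the label register
in an unknown state (`impl_dirtyAdd`, `impl_addShort`, `impl_batchAdd`). Since log₂(M choose F) ≤
F(S+2), there are D = L/S = O(F) digits, so an addition costs D(S 2^T + L) = O(F I), with constants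
depending on ε and k. The instructions that act interval by interval obey the same bound, and M
levels give M F I.

Level 0 has to carry dense ranks. Padding them takes one threshold per weight, at most 2k in all
(`mImpl_align`), and is made part of the first reordering. -/

theorem run_nil (v : QubitSpace n) : Circuit.run ([] : Circuit n) v = v := by
  simp [Circuit.run, Circuit.toMatrix, Matrix.toEuclideanLin]

theorem run_cons (g : Gate n) (c : Circuit n) (v : QubitSpace n) :
    Circuit.run (g :: c) v = Circuit.run c (Circuit.run [g] v) := by
  simp [Circuit.run, Circuit.toMatrix, Matrix.toEuclideanLin]

theorem run_append (c d : Circuit n) (v : QubitSpace n) :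
    Circuit.run (c ++ d) v = Circuit.run d (Circuit.run c v) := by
  induction c generalizing v with
  | nil => simp [run_nil]
  | cons g c ih => rw [List.cons_append, run_cons, ih, ← run_cons]

theorem ket_apply (s x : BitString n) : (ket s : QubitSpace n) x = if x = s then 1 else 0 := by
  simp [ket]

theorem run_singleton_ket (g : Gate n) (s x : BitString n) :
    (Circuit.run [g] (ket s) : QubitSpace n) x = g.toMatrix x s := by
  simp [Circuit.run, Circuit.toMatrix, Matrix.toEuclideanLin, ket, Matrix.toLpLin_apply]

theorem run_one_ket (p : Fin n) (U : Matrix.unitaryGroup Bool ℂ) (s : BitString n) :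
    Circuit.run [Gate.one p U] (ket s) =
      ∑ b, U.1 b (s p) • (ket (Function.update s p b) : QubitSpace n) := by
  ext x
  rw [run_singleton_ket]
  simp only [Gate.toMatrix, WithLp.ofLp_sum, WithLp.ofLp_smul, Finset.sum_apply, Pi.smul_apply,
    ket_apply, smul_eq_mul, mul_ite, mul_one, mul_zero]
  have key : ∀ b, x = Function.update s p b ↔ ((∀ r, r ≠ p → x r = s r) ∧ b = x p) := by
    intro b
    rw [Function.eq_update_iff]
    tauto
  simp only [key]
  by_cases h : ∀ r, r ≠ p → x r = s r
  · rw [if_pos h, Finset.sum_eq_single (x p)]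
    · rw [if_pos ⟨h, rfl⟩]
    · exact fun b _ hb => if_neg fun h' => hb h'.2
    · simp
  · rw [if_neg h, Finset.sum_eq_zero]
    exact fun b _ => if_neg fun h' => h h'.1

theorem run_two_ket (p q : Fin n) (hpq : p ≠ q) (U : Matrix.unitaryGroup (Bool × Bool) ℂ)
    (s : BitString n) :
    Circuit.run [Gate.two p q hpq U] (ket s) =
      ∑ b, U.1 b (s p, s q) •
        (ket (Function.update (Function.update s p b.1) q b.2) : QubitSpace n) := by
  ext x
  rw [run_singleton_ket]
  simp only [Gate.toMatrix, WithLp.ofLp_sum, WithLp.ofLp_smul, Finset.sum_apply, Pi.smul_apply,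
    ket_apply, smul_eq_mul, mul_ite, mul_one, mul_zero]
  have key : ∀ b : Bool × Bool, x = Function.update (Function.update s p b.1) q b.2 ↔
      ((∀ r, r ≠ p → r ≠ q → x r = s r) ∧ b = (x p, x q)) := by
    rintro ⟨a, b⟩
    rw [Function.eq_update_iff]
    constructor
    · rintro ⟨h1, h2⟩
      refine ⟨fun r hr hr' => by rw [h2 r hr', Function.update_of_ne hr], ?_⟩
      rw [h1, h2 p hpq, Function.update_self]
    · rintro ⟨h1, h2⟩
      simp only [Prod.mk.injEq] at h2
      refine ⟨h2.2.symm, fun r hr => ?_⟩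
      by_cases hrp : r = p
      · subst hrp; simp [h2.1]
      · rw [Function.update_of_ne hrp, h1 r hrp hr]
  simp only [key]
  by_cases h : ∀ r, r ≠ p → r ≠ q → x r = s r
  · rw [if_pos h, Finset.sum_eq_single (x p, x q)]
    · rw [if_pos ⟨h, rfl⟩]
    · exact fun b _ hb => if_neg fun h' => hb h'.2
    · simp
  · rw [if_neg h, Finset.sum_eq_zero]
    exact fun b _ => if_neg fun h' => h h'.1

theorem ket_span (f g : QubitSpace n →ₗ[ℂ] QubitSpace n) (h : ∀ s, f (ket s) = g (ket s)) :
    f = g := by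
  refine (EuclideanSpace.basisFun (BitString n) ℂ).toBasis.ext fun s => ?_
  simpa [ket] using h s

theorem run_inv_gate (g : Gate n) (s : BitString n) :
    Circuit.run [g.inv] (Circuit.run [g] (ket s)) = (ket s : QubitSpace n) := by
  cases g with
  | one p U =>
    rw [run_one_ket, Gate.inv, map_sum]
    simp only [map_smul, run_one_ket, Function.update_self, Function.update_idem, Finset.smul_sum,
      smul_smul]
    rw [Finset.sum_comm]
    have hU : ∀ c, ∑ b, U.1 b (s p) * (U⁻¹).1 c b = if c = s p then 1 else 0 := by
      intro c
      have := congrFun (congrFun (congrArg Subtype.val (inv_mul_cancel U)) c) (s p)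
      rw [Submonoid.coe_mul, Matrix.mul_apply] at this
      simp only [mul_comm (U.1 _ _)]
      rw [this]
      simp [Matrix.one_apply]
    simp only [← Finset.sum_smul, hU]
    simp
  | two p q hpq U =>
    rw [run_two_ket, Gate.inv, map_sum]
    have h1 : ∀ a b : Bool, (Function.update (Function.update s p a) q b) p = a := fun a b => by
      rw [Function.update_of_ne hpq, Function.update_self]
    have h2 : ∀ a b a' b' : Bool, Function.update (Function.update
        (Function.update (Function.update s p a) q b) p a') q b' =
        Function.update (Function.update s p a') q b' := fun a b a' b' => by
      funext r
      simp only [Function.update_apply]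
      split_ifs <;> rfl
    simp only [map_smul, run_two_ket, Function.update_self, h1, h2, Finset.smul_sum, smul_smul]
    rw [Finset.sum_comm]
    have hU : ∀ c, ∑ b, U.1 b (s p, s q) * (U⁻¹).1 c b = if c = (s p, s q) then 1 else 0 := by
      intro c
      have := congrFun (congrFun (congrArg Subtype.val (inv_mul_cancel U)) c) (s p, s q)
      rw [Submonoid.coe_mul, Matrix.mul_apply] at this
      simp only [mul_comm (U.1 _ _)]
      rw [this]
      simp [Matrix.one_apply]
    simp only [Prod.mk.eta, ← Finset.sum_smul, hU]
    simp

theorem run_inv (c : Circuit n) (v : QubitSpace n) :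
    Circuit.run (Circuit.inv c) (Circuit.run c v) = v := by
  have hg : ∀ (g : Gate n) (v : QubitSpace n), Circuit.run [g.inv] (Circuit.run [g] v) = v := by
    intro g v
    have := ket_span ((Circuit.run [g.inv]).comp (Circuit.run [g])) LinearMap.id
      (fun s => by simpa using run_inv_gate g s)
    simpa using LinearMap.congr_fun this v
  induction c generalizing v with
  | nil => simp [Circuit.inv, run_nil]
  | cons g c ih =>
    have : Circuit.inv (g :: c) = Circuit.inv c ++ [g.inv] := by simp [Circuit.inv]
    rw [this, run_append, run_cons g c, ih, hg]

theorem length_inv (c : Circuit n) : (Circuit.inv c).length = c.length := by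
  simp [Circuit.inv]

/-- The circuit `c` sends the basis state `s` to the basis state `t`. -/
def Sends (c : Circuit n) (s t : BitString n) : Prop :=
  Circuit.run c (ket s) = (ket t : QubitSpace n)

theorem Sends.nil (s : BitString n) : Sends [] s s := run_nil _

theorem Sends.append {c d : Circuit n} {s t u : BitString n} (h : Sends c s t)
    (h' : Sends d t u) : Sends (c ++ d) s u := by
  unfold Sends at *
  rw [run_append, h, h']

theorem Sends.inv {c : Circuit n} {s t : BitString n} (h : Sends c s t) :
    Sends (Circuit.inv c) t s := by
  unfold Sends at *
  rw [← h, run_inv]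

/-! ### Elementary gates -/

/-- The gate that permutes the basis states of two qubits. -/
def permGate (p q : Fin n) (h : p ≠ q) (e : Equiv.Perm (Bool × Bool)) : Gate n :=
  .two p q h ⟨Matrix.of fun x y => if x = e y then 1 else 0, by
    rw [Matrix.mem_unitaryGroup_iff']
    ext x y
    simp [Matrix.mul_apply, Matrix.one_apply, Matrix.star_apply, eq_comm]⟩

theorem sends_permGate (p q : Fin n) (h : p ≠ q) (e : Equiv.Perm (Bool × Bool))
    (s : BitString n) : Sends [permGate p q h e] s
      (Function.update (Function.update s p (e (s p, s q)).1) q (e (s p, s q)).2) := by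
  unfold Sends permGate
  rw [run_two_ket]
  simp

/-- The gate that puts a phase on the basis states of two qubits. -/
def phaseGate (p q : Fin n) (h : p ≠ q) (d : Bool × Bool → Circle) : Gate n :=
  .two p q h ⟨Matrix.diagonal fun x => (d x : ℂ), by
    rw [Matrix.mem_unitaryGroup_iff']
    rw [Matrix.star_eq_conjTranspose, Matrix.diagonal_conjTranspose, Matrix.diagonal_mul_diagonal]
    ext x y
    by_cases hxy : x = y
    · subst hxy
      simp [← Complex.normSq_eq_conj_mul_self, Circle.normSq_coe]
    · simp [hxy]⟩

theorem run_phaseGate (p q : Fin n) (h : p ≠ q) (d : Bool × Bool → Circle) (s : BitString n) :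
    Circuit.run [phaseGate p q h d] (ket s) = (d (s p, s q) : ℂ) • (ket s : QubitSpace n) := by
  unfold phaseGate
  rw [run_two_ket]
  rw [Finset.sum_eq_single (s p, s q)]
  · simp
  · intro b _ hb
    simp [Matrix.diagonal_apply_ne _ hb]
  · simp

/-- The controlled `Z` gate. -/
def czGate (p q : Fin n) : Circuit n :=
  if h : p ≠ q then [phaseGate p q h fun b => if b.1 && b.2 then -1 else 1] else []

theorem run_czGate {p q : Fin n} (h : p ≠ q) (s : BitString n) :
    Circuit.run (czGate p q) (ket s) =
      (if s p && s q then -1 else 1 : ℂ) • (ket s : QubitSpace n) := by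
  rw [czGate, dif_pos h, run_phaseGate]
  split <;> simp

/-- The controlled `NOT` gate with control `p` and target `q`. -/
def cnot (p q : Fin n) : Circuit n :=
  if h : p ≠ q then [permGate p q h
    ⟨fun b => (b.1, b.2 ^^ b.1), fun b => (b.1, b.2 ^^ b.1), fun b => by simp, fun b => by simp⟩]
  else []

theorem length_cnot (p q : Fin n) : (cnot p q).length ≤ 1 := by
  unfold cnot; split <;> simp

theorem sends_cnot {p q : Fin n} (h : p ≠ q) (s : BitString n) :
    Sends (cnot p q) s (Function.update s q (s q ^^ s p)) := by
  rw [cnot, dif_pos h]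
  simpa using sends_permGate p q h ⟨fun b => (b.1, b.2 ^^ b.1), fun b => (b.1, b.2 ^^ b.1),
    fun b => by simp, fun b => by simp⟩ s

/-- The matrix of a rotation of one qubit. -/
def rotMatrix (w : Circle) (θ : ℝ) : Matrix Bool Bool ℂ := fun a b =>
  if a = b then (Real.cos θ : ℂ) else
    if b then -(starRingEnd ℂ) w * (Real.sin θ : ℂ) else w * (Real.sin θ : ℂ)

theorem rotMatrix_mem (w : Circle) (θ : ℝ) : rotMatrix w θ ∈ Matrix.unitaryGroup Bool ℂ := by
  have h1 : (Real.cos θ : ℂ) ^ 2 + (Real.sin θ : ℂ) ^ 2 = 1 := by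
    exact_mod_cast Real.cos_sq_add_sin_sq θ
  have h2 : (w : ℂ) * (starRingEnd ℂ) w = 1 := by
    rw [Complex.mul_conj]; simp [Circle.normSq_coe]
  rw [Matrix.mem_unitaryGroup_iff']
  ext a b
  cases a <;> cases b <;>
    simp only [rotMatrix, Matrix.mul_apply, Fintype.sum_bool, Matrix.star_apply, Matrix.one_apply,
      Complex.star_def, map_mul, map_neg, Complex.conj_conj, Complex.conj_ofReal,
      if_true, if_false, reduceCtorEq, Bool.false_eq_true]
  · linear_combination h1 + (Real.sin θ : ℂ) ^ 2 * h2
  · ring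
  · ring
  · linear_combination h1 + (Real.sin θ : ℂ) ^ 2 * h2

/-- The result of a rotation of the qubit `u` in a basis state. -/
def rotKet (w : Circle) (θ : ℝ) (u : Fin n) (s : BitString n) : QubitSpace n :=
  (Real.cos θ : ℂ) • ket s +
    (if s u then -(starRingEnd ℂ) w * (Real.sin θ : ℂ) else w * (Real.sin θ : ℂ)) •
      ket (bitFlip u s)

/-- The multiplexed rotation: the qubit `u` is rotated by the angle `β` of the control bits. -/
def mux (w : Circle) (u : Fin n) : List (Fin n) → (List Bool → ℝ) → Circuit n
  | [], β => [.one u ⟨rotMatrix w (β []), rotMatrix_mem w _⟩]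
  | y :: ys, β =>
    mux w u ys (fun v => (β (false :: v) + β (true :: v)) / 2) ++ czGate y u ++
    mux w u ys (fun v => (β (false :: v) - β (true :: v)) / 2) ++ czGate y u

/-- Each control doubles the circuit and adds two `czGate`s, hence at most 3 · 2^|ys| - 2 gates; the
summand 2 makes the recursion homogeneous. -/
theorem length_mux (w : Circle) (u : Fin n) (ys : List (Fin n)) (β : List Bool → ℝ) :
    (mux w u ys β).length + 2 ≤ 3 * 2 ^ ys.length := by
  induction ys generalizing β with
  | nil => simp [mux]
  | cons y ys ih =>
    have hz : (czGate y u).length ≤ 1 := by unfold czGate; split <;> simp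
    have h1 := ih (fun v => (β (false :: v) + β (true :: v)) / 2)
    have h2 := ih (fun v => (β (false :: v) - β (true :: v)) / 2)
    simp only [mux, List.length_append, List.length_cons, pow_succ]
    omega

theorem bitFlip_bitFlip (u : Fin n) (s : BitString n) : bitFlip u (bitFlip u s) = s := by
  simp [bitFlip]

theorem bitFlip_self (u : Fin n) (s : BitString n) : bitFlip u s u = !s u := by
  simp [bitFlip]

theorem bitFlip_of_ne {u r : Fin n} (h : r ≠ u) (s : BitString n) : bitFlip u s r = s r := by
  simp [bitFlip, h]

/-- Conjugation by a controlled Z reverses the rotation when the control is set. The half-sum P and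
the conjugated half-difference Q of the two angles thus add up to P + Q or P - Q, which are the two
values of `β`. -/
theorem run_mux (w : Circle) (u : Fin n) (ys : List (Fin n)) (hu : u ∉ ys) (β : List Bool → ℝ)
    (s : BitString n) :
    Circuit.run (mux w u ys β) (ket s) = rotKet w (β (ys.map s)) u s := by
  induction ys generalizing β s with
  | nil =>
    rw [mux, run_one_ket]
    have hf : Function.update s u (!s u) = bitFlip u s := rfl
    have ht : Function.update s u (s u) = s := by simp
    simp only [Fintype.sum_bool, rotKet, List.map_nil]
    cases h : s u <;> rw [h] at hf ht <;>
      simp only [Bool.not_false, Bool.not_true] at hf <;> rw [hf, ht] <;>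
      simp [rotMatrix, add_comm]
  | cons y ys ih =>
    simp only [List.mem_cons, not_or] at hu
    have hyu : y ≠ u := fun h => hu.1 h.symm
    have hm : ys.map (bitFlip u s) = ys.map s := by
      refine List.map_congr_left fun r hr => bitFlip_of_ne (by rintro rfl; exact hu.2 hr) s
    simp only [mux, run_append, List.map_cons]
    rw [ih hu.2]
    simp only [rotKet, map_add, map_smul, run_czGate hyu, ih hu.2, hm, bitFlip_bitFlip,
      bitFlip_self, bitFlip_of_ne hyu]
    generalize hA : β (false :: ys.map s) = A
    generalize hB : β (true :: ys.map s) = B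
    have e1 : A = (A + B) / 2 + (A - B) / 2 := by ring
    have e2 : B = (A + B) / 2 - (A - B) / 2 := by ring
    have h2 : (w : ℂ) * (starRingEnd ℂ) w = 1 := by
      rw [Complex.mul_conj]; simp [Circle.normSq_coe]
    generalize (A + B) / 2 = P at *
    generalize (A - B) / 2 = Q at *
    cases hy : s y <;> cases hs : s u <;>
      simp only [hA, hB, e1, e2, Bool.and_false, Bool.and_true, Bool.not_true, Bool.not_false,
        if_true, Bool.false_eq_true, if_false, one_smul, smul_add, smul_smul,
        Real.cos_add, Real.sin_add, Real.cos_sub, Real.sin_sub] <;>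
      push_cast <;> match_scalars <;>
      first
        | linear_combination (0 : ℂ) * h2
        | linear_combination (Complex.sin P * Complex.sin Q : ℂ) * h2
        | linear_combination (-(Complex.sin P * Complex.sin Q) : ℂ) * h2

end Semantics

/-! ### Reversible logic, registers and the ripple-carry adder -/

section Arithmetic

variable {n : ℕ}

/-- A circuit with at most `ℓ` gates sends `s` to `t` whenever `R s t`. -/
def Impl (R : BitString n → BitString n → Prop) (ℓ : ℕ) : Prop :=
  ∃ c : Circuit n, c.length ≤ ℓ ∧ ∀ s t, R s t → Sends c s t

theorem Impl.mono {R R' : BitString n → BitString n → Prop} {ℓ ℓ' : ℕ} (h : Impl R ℓ)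
    (hR : ∀ s t, R' s t → R s t) (hℓ : ℓ ≤ ℓ') : Impl R' ℓ' := by
  obtain ⟨c, hc, h⟩ := h
  exact ⟨c, hc.trans hℓ, fun s t hst => h s t (hR s t hst)⟩

theorem Impl.comp {R R' : BitString n → BitString n → Prop} {ℓ ℓ' : ℕ} (h : Impl R ℓ)
    (h' : Impl R' ℓ') : Impl (fun s u => ∃ t, R s t ∧ R' t u) (ℓ + ℓ') := by
  obtain ⟨c, hc, h⟩ := h
  obtain ⟨d, hd, h'⟩ := h'
  refine ⟨c ++ d, by simp; omega, ?_⟩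
  rintro s u ⟨t, h1, h2⟩
  exact (h s t h1).append (h' t u h2)

theorem Impl.inv {R : BitString n → BitString n → Prop} {ℓ : ℕ} (h : Impl R ℓ) :
    Impl (fun s t => R t s) ℓ := by
  obtain ⟨c, hc, h⟩ := h
  exact ⟨c.inv, by rwa [length_inv], fun s t hst => (h t s hst).inv⟩

theorem Impl.id : Impl (fun s t : BitString n => t = s) 0 :=
  ⟨[], le_rfl, by rintro s t rfl; exact Sends.nil _⟩

/-! ### Loading a function of control bits -/

/-- A rotation by π/2 sends |0⟩ to |1⟩ but |1⟩ to -|0⟩, which is why `u` has to be clean. The cost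
is exponential in the number of controls, but later only about log F controls are used. -/
theorem impl_load (u : Fin n) (ys : List (Fin n)) (hu : u ∉ ys) (h : List Bool → Bool) :
    Impl (fun s t => s u = false ∧ t = Function.update s u (h (ys.map s))) (3 * 2 ^ ys.length) := by
  refine ⟨mux 1 u ys fun v => if h v then Real.pi / 2 else 0, ?_, ?_⟩
  · have := length_mux 1 u ys fun v => if h v then Real.pi / 2 else 0
    omega
  · rintro s _ ⟨hs, rfl⟩
    unfold Sends
    rw [run_mux _ _ _ hu]
    cases hv : h (ys.map s)
    · have : Function.update s u false = s := by rw [← hs]; simp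
      simp [rotKet, this]
    · have : Function.update s u true = bitFlip u s := by simp [bitFlip, hs]
      simp [rotKet, this, hs]

/-! ### Reversible logic -/

theorem circle_exp_pi_div_two : ((Circle.exp (Real.pi / 2) : Circle) : ℂ) = Complex.I := by
  rw [Circle.coe_exp]
  push_cast
  exact Complex.exp_pi_div_two_mul_I

/-- With w = -i the rotation by π/2 is -i times NOT, and the phase gate on the two controls cancels
the factor. -/
theorem impl_toffoli {a b t : Fin n} (hab : a ≠ b) (hta : t ≠ a) (htb : t ≠ b) :
    Impl (fun s s' => s' = Function.update s t (s t ^^ (s a && s b))) 11 := by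
  refine ⟨mux (Circle.exp (Real.pi / 2))⁻¹ t [a, b]
    (fun v => if v = [true, true] then Real.pi / 2 else 0) ++
    [phaseGate a b hab fun v => if v.1 && v.2 then Circle.exp (Real.pi / 2) else 1], ?_, ?_⟩
  · have := length_mux (Circle.exp (Real.pi / 2))⁻¹ t [a, b]
      (fun v => if v = [true, true] then Real.pi / 2 else 0)
    simp at this ⊢
    omega
  · rintro s _ rfl
    unfold Sends
    rw [run_append, run_mux _ _ _ (by simp [hta, htb])]
    have h0 : Function.update s t (s t) = s := by simp
    have h1 : Function.update s t (!s t) = bitFlip t s := rfl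
    simp only [rotKet, map_add, map_smul, run_phaseGate, bitFlip_of_ne hta.symm,
      bitFlip_of_ne htb.symm, List.map_cons, List.map_nil, Circle.coe_inv, circle_exp_pi_div_two]
    cases ha : s a <;> cases hb : s b <;> cases hs : s t <;> rw [hs] at h0 h1 <;>
      simp [smul_smul, h0, ← h1]

theorem impl_cnot {p q : Fin n} (h : p ≠ q) :
    Impl (fun s t => t = Function.update s q (s q ^^ s p)) 1 :=
  ⟨cnot p q, length_cnot p q, by rintro s _ rfl; exact sends_cnot h s⟩

theorem impl_not (p : Fin n) : Impl (fun s t => t = Function.update s p (!s p)) 2 := by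
  have hU : (Matrix.of fun x y : Bool => if x = !y then (1 : ℂ) else 0) ∈
      Matrix.unitaryGroup Bool ℂ := by
    rw [Matrix.mem_unitaryGroup_iff']
    ext x y
    cases x <;> cases y <;> simp [Matrix.mul_apply, Matrix.star_apply]
  refine ⟨[.one p ⟨_, hU⟩], by simp, ?_⟩
  rintro s _ rfl
  unfold Sends
  rw [run_one_ket]
  simp

/-- A swap is three controlled NOTs; only the middle one needs the control, because the outer two
cancel without it. -/
theorem impl_fredkin {φ a b : Fin n} (hab : a ≠ b) (ha : φ ≠ a) (hb : φ ≠ b) :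
    Impl (fun s t => t = if s φ then s ∘ Equiv.swap a b else s) 13 := by
  refine ((impl_cnot hab.symm).comp ((impl_toffoli ha hb.symm hab.symm).comp
    (impl_cnot hab.symm))).mono ?_ le_rfl
  rintro s _ rfl
  refine ⟨_, rfl, _, rfl, ?_⟩
  funext q
  by_cases hqa : q = a
  · subst hqa
    cases h : s φ <;> simp [hab, hab.symm, ha, h]
  · by_cases hqb : q = b
    · subst hqb
      cases h : s φ <;> simp [hab, hab.symm, ha, h]
      cases s a <;> cases s q <;> rfl
    · cases h : s φ <;> simp [hqa, hqb, Equiv.swap_apply_of_ne_of_ne]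

/-- A permutation of the qubits that is controlled by a qubit. -/
theorem impl_ctrlPerm {φ : Fin n} (σ : Equiv.Perm (Fin n)) (hσ : σ φ = φ) :
    Impl (fun s t => t = if s φ then s ∘ σ else s) (13 * n) := by
  -- Induction on the size of the support: one controlled swap makes a moved point fixed.
  suffices h : ∀ m (σ : Equiv.Perm (Fin n)), σ.support.card ≤ m → σ φ = φ →
      Impl (fun s t => t = if s φ then s ∘ σ else s) (13 * m) from
    h n σ ((Finset.card_le_univ _).trans (by simp)) hσ
  intro m
  induction m with
  | zero =>
    intro σ h _
    have : σ = 1 := by simpa using h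
    subst this
    exact Impl.id.mono (by rintro s _ rfl; simp) (by simp)
  | succ m ih =>
    intro σ h hσ
    by_cases h1 : σ = 1
    · subst h1
      exact Impl.id.mono (by rintro s _ rfl; simp) (by simp)
    · obtain ⟨x, hx⟩ : ∃ x, σ x ≠ x := by
        by_contra! hc
        exact h1 (Equiv.ext hc)
      have hxφ : φ ≠ x := by rintro rfl; exact hx hσ
      have hxφ' : φ ≠ σ x := fun hh => hxφ (σ.injective (hσ.trans hh))
      have hcard := Equiv.Perm.card_support_swap_mul hx
      refine ((impl_fredkin hx.symm hxφ hxφ').comp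
        (ih (Equiv.swap x (σ x) * σ) (by omega) ?_)).mono ?_ (by omega)
      · rw [Equiv.Perm.mul_apply, hσ, Equiv.swap_apply_of_ne_of_ne hxφ hxφ']
      · rintro s _ rfl
        refine ⟨_, rfl, ?_⟩
        cases hs : s φ
        · simp [hs]
        · have : (s ∘ Equiv.swap x (σ x)) φ = true := by
            simp [Equiv.swap_apply_of_ne_of_ne hxφ hxφ', hs]
          simp only [if_true, this]
          funext q
          simp

/-- Adding a constant pattern, controlled by a qubit. -/
theorem impl_ctrlXor {φ : Fin n} (d : BitString n) (hd : d φ = false) :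
    Impl (fun s t => t = if s φ then (fun q => s q ^^ d q) else s) n := by
  suffices h : ∀ l : List (Fin n), l.Nodup →
      Impl (fun s t => t = if s φ then (fun q => s q ^^ (d q && decide (q ∈ l))) else s)
        l.length by
    refine (h _ (List.nodup_finRange n)).mono ?_ (by simp)
    rintro s _ rfl
    simp
  intro l
  induction l with
  | nil => exact fun _ => Impl.id.mono (by rintro s _ rfl; simp) le_rfl
  | cons x l ih =>
    intro hl
    rw [List.nodup_cons] at hl
    by_cases hx : d x = true
    · have hφ : φ ≠ x := by rintro rfl; simp [hd] at hx
      refine ((ih hl.2).comp (impl_cnot hφ)).mono ?_ (by simp)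
      rintro s _ rfl
      refine ⟨_, rfl, ?_⟩
      funext q
      by_cases hq : q = x
      · subst hq
        cases hs : s φ <;> simp [hl.1, hx, hd, hs]
      · cases hs : s φ <;> simp [hq, hd, hs]
    · refine (ih hl.2).mono ?_ (by simp)
      rintro s _ rfl
      have : ∀ q, (d q && decide (q ∈ x :: l)) = (d q && decide (q ∈ l)) := by
        intro q
        by_cases hq : q = x
        · subst hq; simp [hx]
        · simp [hq]
      simp only [this]

/-! ### Registers -/

/-- The number stored in a register (least significant qubit first). -/
def val (s : BitString n) : List (Fin n) → ℕ
  | [] => 0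
  | x :: xs => (s x).toNat + 2 * val s xs

/-- Overwrite a register by a number. -/
def setVal (s : BitString n) : List (Fin n) → ℕ → BitString n
  | [], _ => s
  | x :: xs, v => Function.update (setVal s xs (v / 2)) x (v.testBit 0)

theorem val_lt (s : BitString n) (xs : List (Fin n)) : val s xs < 2 ^ xs.length := by
  induction xs with
  | nil => simp [val]
  | cons x xs ih =>
    have := Bool.toNat_le (s x)
    simp only [val, List.length_cons, pow_succ]
    omega

theorem val_append (s : BitString n) (xs ys : List (Fin n)) :
    val s (xs ++ ys) = val s xs + 2 ^ xs.length * val s ys := by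
  induction xs with
  | nil => simp [val]
  | cons x xs ih =>
    simp only [val, List.cons_append, ih, List.length_cons, pow_succ]
    ring

theorem val_congr {s t : BitString n} {xs : List (Fin n)} (h : ∀ x ∈ xs, s x = t x) :
    val s xs = val t xs := by
  induction xs with
  | nil => rfl
  | cons x xs ih =>
    simp only [val, h x (by simp), ih fun y hy => h y (by simp [hy])]

theorem eq_of_val_eq {s t : BitString n} {xs : List (Fin n)} (h : val s xs = val t xs) :
    ∀ x ∈ xs, s x = t x := by
  induction xs with
  | nil => simp
  | cons x xs ih =>
    simp only [val] at h
    have h1 := Bool.toNat_le (s x)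
    have h2 := Bool.toNat_le (t x)
    have h3 : (s x).toNat = (t x).toNat := by omega
    have h4 : s x = t x := by
      cases hs : s x <;> cases ht : t x <;> simp [hs, ht] at h3 ⊢
    intro y hy
    rcases List.mem_cons.1 hy with rfl | hy
    · exact h4
    · exact ih (by omega) y hy

theorem ext_val {s t : BitString n} (xs : List (Fin n)) (h : ∀ q, q ∉ xs → s q = t q)
    (hv : val s xs = val t xs) : s = t := by
  funext q
  by_cases hq : q ∈ xs
  · exact eq_of_val_eq hv q hq
  · exact h q hq

theorem setVal_of_notMem {s : BitString n} {xs : List (Fin n)} {q : Fin n} (h : q ∉ xs) (v : ℕ) :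
    setVal s xs v q = s q := by
  induction xs generalizing v with
  | nil => rfl
  | cons x xs ih =>
    simp only [List.mem_cons, not_or] at h
    rw [setVal, Function.update_of_ne h.1, ih h.2]

theorem val_setVal (s : BitString n) {xs : List (Fin n)} (h : xs.Nodup) (v : ℕ) :
    val (setVal s xs v) xs = v % 2 ^ xs.length := by
  induction xs generalizing v with
  | nil => simp [val, Nat.mod_one]
  | cons x xs ih =>
    rw [List.nodup_cons] at h
    have hc : val (setVal s (x :: xs) v) xs = val (setVal s xs (v / 2)) xs :=
      val_congr fun y hy => by
        rw [setVal, Function.update_of_ne (by rintro rfl; exact h.1 hy)]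
    rw [val, hc, ih h.2]
    simp only [setVal, Function.update_self, List.length_cons]
    have h1 : (v.testBit 0).toNat = v % 2 := by
      rw [Nat.testBit_zero]
      rcases Nat.mod_two_eq_zero_or_one v with h | h <;> simp [h]
    rw [h1, pow_succ, mul_comm _ 2, Nat.mod_mul]

theorem setVal_eq_iff {s t : BitString n} {xs : List (Fin n)} (h : xs.Nodup) (v : ℕ) :
    t = setVal s xs v ↔ (∀ q, q ∉ xs → t q = s q) ∧ val t xs = v % 2 ^ xs.length := by
  constructor
  · rintro rfl
    exact ⟨fun q hq => setVal_of_notMem hq v, val_setVal s h v⟩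
  · rintro ⟨h1, h2⟩
    exact ext_val xs (fun q hq => by rw [h1 q hq, setVal_of_notMem hq])
      (by rw [h2, val_setVal s h])

theorem setVal_mem {s t : BitString n} {xs : List (Fin n)} (v : ℕ) {q : Fin n}
    (hq : q ∈ xs) : setVal s xs v q = setVal t xs v q := by
  induction xs generalizing v with
  | nil => simp at hq
  | cons x xs ih =>
    simp only [setVal]
    by_cases h : q = x
    · subst h; simp
    · rw [Function.update_of_ne h, Function.update_of_ne h]
      exact ih _ ((List.mem_cons.1 hq).resolve_left h)

theorem setVal_val (s : BitString n) {xs : List (Fin n)} (h : xs.Nodup) :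
    setVal s xs (val s xs) = s := by
  symm
  rw [setVal_eq_iff h]
  exact ⟨fun _ _ => rfl, (Nat.mod_eq_of_lt (val_lt s xs)).symm⟩

theorem setVal_setVal (s : BitString n) {xs : List (Fin n)} (h : xs.Nodup) (v w : ℕ) :
    setVal (setVal s xs v) xs w = setVal s xs w := by
  rw [setVal_eq_iff h]
  exact ⟨fun q hq => by rw [setVal_of_notMem hq, setVal_of_notMem hq], val_setVal _ h w⟩

theorem setVal_congr_mod (s : BitString n) {xs : List (Fin n)} (h : xs.Nodup) {v w : ℕ}
    (hvw : v ≡ w [MOD 2 ^ xs.length]) : setVal s xs v = setVal s xs w := by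
  rw [setVal_eq_iff h]
  exact ⟨fun q hq => setVal_of_notMem hq v, by rw [val_setVal s h]; exact hvw⟩

theorem impl_loadVal (ys us : List (Fin n)) (hn : us.Nodup) (hd : ∀ u ∈ us, u ∉ ys)
    (f : List Bool → ℕ) :
    Impl (fun s t => (∀ u ∈ us, s u = false) ∧ t = setVal s us (f (ys.map s)))
      (us.length * (3 * 2 ^ ys.length)) := by
  induction us generalizing f with
  | nil => exact Impl.id.mono (by rintro s _ ⟨-, rfl⟩; rfl) (by simp)
  | cons u us ih =>
    rw [List.nodup_cons] at hn
    refine ((ih hn.2 (fun v hv => hd v (by simp [hv])) (fun v => f v / 2)).comp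
      (impl_load u ys (hd u (by simp)) fun v => (f v).testBit 0)).mono ?_
      (by rw [List.length_cons]; ring_nf; rfl)
    rintro s _ ⟨h, rfl⟩
    refine ⟨_, ⟨fun v hv => h v (by simp [hv]), rfl⟩, ?_, ?_⟩
    · rw [setVal_of_notMem hn.1]; exact h u (by simp)
    · rw [setVal]
      congr 2
      exact congrArg f (List.map_congr_left fun y hy => (setVal_of_notMem (fun hy' =>
        hd y (by simp [hy']) hy) _).symm)

/-! ### Addition -/

/-- The ripple-carry adder with carry-in `z`. -/
theorem impl_adder (z : Fin n) (xs as : List (Fin n)) (hl : xs.length = as.length)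
    (hn : (z :: (xs ++ as)).Nodup) :
    Impl (fun s t => t = setVal s xs (val s xs + val s as + (s z).toNat)) (26 * xs.length) := by
  induction xs generalizing z as with
  | nil => exact Impl.id.mono (by rintro s _ rfl; rfl) (by simp)
  | cons x xs ih =>
    cases as with
    | nil => simp at hl
    | cons a as =>
      simp only [List.nodup_cons, List.cons_append, List.mem_cons, List.mem_append, not_or,
        List.nodup_append] at hn
      obtain ⟨⟨hzx, hzxs, hza, hzas⟩, ⟨hxxs, hxa, hxas⟩, hnxs, ⟨haas, hnas⟩, hdis⟩ := hn
      have haxs : a ∉ xs := fun h => hdis a h a (Or.inl rfl) rfl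
      have hn' : (a :: (xs ++ as)).Nodup := by
        simp only [List.nodup_cons, List.mem_append, not_or, List.nodup_append]
        exact ⟨⟨haxs, haas⟩, hnxs, hnas, fun b hb c hc => hdis b hb c (Or.inr hc)⟩
      -- The first three gates turn `a` into the majority of `x`, `a`, `z`, that is, the carry,
      -- which is the carry-in for the remaining bits. Then `a` and `z` are restored and `x`
      -- receives the sum bit, so no carry register is needed.
      refine ((impl_cnot (p := a) (q := x) (Ne.symm hxa)).comp
        ((impl_cnot (p := a) (q := z) (Ne.symm hza)).comp
        ((impl_toffoli (a := z) (b := x) (t := a) hzx (Ne.symm hza) (Ne.symm hxa)).comp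
        ((ih a as (by simpa using hl) hn').comp
        ((impl_toffoli (a := z) (b := x) (t := a) hzx (Ne.symm hza) (Ne.symm hxa)).comp
        ((impl_cnot (p := a) (q := z) (Ne.symm hza)).comp
        (impl_cnot (p := z) (q := x) hzx))))))).mono ?_ (by simp only [List.length_cons]; omega)
      rintro s _ rfl
      refine ⟨_, rfl, _, rfl, _, rfl, _, rfl, _, rfl, _, rfl, ?_⟩
      generalize hs3 : Function.update (Function.update (Function.update s x (s x ^^ s a)) z _) a _
        = s3
      have h3 : ∀ q, q ≠ x → q ≠ z → q ≠ a → s3 q = s q := by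
        intro q h1 h2 h3
        rw [← hs3]; simp [h1, h2, h3]
      have h3x : s3 x = (s x ^^ s a) := by
        rw [← hs3]; simp [hxa, Ne.symm hzx]
      have h3z : s3 z = (s z ^^ s a) := by
        rw [← hs3]; simp [hzx, hza, Ne.symm hxa]
      have h3a : s3 a = (s a ^^ ((s z ^^ s a) && (s x ^^ s a))) := by
        rw [← hs3]; simp [hzx, Ne.symm hza, Ne.symm hxa, Ne.symm hzx]
      have hvx : val s3 xs = val s xs := val_congr fun q hq =>
        h3 q (by rintro rfl; exact hxxs hq) (by rintro rfl; exact hzxs hq)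
          (by rintro rfl; exact haxs hq)
      have hva : val s3 as = val s as := val_congr fun q hq =>
        h3 q (by rintro rfl; exact hxas hq) (by rintro rfl; exact hzas hq)
          (by rintro rfl; exact haas hq)
      have hV : (val s (x :: xs) + val s (a :: as) + (s z).toNat) / 2 =
          val s3 xs + val s3 as + (s3 a).toNat := by
        rw [hvx, hva, h3a]
        simp only [val]
        cases s x <;> cases s a <;> cases s z <;> simp <;> omega
      have hV0 : (val s (x :: xs) + val s (a :: as) + (s z).toNat).testBit 0 =
          (s x ^^ s a ^^ s z) := by
        rw [Nat.testBit_zero, Bool.eq_iff_iff, decide_eq_true_iff]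
        simp only [val]
        cases s x <;> cases s a <;> cases s z <;> simp <;> omega
      rw [setVal, hV, hV0]
      generalize val s3 xs + val s3 as + (s3 a).toNat = V
      have e1 : setVal s3 xs V x = (s x ^^ s a) := by rw [setVal_of_notMem hxxs, h3x]
      have e2 : setVal s3 xs V z = (s z ^^ s a) := by rw [setVal_of_notMem hzxs, h3z]
      have e3 : setVal s3 xs V a = (s a ^^ ((s z ^^ s a) && (s x ^^ s a))) := by
        rw [setVal_of_notMem haxs, h3a]
      funext q
      by_cases hqx : q = x
      · subst hqx
        simp [e1, e2, e3, Ne.symm hzx, hza, hxa]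
      · by_cases hqz : q = z
        · subst hqz
          simp [e1, e2, e3, hzx, Ne.symm hzx, hza, hxa,
            setVal_of_notMem hzxs]
        · by_cases hqa : q = a
          · subst hqa
            simp [e1, e2, e3, Ne.symm hzx, hza, hxa, Ne.symm hxa, Ne.symm hza,
              setVal_of_notMem haxs]
          · simp only [Function.update_of_ne hqx, Function.update_of_ne hqz,
              Function.update_of_ne hqa]
            by_cases hq : q ∈ xs
            · exact setVal_mem _ hq
            · rw [setVal_of_notMem hq, setVal_of_notMem hq, h3 q hqx hqz hqa]

end Arithmetic

/-! ### Addition with borrowed qubits -/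

section BatchAddition

variable {n : ℕ}

theorem val_append_setVal_right {s : BitString n} {lo hi : List (Fin n)}
    (h : (lo ++ hi).Nodup) (v : ℕ) :
    val (setVal s hi v) (lo ++ hi) = val s lo + 2 ^ lo.length * (v % 2 ^ hi.length) := by
  rw [List.nodup_append] at h
  rw [val_append, val_setVal s h.2.1]
  congr 1
  exact val_congr fun q hq => setVal_of_notMem (fun hq' => h.2.2 q hq q hq' rfl) v

theorem val_setVal_of_disjoint {s : BitString n} {xs ys : List (Fin n)}
    (h : ∀ x ∈ xs, x ∉ ys) (v : ℕ) : val (setVal s ys v) xs = val s xs :=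
  val_congr fun q hq => setVal_of_notMem (h q hq) v

/-- Addition of a short register into a longer one, with the help of qubits `g` in an arbitrary
state: the number in `g` is first subtracted from the upper part and then added again. -/
theorem impl_dirtyAdd (z : Fin n) (xs us g : List (Fin n)) (hn : (z :: (xs ++ (us ++ g))).Nodup)
    (h1 : us.length ≤ xs.length) (h2 : xs.length ≤ us.length + g.length) :
    Impl (fun s t => s z = false ∧ t = setVal s xs (val s xs + val s us)) (52 * xs.length) := by
  obtain ⟨lo, hi, rfl, hlo⟩ : ∃ lo hi, xs = lo ++ hi ∧ lo.length = us.length :=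
    ⟨xs.take us.length, xs.drop us.length, (List.take_append_drop _ _).symm, by simpa using h1⟩
  obtain ⟨g₁, g₂, rfl, hg⟩ : ∃ g₁ g₂, g = g₁ ++ g₂ ∧ g₁.length = hi.length :=
    ⟨g.take hi.length, g.drop hi.length, (List.take_append_drop _ _).symm, by
      simp only [List.length_append] at h2
      simp; omega⟩
  have hn1 : (z :: (hi ++ g₁)).Nodup := by
    refine hn.sublist (List.Sublist.cons_cons _ ?_)
    exact List.Sublist.append (List.sublist_append_right lo hi)
      ((List.sublist_append_left g₁ g₂).trans (List.sublist_append_right us _))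
  have hn2 : (z :: ((lo ++ hi) ++ (us ++ g₁))).Nodup := by
    refine hn.sublist (List.Sublist.cons_cons _ ?_)
    exact List.Sublist.append (List.Sublist.refl _)
      (List.Sublist.append (List.Sublist.refl _) (List.sublist_append_left g₁ g₂))
  refine (((impl_adder z hi g₁ hg.symm hn1).inv).comp
    (impl_adder z (lo ++ hi) (us ++ g₁) (by simp [hlo, hg]) hn2)).mono ?_
    (by simp only [List.length_append]; omega)
  rintro s _ ⟨hz, rfl⟩
  have hnx : (lo ++ hi).Nodup := (List.nodup_append.1 (List.nodup_cons.1 hn2).2).1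
  have hnh : hi.Nodup := (List.nodup_append.1 hnx).2.1
  have hzx : z ∉ hi := fun h => (List.nodup_cons.1 hn2).1 (by simp [h])
  have hdis : ∀ q ∈ us ++ g₁, q ∉ hi := fun q hq hq' =>
    (List.nodup_append.1 (List.nodup_cons.1 hn2).2).2.2 q (by simp [hq']) q hq rfl
  have hG := val_lt s g₁
  set G := val s g₁ with hGdef
  set H := val s hi with hH
  -- The summand 2^|hi| keeps the truncated subtraction exact and disappears modulo 2^|hi|.
  set s1 := setVal s hi (H + 2 ^ hi.length - G) with hs1
  have hGs : val s1 (us ++ g₁) = val s us + 2 ^ us.length * G := by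
    rw [hs1, val_setVal_of_disjoint hdis, val_append]
  have hG1 : val s1 g₁ = G := by
    rw [hs1, val_setVal_of_disjoint fun q hq => hdis q (by simp [hq])]
  have hz1 : s1 z = false := by rw [hs1, setVal_of_notMem hzx, hz]
  have hmod : (H + 2 ^ hi.length - G) % 2 ^ hi.length + G ≡ H [MOD 2 ^ hi.length] := by
    have : (H + 2 ^ hi.length - G) % 2 ^ hi.length + G ≡ (H + 2 ^ hi.length - G) + G
        [MOD 2 ^ hi.length] := Nat.ModEq.add_right _ (Nat.mod_modEq _ _)
    refine this.trans ?_
    rw [hg] at hG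
    rw [Nat.sub_add_cancel (by omega)]
    simp [Nat.ModEq]
  refine ⟨s1, ?_, ?_⟩
  · rw [hG1, hz1, hs1, val_setVal s hnh, setVal_setVal s hnh]
    simp only [Bool.toNat_false, add_zero]
    rw [setVal_congr_mod s hnh hmod, hH, setVal_val s hnh]
  · rw [hGs, hz1, hs1, val_append_setVal_right hnx]
    simp only [Bool.toNat_false, add_zero]
    have e : ∀ v, setVal (setVal s hi (H + 2 ^ hi.length - G)) (lo ++ hi) v
        = setVal s (lo ++ hi) v := by
      intro v
      rw [setVal_eq_iff hnx]
      refine ⟨fun q hq => ?_, val_setVal _ hnx v⟩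
      rw [setVal_of_notMem hq, setVal_of_notMem fun h => hq (by simp [h])]
    rw [e, val_append]
    refine setVal_congr_mod s hnx ?_
    have := (hmod.symm.mul_left' (2 ^ lo.length)).add_left (val s lo + val s us)
    rw [← pow_add, ← List.length_append] at this
    convert this using 1
    · ring
    · rw [← hlo]; ring

/-- Toggle a qubit by the carry of an addition. -/
theorem impl_carry (z c p : Fin n) (xs us g : List (Fin n))
    (hn : (z :: ((xs ++ [c]) ++ (us ++ (p :: g)))).Nodup)
    (h1 : us.length ≤ xs.length) (h2 : xs.length ≤ us.length + g.length) :
    Impl (fun s t => s z = false ∧ s c = false ∧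
      t = Function.update s p (s p ^^ decide (2 ^ xs.length ≤ val s xs + val s us)))
      (104 * xs.length + 105) := by
  have hpc : c ≠ p := by
    rintro rfl
    simp [List.nodup_append] at hn
  -- The clean qubit `c` extends the register and catches the carry. The target `p` is itself
  -- borrowed; that it may change before the addition is undone is harmless, since the effect of
  -- `impl_dirtyAdd` does not depend on the contents of the borrowed qubits.
  have hadd := impl_dirtyAdd z (xs ++ [c]) us (p :: g) hn (by simp; omega) (by simp; omega)
  refine (hadd.comp ((impl_cnot hpc).comp hadd.inv)).mono ?_ (by simp; omega)
  rintro s _ ⟨hz, hc, rfl⟩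
  have hnx : (xs ++ [c]).Nodup := (List.nodup_append.1 (List.nodup_cons.1 hn).2).1
  have hzx : z ∉ xs ++ [c] := fun h => (List.nodup_cons.1 hn).1 (List.mem_append_left _ h)
  have hdis : ∀ q ∈ xs ++ [c], q ∉ us ++ p :: g := fun q hq hq' =>
    (List.nodup_append.1 (List.nodup_cons.1 hn).2).2.2 q hq q hq' rfl
  have hpx : p ∉ xs ++ [c] := fun h => hdis p h (by simp)
  have hpus : p ∉ us := by
    intro h
    have := (List.nodup_append.1 (List.nodup_append.1 (List.nodup_cons.1 hn).2).2.1).2.2 p h p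
      (by simp)
    exact this rfl
  have hzp : z ≠ p := by
    rintro rfl
    exact (List.nodup_cons.1 hn).1 (by simp)
  have hv : val s (xs ++ [c]) = val s xs := by rw [val_append]; simp [val, hc]
  set V := val s xs + val s us with hV
  have hlt : V < 2 ^ (xs.length + 1) := by
    have a := val_lt s xs
    have b := val_lt s us
    have c : 2 ^ us.length ≤ 2 ^ xs.length := Nat.pow_le_pow_right (by norm_num) h1
    rw [pow_succ]; omega
  have hcV : setVal s (xs ++ [c]) V c = decide (2 ^ xs.length ≤ V) := by
    have h := val_setVal s hnx V
    rw [List.length_append, List.length_singleton, Nat.mod_eq_of_lt hlt, val_append] at h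
    have h' := val_lt (setVal s (xs ++ [c]) V) xs
    simp only [val] at h
    cases hb : setVal s (xs ++ [c]) V c
    · simp [hb] at h
      symm
      simp only [decide_eq_false_iff_not, not_le]
      omega
    · simp [hb] at h
      symm
      simp only [decide_eq_true_eq]
      omega
  refine ⟨_, ⟨hz, rfl⟩, _, rfl, ?_, ?_⟩
  · rw [Function.update_of_ne hzp, hz]
  · rw [hv, setVal_of_notMem hpx, hcV]
    have hu : ∀ (t : BitString n) b (l : List (Fin n)), p ∉ l →
        val (Function.update t p b) l = val t l := fun t b l hl =>
      val_congr fun q hq => Function.update_of_ne (by rintro rfl; exact hl hq) _ _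
    rw [hu _ _ _ hpx, hu _ _ _ hpus, hv, ← hV]
    funext q
    by_cases hq : q = p
    · subst hq
      rw [setVal_of_notMem hpx]; simp
    · rw [Function.update_of_ne hq]
      by_cases hqx : q ∈ xs ++ [c]
      · exact setVal_mem _ hqx
      · rw [setVal_of_notMem hqx, setVal_of_notMem hqx, Function.update_of_ne hq]

/-- Addition of a short register into a longer one with three clean qubits. -/
theorem impl_addShort (z c p : Fin n) (xs us : List (Fin n))
    (hn : (z :: c :: p :: (xs ++ us)).Nodup) (h0 : 0 < us.length) (h1 : us.length ≤ xs.length) :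
    Impl (fun s t => s z = false ∧ s c = false ∧ s p = false ∧
      t = setVal s xs (val s xs + val s us)) (260 * xs.length + 210) := by
  rcases h1.lt_or_eq with hlt | heq
  swap
  · refine (impl_dirtyAdd z xs us [] ?_ h1 (by simp [heq])).mono ?_ (by omega)
    · rw [List.append_nil]
      refine hn.sublist (List.Sublist.cons_cons _ ?_)
      exact (List.sublist_cons_self p _).trans (List.sublist_cons_self c _)
    · rintro s t ⟨hz, -, -, rfl⟩
      exact ⟨hz, rfl⟩
  -- The register is cut so that each part is long enough to be lent to the other: in the middle, or
  -- after the length of the addend if that is longer.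
  obtain ⟨A, B, rfl, hA, hB0, hAB, hBA⟩ : ∃ A B, xs = A ++ B ∧ us.length ≤ A.length ∧
      0 < B.length ∧ A.length ≤ us.length + B.length ∧ B.length ≤ A.length + 1 := by
    refine ⟨xs.take (max us.length (xs.length / 2)), xs.drop (max us.length (xs.length / 2)),
      (List.take_append_drop _ _).symm, ?_, ?_, ?_, ?_⟩ <;> simp <;> omega
  simp only [List.nodup_cons, List.mem_cons, List.mem_append, not_or, List.nodup_append] at hn
  obtain ⟨⟨hzc, hzp, ⟨hzA, hzB⟩, hzu⟩, ⟨hcp, ⟨hcA, hcB⟩, hcu⟩, ⟨⟨hpA, hpB⟩, hpu⟩, ⟨hnA, hnB, hAB'⟩,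
    hnu, hxu⟩ := hn
  have hAu : ∀ a ∈ A, a ∉ us := fun a ha h => hxu a (Or.inl ha) a h rfl
  have hBu : ∀ a ∈ B, a ∉ us := fun a ha h => hxu a (Or.inr ha) a h rfl
  have hAB2 : ∀ a ∈ A, a ∉ B := fun a ha h => hAB' a ha a h rfl
  have hBA2 : ∀ a ∈ B, a ∉ A := fun a ha h => hAB' a h a ha rfl
  have hcarry := impl_carry z c p A us B (by
    simp only [List.nodup_cons, List.mem_cons, List.mem_append, not_or, List.nodup_append,
      List.not_mem_nil, List.nodup_nil]
    refine ⟨by tauto, ⟨hnA, by tauto, ?_⟩, ⟨hnu, by tauto, ?_⟩, ?_⟩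
    · rintro a ha b (rfl | h) rfl
      · exact hcA ha
      · exact h
    · rintro a ha b (rfl | h) rfl
      · exact hpu ha
      · exact hBu a h ha
    · rintro a (ha | rfl | h) b hb rfl
      · rcases hb with hb | rfl | hb
        · exact hAu a ha hb
        · exact hpA ha
        · exact hAB2 a ha hb
      · tauto
      · exact h) hA hAB
  have hB := impl_dirtyAdd z B [p] A (by
    simp only [List.nodup_cons, List.mem_cons, List.mem_append, not_or, List.nodup_append,
      List.not_mem_nil, List.nodup_nil]
    refine ⟨by tauto, hnB, ⟨by tauto, hnA, ?_⟩, ?_⟩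
    · rintro a (rfl | h) b hb rfl
      · exact hpA hb
      · exact h
    · rintro a ha b ((rfl | h) | hb) rfl
      · exact hpB ha
      · exact h
      · exact hBA2 a ha hb) (by simp; omega) (by simpa [add_comm] using hBA)
  have hAadd := impl_dirtyAdd z A us B (by
    simp only [List.nodup_cons, List.mem_append, not_or, List.nodup_append]
    refine ⟨by tauto, hnA, ⟨hnu, hnB, ?_⟩, ?_⟩
    · rintro a ha b hb rfl
      exact hBu a hb ha
    · rintro a ha b (hb | hb) rfl
      · exact hAu a ha hb
      · exact hAB2 a ha hb) hA hAB
  -- The carry out of `A` goes to `p` and is added to `B`. It is then cleared by computing it again,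
  -- which works because `A` and the addend are still unchanged; `A` is changed last.
  refine (hcarry.comp (hB.comp (hcarry.comp hAadd))).mono ?_
    (by simp only [List.length_append]; omega)
  rintro s _ ⟨hz, hc, hp, rfl⟩
  have hnx : (A ++ B).Nodup := List.nodup_append.2 ⟨hnA, hnB, hAB'⟩
  set κ := decide (2 ^ A.length ≤ val s A + val s us) with hκ
  set s1 := Function.update s p κ with hs1
  have hv1 : ∀ l : List (Fin n), p ∉ l → val s1 l = val s l := fun l hl =>
    val_congr fun q hq => Function.update_of_ne (by rintro rfl; exact hl hq) _ _
  set s2 := setVal s1 B (val s1 B + val s1 [p]) with hs2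
  have hs2A : val s2 A = val s A := by
    rw [hs2, val_setVal_of_disjoint hAB2, hv1 A hpA]
  have hs2u : val s2 us = val s us := by
    rw [hs2, val_setVal_of_disjoint fun u hu h => hBu u h hu, hv1 us hpu]
  have hs2p : s2 p = κ := by rw [hs2, setVal_of_notMem hpB, hs1, Function.update_self]
  have hs2z : s2 z = false := by
    rw [hs2, setVal_of_notMem hzB, hs1, Function.update_of_ne hzp, hz]
  have hs2c : s2 c = false := by
    rw [hs2, setVal_of_notMem hcB, hs1, Function.update_of_ne hcp, hc]
  set s3 := Function.update s2 p false with hs3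
  have hv3 : ∀ l : List (Fin n), p ∉ l → val s3 l = val s2 l := fun l hl =>
    val_congr fun q hq => Function.update_of_ne (by rintro rfl; exact hl hq) _ _
  refine ⟨s1, ⟨hz, hc, by rw [hs1, hp, hκ]; simp⟩, s2, ⟨?_, rfl⟩, s3, ⟨hs2z, hs2c, ?_⟩, ?_, ?_⟩
  · rw [hs1, Function.update_of_ne hzp, hz]
  · rw [hs2A, hs2u, hs2p, ← hκ, hs3]; simp
  · rw [hs3, Function.update_of_ne hzp, hs2z]
  · symm
    rw [setVal_eq_iff hnx]
    refine ⟨fun q hq => ?_, ?_⟩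
    · simp only [List.mem_append, not_or] at hq
      rw [setVal_of_notMem hq.1]
      by_cases hqp : q = p
      · subst hqp; rw [hs3, Function.update_self, hp]
      · rw [hs3, Function.update_of_ne hqp, hs2, setVal_of_notMem hq.2, hs1,
          Function.update_of_ne hqp]
    · rw [val_append, val_setVal s3 hnA, val_setVal_of_disjoint hBA2, hv3 A hpA, hv3 us hpu, hs2A,
        hs2u, hv3 B hpB, hs2, val_setVal s1 hnB, hv1 B hpB, val_append, List.length_append, pow_add]
      have hp1 : val s1 [p] = κ.toNat := by simp [val, hs1]
      rw [hp1]
      have hdm : κ.toNat = (val s A + val s us) / 2 ^ A.length := by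
        have a := val_lt s A
        have b := val_lt s us
        have d : 2 ^ us.length ≤ 2 ^ A.length := Nat.pow_le_pow_right (by norm_num) hA
        rw [hκ]
        by_cases h : 2 ^ A.length ≤ val s A + val s us
        · simp only [h, decide_true, Bool.toNat_true]
          rw [Nat.div_eq_sub_div (by positivity) h, Nat.div_eq_of_lt (by omega)]
        · simp only [h, decide_false, Bool.toNat_false]
          rw [Nat.div_eq_of_lt (by omega)]
      rw [hdm]
      generalize 2 ^ A.length = a
      generalize 2 ^ B.length = b
      have : val s A + a * val s B + val s us = (val s A + val s us) + a * val s B := by ring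
      rw [this]
      rcases Nat.eq_zero_or_pos a with rfl | ha
      · simp
      · rw [Nat.mod_mul, Nat.add_mul_mod_self_left, Nat.add_mul_div_left _ _ ha, add_comm (val s B)]

/-- Addition of a number that is a function of control qubits, digit by digit; the control qubits
may belong to the register provided that their relevant content never changes. -/
theorem impl_batchAdd (z c p : Fin n) (xs us ys : List (Fin n)) (D : ℕ)
    (hn : (z :: c :: p :: (xs ++ us)).Nodup) (hy : ∀ u ∈ us, u ∉ ys)
    (h0 : 0 < us.length) (hD : xs.length = us.length * D) (f : List Bool → ℕ) :
    Impl (fun s t => s z = false ∧ s c = false ∧ s p = false ∧ (∀ u ∈ us, s u = false) ∧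
      (∀ d ≤ f (ys.map s), f (ys.map (setVal s xs (val s xs + d))) = f (ys.map s)) ∧
      t = setVal s xs (val s xs + f (ys.map s)))
      (D * (us.length * (6 * 2 ^ ys.length) + 260 * xs.length + 210)) := by
  have hn' := hn
  simp only [List.nodup_cons, List.mem_cons, List.mem_append, not_or, List.nodup_append] at hn'
  obtain ⟨⟨hzc, hzp, hzx, hzu⟩, ⟨hcp, hcx, hcu⟩, ⟨hpx, hpu⟩, hnx, hnu, hxu⟩ := hn'
  have hux : ∀ u ∈ us, u ∉ xs := fun u hu h => hxu u h u hu rfl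
  -- After k digits the register has gained `f` modulo 2^(|us| k). This is at most `f`, so by
  -- hypothesis the controls still yield the same number, and each digit can be both loaded and
  -- unloaded.
  suffices h : ∀ k ≤ D, Impl (fun s t => s z = false ∧ s c = false ∧ s p = false ∧
      (∀ u ∈ us, s u = false) ∧
      (∀ d ≤ f (ys.map s), f (ys.map (setVal s xs (val s xs + d))) = f (ys.map s)) ∧
      t = setVal s xs (val s xs + f (ys.map s) % 2 ^ (us.length * k)))
      (k * (us.length * (6 * 2 ^ ys.length) + 260 * xs.length + 210)) by
    refine (h D le_rfl).mono ?_ le_rfl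
    rintro s _ ⟨a1, a2, a3, a4, a5, rfl⟩
    refine ⟨a1, a2, a3, a4, a5, setVal_congr_mod s hnx ?_⟩
    rw [hD]
    exact (Nat.mod_modEq _ _).symm.add_left _
  intro k
  induction k with
  | zero =>
    intro _
    refine Impl.id.mono ?_ (by simp)
    rintro s _ ⟨-, -, -, -, -, rfl⟩
    simp [Nat.mod_one, setVal_val s hnx]
  | succ k ih =>
    intro hk
    set S := us.length with hS
    have hlen : S ≤ (xs.drop (S * k)).length := by
      rw [List.length_drop, hD]
      have : S * k + S ≤ S * D := by
        rw [← Nat.mul_succ]; exact Nat.mul_le_mul_left _ hk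
      omega
    have hnd : (z :: c :: p :: (xs.drop (S * k) ++ us)).Nodup :=
      hn.sublist (((List.Sublist.append (List.drop_sublist _ _)
        (List.Sublist.refl _)).cons_cons _).cons_cons _ |>.cons_cons _)
    have hload := impl_loadVal ys us hnu hy fun v => f v / 2 ^ (S * k)
    have hadd := impl_addShort z c p (xs.drop (S * k)) us hnd h0 hlen
    refine ((ih (by omega)).comp (hload.comp (hadd.comp hload.inv))).mono ?_ ?_
    · rintro s _ ⟨hz, hc, hp, hu, hf, rfl⟩
      set C := f (ys.map s) with hC
      set a := C % 2 ^ (S * k) with ha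
      set s1 := setVal s xs (val s xs + a) with hs1
      have hfs1 : f (ys.map s1) = C := hf _ (Nat.mod_le _ _)
      have hs1' : ∀ q, q ∉ xs → s1 q = s q := fun q hq => setVal_of_notMem hq _
      set g := C / 2 ^ (S * k) with hg
      set s2 := setVal s1 us g with hs2
      have hus2 : val s2 us = g % 2 ^ S := val_setVal s1 hnu g
      set dx := xs.drop (S * k) with hdx
      have hdxs : ∀ q ∈ dx, q ∈ xs := fun q hq => List.mem_of_mem_drop hq
      have hndx : dx.Nodup := hnx.sublist (List.drop_sublist _ _)
      set T := val s xs + C % 2 ^ (S * (k + 1)) with hT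
      set t := setVal s xs T with ht
      have hft : f (ys.map t) = C := hf _ (Nat.mod_le _ _)
      have hs2q : ∀ q, q ∉ us → s2 q = s1 q := fun q hq => setVal_of_notMem hq _
      have htu : ∀ u ∈ us, t u = false := fun u hu' => by
        rw [ht, setVal_of_notMem (hux u hu'), hu u hu']
      refine ⟨s1, ⟨hz, hc, hp, hu, hf, rfl⟩, s2, ⟨?_, ?_⟩, setVal t us g,
        ⟨?_, ?_, ?_, ?_⟩, htu, ?_⟩
      · intro u hu'; rw [hs1' u (hux u hu'), hu u hu']
      · show s2 = setVal s1 us (f (ys.map s1) / 2 ^ (S * k))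
        rw [hfs1]
      · rw [hs2q z hzu, hs1' z hzx, hz]
      · rw [hs2q c hcu, hs1' c hcx, hc]
      · rw [hs2q p hpu, hs1' p hpx, hp]
      · rw [hus2, setVal_eq_iff hndx]
        have hxsplit : xs = xs.take (S * k) ++ dx := (List.take_append_drop _ _).symm
        have htl : (xs.take (S * k)).length = S * k := by
          rw [List.length_take, hD, min_eq_left]
          exact Nat.mul_le_mul_left _ (by omega)
        have hvx1 : val s1 xs = (val s xs + a) % 2 ^ xs.length := val_setVal s hnx _
        have hvt : val t xs = T % 2 ^ xs.length := val_setVal s hnx _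
        have hlenx : xs.length = S * k + dx.length := by
          conv_lhs => rw [hxsplit]
          rw [List.length_append, htl]
        have hTa : T = (val s xs + a) + 2 ^ (S * k) * (g % 2 ^ S) := by
          rw [hT, ha, hg, Nat.mul_succ, pow_add, Nat.mod_mul]; ring
        have hTm : T % 2 ^ (S * k) = (val s xs + a) % 2 ^ (S * k) := by
          rw [hTa, Nat.add_mul_mod_self_left]
        have hsplit1 : ∀ (r : BitString n), val r xs =
            val r (xs.take (S * k)) + 2 ^ (S * k) * val r dx := by
          intro r
          conv_lhs => rw [hxsplit]
          rw [val_append, htl]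
        have hlo : ∀ r : BitString n, val r (xs.take (S * k)) = val r xs % 2 ^ (S * k) := by
          intro r
          rw [hsplit1 r, Nat.add_mul_mod_self_left, Nat.mod_eq_of_lt]
          have := val_lt r (xs.take (S * k))
          rwa [htl] at this
        have hhi : ∀ r : BitString n, val r dx = val r xs / 2 ^ (S * k) := by
          intro r
          have := val_lt r (xs.take (S * k))
          rw [htl] at this
          rw [hsplit1 r, Nat.add_mul_div_left _ _ (by positivity), Nat.div_eq_of_lt this, zero_add]
        have hmodmod : ∀ v, v % 2 ^ xs.length % 2 ^ (S * k) = v % 2 ^ (S * k) := fun v =>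
          Nat.mod_mod_of_dvd v (pow_dvd_pow 2 (by omega))
        have hdivmod : ∀ v, v % 2 ^ xs.length / 2 ^ (S * k) = v / 2 ^ (S * k) % 2 ^ dx.length := by
          intro v
          rw [hlenx, pow_add, Nat.mod_mul_right_div_self]
        have hc2 : val s2 dx = val s1 dx := val_congr fun q hq =>
          hs2q q fun h => hux q h (hdxs q hq)
        have hct : val (setVal t us g) dx = val t dx := val_congr fun q hq =>
          setVal_of_notMem (fun h => hux q h (hdxs q hq)) _
        constructor
        · intro q hq
          by_cases hqu : q ∈ us
          · exact setVal_mem _ hqu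
          · rw [setVal_of_notMem hqu, hs2q q hqu]
            by_cases hqx : q ∈ xs
            · rw [hxsplit, List.mem_append] at hqx
              refine eq_of_val_eq ?_ q (hqx.resolve_right hq)
              rw [hlo, hlo, hvt, hvx1, hmodmod, hmodmod, hTm]
            · rw [hs1' q hqx, ht, setVal_of_notMem hqx]
        · rw [hct, hhi, hvt, hdivmod, hc2, hhi, hvx1, hdivmod, hTa,
            Nat.add_mul_div_left _ _ (by positivity)]
          simp
      · show setVal t us g = setVal t us (f (ys.map t) / 2 ^ (S * k))
        rw [hft]
    · have : (xs.drop (S * k)).length ≤ xs.length := by simp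
      have h2 : (k + 1) * (S * (6 * 2 ^ ys.length) + 260 * xs.length + 210) =
        k * (S * (6 * 2 ^ ys.length) + 260 * xs.length + 210) +
        (S * (3 * 2 ^ ys.length) + (260 * xs.length + 210 + S * (3 * 2 ^ ys.length))) := by ring
      rw [h2]
      gcongr

end BatchAddition

/-! ### Instructions on labels with two flags -/

section Machine

/-- A machine configuration: a label and two flag bits. -/
abbrev Cfg : Type := ℕ × Bool × Bool

/-- The number with given binary digits, least significant first. -/
def ofBits : List Bool → ℕ
  | [] => 0
  | b :: l => b.toNat + 2 * ofBits l

theorem ofBits_map {n : ℕ} (s : BitString n) (xs : List (Fin n)) :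
    ofBits (xs.map s) = val s xs := by
  induction xs with
  | nil => rfl
  | cons x xs ih => simp [ofBits, val, ih]

theorem val_ofFn {n len : ℕ} (s : BitString n) (g : Fin len → Fin n) (V : ℕ)
    (h : ∀ i : Fin len, s (g i) = V.testBit i) : val s (List.ofFn g) = V % 2 ^ len := by
  induction len generalizing V with
  | zero => simp [val, Nat.mod_one]
  | succ len ih =>
    rw [List.ofFn_succ, val, h 0, ih (fun i => g i.succ) (V / 2)]
    · have h1 : (V.testBit 0).toNat = V % 2 := by
        rw [Nat.testBit_zero]
        rcases Nat.mod_two_eq_zero_or_one V with h | h <;> simp [h]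
      rw [Fin.val_zero, h1, pow_succ, mul_comm _ 2, Nat.mod_mul]
    · intro i
      rw [h i.succ, Fin.val_succ, Nat.testBit_succ]

/-- The bits of a configuration on a register of `L + 2` qubits. -/
def cbit (L : ℕ) (x : Cfg) (i : ℕ) : Bool :=
  if i < L then x.1.testBit i else if i = L then x.2.1 else if i = L + 1 then x.2.2 else false

/-- The basis state of a configuration, with an additional control qubit. All other ancillas are
clean. -/
def cfgState (L S : ℕ) (x : Cfg) (φ : Bool) : BitString (L + S + 6) := fun i =>
  if (i : ℕ) = L + 2 then φ else cbit L x i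

theorem cfgState_apply (L S : ℕ) (x : Cfg) (φ : Bool) (i : Fin (L + S + 6)) :
    cfgState L S x φ i = if (i : ℕ) = L + 2 then φ else cbit L x i := rfl

theorem cfgState_eq_bits {L S v : ℕ} (hv : v < 2 ^ L) :
    cfgState L S (v, false, false) false = bits (L + S + 6) v := by
  funext i
  have : ¬ (i : ℕ) < L → v.testBit i = false := fun h =>
    Nat.testBit_eq_false_of_lt (hv.trans_le (Nat.pow_le_pow_right (by norm_num) (by omega)))
  simp only [cfgState, cbit, bits]
  split_ifs <;> first | rfl | (symm; apply this; omega)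

variable {L S : ℕ}

/-- A circuit with at most `ℓ` gates carries the configuration `x` to `y` whenever `R x y`. -/
def MImpl (L S : ℕ) (R : Cfg → Cfg → Prop) (ℓ : ℕ) : Prop :=
  Impl (n := L + S + 6) (fun s t => ∃ x y : Cfg, x.1 < 2 ^ L ∧ y.1 < 2 ^ L ∧ R x y ∧
    s = cfgState L S x false ∧ t = cfgState L S y false) ℓ

theorem MImpl.mono {R R' : Cfg → Cfg → Prop} {ℓ ℓ' : ℕ} (h : MImpl L S R ℓ)
    (hR : ∀ x y : Cfg, x.1 < 2 ^ L → y.1 < 2 ^ L → R' x y → R x y) (hℓ : ℓ ≤ ℓ') :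
    MImpl L S R' ℓ' := by
  refine Impl.mono h ?_ hℓ
  rintro s t ⟨x, y, hx, hy, h, rfl, rfl⟩
  exact ⟨x, y, hx, hy, hR x y hx hy h, rfl, rfl⟩

theorem MImpl.comp {R R' : Cfg → Cfg → Prop} {ℓ ℓ' : ℕ} (h : MImpl L S R ℓ)
    (h' : MImpl L S R' ℓ') :
    MImpl L S (fun x z => ∃ y : Cfg, y.1 < 2 ^ L ∧ R x y ∧ R' y z) (ℓ + ℓ') := by
  refine Impl.mono (Impl.comp h h') ?_ le_rfl
  rintro s t ⟨x, z, hx, hz, ⟨y, hy, h1, h2⟩, rfl, rfl⟩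
  exact ⟨_, ⟨x, y, hx, hy, h1, rfl, rfl⟩, ⟨y, z, hy, hz, h2, rfl, rfl⟩⟩

theorem MImpl.inv {R : Cfg → Cfg → Prop} {ℓ : ℕ} (h : MImpl L S R ℓ) :
    MImpl L S (fun x y => R y x) ℓ := by
  refine Impl.mono (Impl.inv h) ?_ le_rfl
  rintro s t ⟨x, y, hx, hy, h, rfl, rfl⟩
  exact ⟨y, x, hy, hx, h, rfl, rfl⟩

theorem MImpl.id : MImpl L S (fun x y => y = x) 0 := by
  refine Impl.mono Impl.id ?_ le_rfl
  rintro s t ⟨x, y, -, -, rfl, rfl, rfl⟩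
  rfl

/-- A sequence of instructions of which at most one acts. -/
theorem MImpl.list {ι : Type*} {R : ι → Cfg → Cfg → Prop} {ℓ : ℕ} (l : List ι) (hl : l.Nodup)
    (h : ∀ i ∈ l, MImpl L S (R i) ℓ) :
    MImpl L S (fun x y => (y = x ∧ ∀ i ∈ l, R i x x) ∨
      ∃ i ∈ l, R i x y ∧ ∀ i' ∈ l, i' ≠ i → R i' x x ∧ R i' y y) (l.length * ℓ) := by
  induction l with
  | nil =>
    refine MImpl.id.mono ?_ (by simp)
    rintro x y - - (⟨rfl, -⟩ | ⟨i, hi, -⟩)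
    · rfl
    · simp at hi
  | cons a l ih =>
    rw [List.nodup_cons] at hl
    refine ((h a (by simp)).comp (ih hl.2 fun i hi => h i (by simp [hi]))).mono ?_
      (by rw [List.length_cons]; ring_nf; rfl)
    rintro x y hx hy (⟨rfl, h1⟩ | ⟨i, hi, h1, h2⟩)
    · exact ⟨y, hy, h1 a (by simp), Or.inl ⟨rfl, fun i hi => h1 i (by simp [hi])⟩⟩
    · rcases List.mem_cons.1 hi with rfl | hi'
      · refine ⟨y, hy, h1, Or.inl ⟨rfl, fun j hj => (h2 j (by simp [hj]) ?_).2⟩⟩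
        rintro rfl; exact hl.1 hj
      · refine ⟨x, hx, (h2 a (by simp) ?_).1, Or.inr ⟨i, hi', h1, fun j hj hji =>
          h2 j (by simp [hj]) hji⟩⟩
        rintro rfl; exact hl.1 hi'

/-! ### Instructions -/

/-- The qubit with a given index. -/
abbrev qubit (L S i : ℕ) (h : i < L + S + 6) : Fin (L + S + 6) := ⟨i, h⟩

/-- The label register. -/
def labelReg (L S : ℕ) : List (Fin (L + S + 6)) :=
  List.ofFn fun i : Fin L => qubit L S i (by omega)

/-- The register for digits. -/
def digitReg (L S : ℕ) : List (Fin (L + S + 6)) :=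
  List.ofFn fun i : Fin S => qubit L S (L + 6 + i) (by omega)

/-- The flags and the `T` topmost qubits of the label register. -/
def controlReg (L S T : ℕ) : List (Fin (L + S + 6)) :=
  qubit L S L (by omega) :: qubit L S (L + 1) (by omega) ::
    -- The minimum only keeps the index in range; for T ≤ L it never acts.
    List.ofFn fun i : Fin T => qubit L S (min (L - T + i) L) (by omega)

theorem mem_labelReg (q : Fin (L + S + 6)) : q ∈ labelReg L S ↔ (q : ℕ) < L := by
  simp only [labelReg, List.mem_ofFn, Fin.ext_iff]
  constructor
  · rintro ⟨i, hi⟩; omega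
  · intro h; exact ⟨⟨q, h⟩, rfl⟩

theorem mem_digitReg (q : Fin (L + S + 6)) : q ∈ digitReg L S ↔ L + 6 ≤ (q : ℕ) := by
  simp only [digitReg, List.mem_ofFn, Fin.ext_iff]
  constructor
  · rintro ⟨i, hi⟩; omega
  · intro h; exact ⟨⟨q - (L + 6), by omega⟩, by simp; omega⟩

theorem nodup_labelReg : (labelReg L S).Nodup :=
  List.nodup_ofFn.2 fun i j h => by simpa [Fin.ext_iff] using h

theorem nodup_digitReg : (digitReg L S).Nodup :=
  List.nodup_ofFn.2 fun i j h => by simpa [Fin.ext_iff] using h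

theorem val_labelReg {x : Cfg} (hx : x.1 < 2 ^ L) (φ : Bool) :
    val (cfgState L S x φ) (labelReg L S) = x.1 := by
  rw [labelReg, val_ofFn _ _ x.1, Nat.mod_eq_of_lt hx]
  intro i
  simp only [cfgState, cbit]
  rw [if_neg (by omega), if_pos (by omega)]

theorem setVal_labelReg (x : Cfg) (φ : Bool) {v : ℕ} (hv : v < 2 ^ L) :
    setVal (cfgState L S x φ) (labelReg L S) v = cfgState L S (v, x.2) φ := by
  symm
  rw [setVal_eq_iff nodup_labelReg]
  constructor
  · intro q hq
    rw [mem_labelReg] at hq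
    simp [cfgState, cbit, hq]
  · rw [val_labelReg (x := (v, x.2)) hv]
    rw [Nat.mod_eq_of_lt]
    simpa [labelReg] using hv

/-- A function of the `T` topmost bits and the flags, as a function of the control qubits. -/
def onControls {α : Type*} (C : ℕ → Bool → Bool → α) : List Bool → α
  | e :: w :: l => C (ofBits l) e w
  | _ => C 0 false false

theorem length_controlReg (T : ℕ) : (controlReg L S T).length = T + 2 := by
  simp [controlReg]

theorem onControls_map {α : Type*} (C : ℕ → Bool → Bool → α) {T : ℕ} (hT : T ≤ L) {x : Cfg}
    (hx : x.1 < 2 ^ L) (φ : Bool) :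
    onControls C ((controlReg L S T).map (cfgState L S x φ)) =
      C (x.1 / 2 ^ (L - T)) x.2.1 x.2.2 := by
  simp only [controlReg, List.map_cons, onControls]
  rw [ofBits_map, val_ofFn _ _ (x.1 / 2 ^ (L - T))]
  · rw [Nat.mod_eq_of_lt]
    · simp [cfgState, cbit]
    · rw [Nat.div_lt_iff_lt_mul (by positivity), ← pow_add]
      rwa [Nat.add_sub_cancel' hT]
  · intro i
    have : min (L - T + (i : ℕ)) L = L - T + i := by omega
    simp only [cfgState, cbit, Nat.testBit_div_two_pow, this]
    rw [if_neg (by omega), if_pos (by omega)]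
    congr 1; omega

theorem mem_controlReg {T : ℕ} {q : Fin (L + S + 6)} (h : q ∈ controlReg L S T) :
    (q : ℕ) < L + 2 := by
  simp only [controlReg, List.mem_cons, List.mem_ofFn, Fin.ext_iff] at h
  rcases h with h | h | ⟨i, hi⟩ <;> omega

/-- Addition of a number that depends on the flags and on the topmost bits. -/
theorem mImpl_add {T D : ℕ} (hT : T ≤ L) (hS : 0 < S) (hD : L = S * D)
    (C : ℕ → Bool → Bool → ℕ) :
    MImpl L S (fun x y => (∀ d ≤ C (x.1 / 2 ^ (L - T)) x.2.1 x.2.2,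
        C ((x.1 + d) / 2 ^ (L - T)) x.2.1 x.2.2 = C (x.1 / 2 ^ (L - T)) x.2.1 x.2.2) ∧
        y = (x.1 + C (x.1 / 2 ^ (L - T)) x.2.1 x.2.2, x.2))
      (D * (S * (6 * 2 ^ (T + 2)) + 260 * L + 210)) := by
  have hlen : (labelReg L S).length = L := by simp [labelReg]
  have hlen' : (digitReg L S).length = S := by simp [digitReg]
  have := impl_batchAdd (qubit L S (L + 3) (by omega)) (qubit L S (L + 4) (by omega))
    (qubit L S (L + 5) (by omega)) (labelReg L S) (digitReg L S) (controlReg L S T) D ?_ ?_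
    (by rw [hlen']; exact hS) (by rw [hlen, hlen', hD]) (onControls C)
  · rw [hlen, hlen', length_controlReg] at this
    refine this.mono ?_ le_rfl
    rintro s t ⟨x, y, hx, hy, ⟨hC, rfl⟩, rfl, rfl⟩
    have hclean : ∀ q : Fin (L + S + 6), L + 3 ≤ (q : ℕ) → cfgState L S x false q = false := by
      intro q hq
      simp only [cfgState, cbit]
      split_ifs <;> first | rfl | omega
    refine ⟨hclean _ (by simp), hclean _ (by simp), hclean _ (by simp), fun u hu => hclean u ?_,
      ?_, ?_⟩
    · rw [mem_digitReg] at hu; omega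
    · intro d hd
      rw [onControls_map C hT hx] at hd ⊢
      have hlt : x.1 + d < 2 ^ L := lt_of_le_of_lt (Nat.add_le_add_left hd _) hy
      rw [val_labelReg hx, setVal_labelReg x false hlt, onControls_map C hT hlt]
      exact hC d hd
    · rw [onControls_map C hT hx, val_labelReg hx, setVal_labelReg x false hy]
  · simp only [List.nodup_cons, List.mem_cons, List.mem_append, not_or, List.nodup_append,
      mem_labelReg, mem_digitReg, Fin.mk.injEq]
    refine ⟨by omega, by omega, by omega, nodup_labelReg, nodup_digitReg, ?_⟩
    rintro a ha b hb rfl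
    omega
  · intro u hu hu'
    rw [mem_digitReg] at hu
    have := mem_controlReg hu'
    omega

/-- A circuit with at most `ℓ` gates carries `x` to `y` whenever `R x y`, provided that the control
qubit is set; otherwise it does nothing. -/
def CtrlImpl (L S : ℕ) (R : Cfg → Cfg → Prop) (ℓ : ℕ) : Prop :=
  Impl (n := L + S + 6) (fun s t => ∃ x y : Cfg, ∃ φ : Bool, x.1 < 2 ^ L ∧ y.1 < 2 ^ L ∧
    (if φ then R x y else y = x) ∧ s = cfgState L S x φ ∧ t = cfgState L S y φ) ℓ

theorem CtrlImpl.comp {R R' : Cfg → Cfg → Prop} {ℓ ℓ' : ℕ} (h : CtrlImpl L S R ℓ)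
    (h' : CtrlImpl L S R' ℓ') :
    CtrlImpl L S (fun x z => ∃ y : Cfg, y.1 < 2 ^ L ∧ R x y ∧ R' y z) (ℓ + ℓ') := by
  refine Impl.mono (Impl.comp h h') ?_ le_rfl
  rintro s t ⟨x, z, φ, hx, hz, hR, rfl, rfl⟩
  cases φ
  · simp only [Bool.false_eq_true, if_false] at hR
    subst hR
    exact ⟨_, ⟨z, z, false, hx, hx, by simp, rfl, rfl⟩, ⟨z, z, false, hx, hx, by simp, rfl, rfl⟩⟩
  · simp only [if_true] at hR
    obtain ⟨y, hy, h1, h2⟩ := hR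
    exact ⟨_, ⟨x, y, true, hx, hy, by simpa using h1, rfl, rfl⟩,
      ⟨y, z, true, hy, hz, by simpa using h2, rfl, rfl⟩⟩

/-- A permutation of the label and flag bits. -/
theorem ctrlImpl_perm (π : Equiv.Perm ℕ) (hπ : ∀ i, L + 2 ≤ i → π i = i) :
    CtrlImpl L S (fun x y => ∀ i < L + 2, cbit L y i = cbit L x (π i)) (13 * (L + S + 6)) := by
  have hlt : ∀ σ : Equiv.Perm ℕ, (∀ i, L + 2 ≤ i → σ i = i) → ∀ i, i < L + 2 → σ i < L + 2 := by
    intro σ hσ i hi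
    by_contra hc
    have := σ.injective (hσ (σ i) (by omega))
    omega
  have hinv : ∀ i, L + 2 ≤ i → π.symm i = i := fun i hi => by
    rw [Equiv.symm_apply_eq, hπ i hi]
  have hbd : ∀ σ : Equiv.Perm ℕ, (∀ i, L + 2 ≤ i → σ i = i) → ∀ i, i < L + S + 6 →
      σ i < L + S + 6 := by
    intro σ hσ i hi
    by_cases h : i < L + 2
    · have := hlt σ hσ i h; omega
    · rw [hσ i (by omega)]; exact hi
  let σ : Equiv.Perm (Fin (L + S + 6)) :=
    { toFun := fun i => ⟨π i, hbd π hπ i i.2⟩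
      invFun := fun i => ⟨π.symm i, hbd π.symm hinv i i.2⟩
      left_inv := fun i => by simp
      right_inv := fun i => by simp }
  refine (impl_ctrlPerm (φ := qubit L S (L + 2) (by omega)) σ ?_).mono ?_ le_rfl
  · ext; simp [σ, hπ]
  · rintro s t ⟨x, y, φ, hx, hy, hR, rfl, rfl⟩
    cases φ
    · simp only [Bool.false_eq_true, if_false] at hR
      subst hR
      simp [cfgState]
    · simp only [if_true] at hR
      simp only [cfgState_apply, if_true]
      funext i
      simp only [Function.comp, σ, Equiv.coe_fn_mk, cfgState_apply]
      by_cases h : (i : ℕ) < L + 2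
      · rw [if_neg (by omega), if_neg (by have := hlt π hπ i h; omega), hR i h]
      · rw [hπ i (by omega)]
        split_ifs
        · rfl
        · simp only [cbit]
          split_ifs <;> first | rfl | omega

/-- Adding a bit pattern to the label and the flags. -/
theorem ctrlImpl_xor (a : ℕ) (e w : Bool) :
    CtrlImpl L S (fun x y => y = (x.1 ^^^ a, x.2.1 ^^ e, x.2.2 ^^ w)) (L + S + 6) := by
  refine (impl_ctrlXor (φ := qubit L S (L + 2) (by omega)) (cfgState L S (a, e, w) false) ?_).mono
    ?_ le_rfl
  · simp [cfgState]
  · rintro s t ⟨x, y, φ, hx, hy, hR, rfl, rfl⟩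
    cases φ
    · simp only [Bool.false_eq_true, if_false] at hR
      subst hR
      simp [cfgState]
    · simp only [if_true] at hR
      subst hR
      rw [if_pos (by simp [cfgState])]
      funext i
      simp only [cfgState_apply, cbit]
      split_ifs <;> first | omega | simp

/-- An instruction under a condition on the flags and the topmost bits; the condition has to be
recognizable from the result. -/
theorem MImpl.block {T ℓ : ℕ} (hT : T ≤ L) {R : Cfg → Cfg → Prop} (h : CtrlImpl L S R ℓ)
    (p p' : ℕ → Bool → Bool → Bool) :
    MImpl L S (fun x y =>
      (p (x.1 / 2 ^ (L - T)) x.2.1 x.2.2 = true ∧ p' (y.1 / 2 ^ (L - T)) y.2.1 y.2.2 = true ∧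
        R x y) ∨
      (p (x.1 / 2 ^ (L - T)) x.2.1 x.2.2 = false ∧ p' (x.1 / 2 ^ (L - T)) x.2.1 x.2.2 = false ∧
        y = x)) (ℓ + 6 * 2 ^ (T + 2)) := by
  have hq : qubit L S (L + 2) (by omega) ∉ controlReg L S T := fun h => by
    have := mem_controlReg h
    simp at this
  have h1 := impl_load _ _ hq (onControls p)
  have h2 := (impl_load _ _ hq (onControls p')).inv
  have hup : ∀ (x : Cfg) (φ : Bool), Function.update (cfgState L S x false)
      (qubit L S (L + 2) (by omega)) φ = cfgState L S x φ := by
    intro x φ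
    funext i
    by_cases hi : i = qubit L S (L + 2) (by omega)
    · subst hi; simp [cfgState]
    · rw [Function.update_of_ne hi]
      have : (i : ℕ) ≠ L + 2 := fun h => hi (Fin.ext h)
      simp [cfgState, this]
  refine (h1.comp (Impl.comp h h2)).mono ?_ (by rw [length_controlReg]; omega)
  rintro s t ⟨x, y, hx, hy, hR, rfl, rfl⟩
  have hclean : ∀ x : Cfg, cfgState L S x false (qubit L S (L + 2) (by omega)) = false := by
    simp [cfgState]
  -- `p` sets the control qubit from the old configuration and `p'` clears it from the new one; in
  -- both alternatives of the relation the two values agree.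
  refine ⟨cfgState L S x (p (x.1 / 2 ^ (L - T)) x.2.1 x.2.2), ⟨hclean x, ?_⟩,
    cfgState L S y (p' (y.1 / 2 ^ (L - T)) y.2.1 y.2.2), ?_, ⟨hclean y, ?_⟩⟩
  · rw [onControls_map p hT hx, hup]
  · rcases hR with ⟨e1, e2, h3⟩ | ⟨e1, e2, rfl⟩
    · exact ⟨x, y, true, hx, hy, by simpa using h3, by rw [e1], by rw [e2]⟩
    · exact ⟨y, y, false, hx, hx, by simp, by rw [e1], by rw [e2]⟩
  · rw [onControls_map p' hT hy, hup]

/-- A sign that depends on the flags and the topmost bits. -/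
theorem exists_sign_circuit {T : ℕ} (hT : T ≤ L) (p : ℕ → Bool → Bool → Bool) :
    ∃ c : Circuit (L + S + 6), c.length ≤ 6 * 2 ^ (T + 2) + 1 ∧ ∀ x : Cfg, x.1 < 2 ^ L →
      c.run (ket (cfgState L S x false)) =
        (-1 : ℂ) ^ (p (x.1 / 2 ^ (L - T)) x.2.1 x.2.2).toNat •
          (ket (cfgState L S x false) : QubitSpace (L + S + 6)) := by
  have hq : qubit L S (L + 2) (by omega) ∉ controlReg L S T := fun h => by
    have := mem_controlReg h
    simp at this
  obtain ⟨c, hc, h⟩ := impl_load _ _ hq (onControls p)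
  have hne : qubit L S (L + 2) (by omega) ≠ qubit L S (L + 3) (by omega) := by simp
  -- The sign depends on the loaded qubit alone; the second qubit of the gate is a bystander.
  refine ⟨c ++ [phaseGate _ _ hne fun b => if b.1 then -1 else 1] ++ c.inv, ?_, ?_⟩
  · rw [length_controlReg] at hc
    simp [length_inv]; omega
  · intro x hx
    have hs := h (cfgState L S x false) _ ⟨by simp [cfgState], rfl⟩
    have hr := run_inv c (ket (cfgState L S x false))
    unfold Sends at hs
    rw [run_append, run_append, hs, run_phaseGate, map_smul]
    rw [hs] at hr
    rw [hr, Function.update_self, onControls_map p hT hx]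
    cases p (x.1 / 2 ^ (L - T)) x.2.1 x.2.2 <;> simp

end Machine

/-! ### Aligned intervals of labels -/

section Layouts

/-- A family of disjoint aligned intervals of labels, which the `T` topmost of `L` bits tell
apart. -/
structure Layout (L T : ℕ) (H : Type) where
  /-- The indices of the intervals. -/
  idx : Finset H
  /-- The first label of an interval. -/
  base : H → ℕ
  /-- The binary logarithm of the length of an interval. -/
  width : H → ℕ
  le_width : ∀ h ∈ idx, L - T ≤ width h
  width_le : ∀ h ∈ idx, width h ≤ L
  dvd_base : ∀ h ∈ idx, 2 ^ width h ∣ base h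
  base_add_le : ∀ h ∈ idx, base h + 2 ^ width h ≤ 2 ^ L
  disjoint : ∀ h ∈ idx, ∀ h' ∈ idx, h ≠ h' →
    base h + 2 ^ width h ≤ base h' ∨ base h' + 2 ^ width h' ≤ base h

variable {L S T : ℕ} {H H' : Type}

/-- The label `v` lies in the interval `h`. -/
def Layout.Mem (Λ : Layout L T H) (h : H) (v : ℕ) : Prop :=
  Λ.base h ≤ v ∧ v < Λ.base h + 2 ^ Λ.width h

instance (Λ : Layout L T H) (h : H) (v : ℕ) : Decidable (Λ.Mem h v) := by
  unfold Layout.Mem; infer_instance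

theorem Layout.Mem.unique {Λ : Layout L T H} {h h' : H} {v : ℕ} (hh : h ∈ Λ.idx)
    (hh' : h' ∈ Λ.idx) (hv : Λ.Mem h v) (hv' : Λ.Mem h' v) : h = h' := by
  by_contra hne
  have := Λ.disjoint h hh h' hh' hne
  unfold Layout.Mem at hv hv'
  omega

/-- Bases and lengths are multiples of 2^(L-T), so the lower bits do not affect membership, and
conditions on the interval can be evaluated from T control qubits. -/
theorem Layout.mem_top {Λ : Layout L T H} {h : H} (hh : h ∈ Λ.idx) (v : ℕ) :
    Λ.Mem h (v / 2 ^ (L - T) * 2 ^ (L - T)) ↔ Λ.Mem h v := by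
  obtain ⟨β, hβ⟩ := (pow_dvd_pow 2 (Λ.le_width h hh)).trans (Λ.dvd_base h hh)
  obtain ⟨γ, hγ⟩ := pow_dvd_pow 2 (Λ.le_width h hh)
  unfold Layout.Mem
  have hp : 0 < 2 ^ (L - T) := by positivity
  rw [hβ, hγ, ← mul_add, mul_comm _ β, mul_comm _ (β + γ)]
  rw [Nat.mul_le_mul_right_iff hp, Nat.mul_lt_mul_right hp, Nat.le_div_iff_mul_le hp,
    Nat.div_lt_iff_lt_mul hp]

theorem Layout.Mem.lt {Λ : Layout L T H} {h : H} (hh : h ∈ Λ.idx) {v : ℕ} (hv : Λ.Mem h v) :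
    v < 2 ^ L := hv.2.trans_le (Λ.base_add_le h hh)

theorem Layout.mem_base_add {Λ : Layout L T H} {h : H} {c : ℕ} (hc : c < 2 ^ Λ.width h) :
    Λ.Mem h (Λ.base h + c) := ⟨Nat.le_add_right _ _, Nat.add_lt_add_left hc _⟩

/-- Addition of a constant that depends on the interval and on the flags. -/
theorem Layout.mImpl_add (Λ : Layout L T H) {D : ℕ} (hT : T ≤ L) (hS : 0 < S)
    (hD : L = S * D) (c : H → Bool → Bool → ℕ) :
    MImpl L S (fun x y => ∃ h ∈ Λ.idx, Λ.Mem h x.1 ∧ Λ.Mem h y.1 ∧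
      y = (x.1 + c h x.2.1 x.2.2, x.2)) (D * (S * (6 * 2 ^ (T + 2)) + 260 * L + 210)) := by
  classical
  -- By disjointness at most one summand is present. The sum stays in its interval, so the addend
  -- read from the topmost bits does not change during the addition.
  set C : ℕ → Bool → Bool → ℕ := fun Y e w =>
    ∑ h ∈ Λ.idx, if Λ.Mem h (Y * 2 ^ (L - T)) then c h e w else 0 with hC
  have key : ∀ h ∈ Λ.idx, ∀ v e w, Λ.Mem h v → C (v / 2 ^ (L - T)) e w = c h e w := by
    intro h hh v e w hv
    simp only [hC]
    rw [Finset.sum_eq_single h]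
    · rw [if_pos ((Layout.mem_top hh v).2 hv)]
    · intro h' hh' hne
      rw [if_neg]
      intro hm
      exact hne (Layout.Mem.unique hh' hh ((Layout.mem_top hh' v).1 hm) hv)
    · exact fun hn => absurd hh hn
  refine (FermionEncoding.mImpl_add hT hS hD C).mono ?_ le_rfl
  rintro x y hx hy ⟨h, hh, hm, hm', rfl⟩
  rw [key h hh x.1 _ _ hm]
  refine ⟨fun d hd => key h hh _ _ _ ?_, rfl⟩
  unfold Layout.Mem at *
  simp only at hm'
  omega

/-- Instructions that act within the intervals. -/
theorem Layout.mImpl_block (Λ : Layout L T H) (hT : T ≤ L) {R : H → Cfg → Cfg → Prop} {ℓ : ℕ}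
    (hR : ∀ h ∈ Λ.idx, CtrlImpl L S (R h) ℓ) :
    MImpl L S (fun x y => ∃ h ∈ Λ.idx, Λ.Mem h x.1 ∧ Λ.Mem h y.1 ∧ R h x y)
      (Λ.idx.card * (ℓ + 6 * 2 ^ (T + 2))) := by
  rw [← Finset.length_toList]
  refine (MImpl.list Λ.idx.toList (Finset.nodup_toList _) fun h hh =>
    MImpl.block hT (hR h (Finset.mem_toList.1 hh))
      (fun Y _ _ => decide (Λ.Mem h (Y * 2 ^ (L - T))))
      (fun Y _ _ => decide (Λ.Mem h (Y * 2 ^ (L - T))))).mono ?_ le_rfl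
  rintro x y hx hy ⟨h, hh, hm, hm', hxy⟩
  refine Or.inr ⟨h, Finset.mem_toList.2 hh, Or.inl ⟨?_, ?_, hxy⟩, ?_⟩
  · simpa [Layout.mem_top hh] using hm
  · simpa [Layout.mem_top hh] using hm'
  · intro h' hh' hne
    rw [Finset.mem_toList] at hh'
    have e1 : ¬ Λ.Mem h' x.1 := fun hc => hne (Layout.Mem.unique hh' hh hc hm)
    have e2 : ¬ Λ.Mem h' y.1 := fun hc => hne (Layout.Mem.unique hh' hh hc hm')
    exact ⟨Or.inr (by simp [Layout.mem_top hh', e1]), Or.inr (by simp [Layout.mem_top hh', e2])⟩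

/-- If `P` fails, nothing is asked with the control set and the empty circuit will do. This makes
available the side conditions that a relation implies but that are needed already to write down the
circuit. -/
theorem CtrlImpl.of_imp {P : Prop} {R : Cfg → Cfg → Prop} {ℓ : ℕ} (h : P → CtrlImpl L S R ℓ) :
    CtrlImpl L S (fun x y => P ∧ R x y) ℓ := by
  by_cases hP : P
  · refine Impl.mono (h hP) ?_ le_rfl
    rintro s t ⟨x, y, φ, hx, hy, hR, rfl, rfl⟩
    refine ⟨x, y, φ, hx, hy, ?_, rfl, rfl⟩
    cases φ <;> simp_all
  · refine Impl.mono Impl.id ?_ (Nat.zero_le _)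
    rintro s t ⟨x, y, φ, hx, hy, hR, rfl, rfl⟩
    cases φ <;> simp_all

theorem CtrlImpl.mono {R R' : Cfg → Cfg → Prop} {ℓ ℓ' : ℕ} (h : CtrlImpl L S R ℓ)
    (hR : ∀ x y : Cfg, x.1 < 2 ^ L → y.1 < 2 ^ L → R' x y → R x y) (hℓ : ℓ ≤ ℓ') :
    CtrlImpl L S R' ℓ' := by
  refine Impl.mono h ?_ hℓ
  rintro s t ⟨x, y, φ, hx, hy, h, rfl, rfl⟩
  refine ⟨x, y, φ, hx, hy, ?_, rfl, rfl⟩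
  cases φ
  · simpa using h
  · simp only [if_true] at h ⊢; exact hR x y hx hy h

theorem testBit_fields {t b β hi f : ℕ} (hb : b ≤ t) (hf : f < 2 ^ b) (hhi : hi < 2 ^ (t - b))
    (i : ℕ) : (2 ^ t * β + (2 ^ b * hi + f)).testBit i =
      if i < b then f.testBit i else if i < t then hi.testBit (i - b) else β.testBit (i - t) := by
  have hlt : 2 ^ b * hi + f < 2 ^ t := by
    have : 2 ^ t = 2 ^ b * 2 ^ (t - b) := by rw [← pow_add, Nat.add_sub_cancel' hb]
    rw [this]
    calc 2 ^ b * hi + f < 2 ^ b * hi + 2 ^ b := by omega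
      _ = 2 ^ b * (hi + 1) := by ring
      _ ≤ _ := Nat.mul_le_mul_left _ hhi
  rw [Nat.testBit_two_pow_mul_add _ hlt, Nat.testBit_two_pow_mul_add _ hf]
  split_ifs <;> first | rfl | omega

theorem fields_lt {t b hi f : ℕ} (hb : b ≤ t) (hf : f < 2 ^ b) (hhi : hi < 2 ^ (t - b)) :
    2 ^ b * hi + f < 2 ^ t := by
  have : 2 ^ t = 2 ^ b * 2 ^ (t - b) := by rw [← pow_add, Nat.add_sub_cancel' hb]
  rw [this]
  calc 2 ^ b * hi + f < 2 ^ b * hi + 2 ^ b := by omega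
    _ = 2 ^ b * (hi + 1) := by ring
    _ ≤ _ := Nat.mul_le_mul_left _ hhi

/-- Rotates the top bit of a segment to its bottom. -/
def rotDown (b t : ℕ) (h : b < t) : Equiv.Perm ℕ where
  toFun i := if i < b then i else if i = b then t - 1 else if i < t then i - 1 else i
  invFun i := if i < b then i else if i = t - 1 then b else if i < t then i + 1 else i
  left_inv i := by dsimp only; split_ifs <;> omega
  right_inv i := by dsimp only; split_ifs <;> omega

/-- Moves the bottom bit of a segment to the place `L`, and the bit `L` to its top. -/
def exchangeUp (b t L : ℕ) (h : b < t) (hL : t ≤ L) : Equiv.Perm ℕ where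
  toFun i := if i < b then i else if i < t - 1 then i + 1 else if i = t - 1 then L else
    if i = L then b else i
  invFun i := if i < b then i else if i = b then L else if i < t then i - 1 else
    if i = L then t - 1 else i
  left_inv i := by dsimp only; split_ifs <;> omega
  right_inv i := by dsimp only; split_ifs <;> omega

/-- Exchanges the segments `[s', s)` and `[s, L)`. -/
def shiftDown (s' s L : ℕ) (h : s' ≤ s) (hL : s ≤ L) : Equiv.Perm ℕ where
  toFun i := if i < s' then i else if i < L - (s - s') then i + (s - s') else
    if i < L then i - (L - s) else i
  invFun i := if i < s' then i else if i < s then i + (L - s) else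
    if i < L then i - (s - s') else i
  left_inv i := by dsimp only; split_ifs <;> omega
  right_inv i := by dsimp only; split_ifs <;> omega

theorem testBit_rotDown {t b β hi f : ℕ} (hbt : b < t) (hf : f < 2 ^ b)
    (hhi : hi < 2 ^ (t - (b + 1))) (i : ℕ) :
    (2 ^ t * β + (2 ^ (b + 1) * hi + f)).testBit i =
      (2 ^ t * β + (2 ^ b * hi + f)).testBit (rotDown b t hbt i) := by
  have hf' : f < 2 ^ (b + 1) := hf.trans_le (Nat.pow_le_pow_right (by norm_num) (by omega))
  have hhi2 : hi < 2 ^ (t - b) := hhi.trans_le (Nat.pow_le_pow_right (by norm_num) (by omega))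
  rw [testBit_fields hbt hf' hhi, testBit_fields hbt.le hf hhi2]
  have hv : ∀ v, v = (if i < b then i else if i = b then t - 1 else if i < t then i - 1 else i) →
      rotDown b t hbt i = v := fun v hv => hv.symm
  have h1 : i < b ∨ i = b ∨ (b < i ∧ i < t) ∨ t ≤ i := by omega
  rcases h1 with h1 | h1 | h1 | h1
  · rw [hv i (by split_ifs; rfl), if_pos (by omega), if_pos h1]
  · rw [hv (t - 1) (by split_ifs <;> omega)]
    subst h1
    rw [if_pos (by omega), if_neg (by omega), if_pos (by omega),
      Nat.testBit_eq_false_of_lt hf, Nat.testBit_eq_false_of_lt]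
    rwa [show t - 1 - i = t - (i + 1) by omega]
  · rw [hv (i - 1) (by split_ifs <;> omega), if_neg (by omega), if_pos h1.2, if_neg (by omega),
      if_pos (by omega)]
    congr 1; omega
  · rw [hv i (by split_ifs <;> omega), if_neg (by omega), if_neg (by omega),
      if_neg (show ¬ i < b by omega), if_neg (by omega)]

theorem cbit_exchangeUp {t b L β hi g0 : ℕ} {e : Bool} (hbt : b < t) (hL : t ≤ L)
    (hg : g0 < 2 ^ b) (hhi : hi < 2 ^ (t - (b + 1))) (i : ℕ) :
    cbit L (2 ^ t * β + (2 ^ b * hi + g0), e, false) i =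
      cbit L (2 ^ t * β + (2 ^ (b + 1) * hi + (2 ^ b * e.toNat + g0)), false, false)
        (exchangeUp b t L hbt hL i) := by
  have hhi2 : hi < 2 ^ (t - b) := hhi.trans_le (Nat.pow_le_pow_right (by norm_num) (by omega))
  have hg' : 2 ^ b * e.toNat + g0 < 2 ^ (b + 1) := by
    have := Bool.toNat_le e
    have : 2 ^ b * e.toNat ≤ 2 ^ b * 1 := Nat.mul_le_mul_left _ this
    rw [pow_succ]; omega
  have hbit := fun i => Nat.testBit_two_pow_mul_add e.toNat hg i
  have hv : ∀ v, v = (if i < b then i else if i < t - 1 then i + 1 else if i = t - 1 then L else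
      if i = L then b else i) → exchangeUp b t L hbt hL i = v := fun v hv => hv.symm
  simp only [cbit]
  rw [testBit_fields hbt.le hg hhi2, testBit_fields hbt hg' hhi]
  have h1 : i < b ∨ (b ≤ i ∧ i < t - 1) ∨ i = t - 1 ∨ (t ≤ i ∧ i < L) ∨ i = L ∨ L < i := by omega
  rcases h1 with h1 | h1 | h1 | h1 | h1 | h1
  · rw [hv i (by split_ifs; rfl), if_pos (by omega), if_pos h1, if_pos (by omega),
      if_pos (by omega), hbit, if_pos h1]
  · rw [hv (i + 1) (by split_ifs <;> omega), if_pos (by omega), if_neg (by omega),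
      if_pos (by omega), if_pos (by omega), if_neg (by omega), if_pos (by omega)]
    congr 1; omega
  · rw [hv L (by split_ifs <;> omega), if_pos (by omega), if_neg (by omega), if_pos (by omega),
      if_neg (lt_irrefl _), if_pos rfl, Nat.testBit_eq_false_of_lt]
    rwa [show i - b = t - (b + 1) by omega]
  · rw [hv i (by split_ifs <;> omega), if_pos (by omega), if_neg (by omega), if_neg (by omega),
      if_pos h1.2, if_neg (by omega), if_neg (by omega)]
  · rw [hv b (by split_ifs <;> omega), if_neg (by omega), if_pos h1, if_pos (by omega),
      if_pos (by omega), hbit, if_neg (lt_irrefl _)]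
    cases e <;> simp
  · rw [hv i (by split_ifs <;> omega), if_neg (by omega), if_neg (by omega)]
    split_ifs <;> first | rfl | omega

/-- The relation between a label whose field below the bit `b h` contains `f`, and the label whose
field contains `f` minus `K h` if `K h ≤ f`; the flag tells the two cases apart. -/
def Layout.SplitRel (Λ : Layout L T H) (b K : H → ℕ) (x y : Cfg) : Prop :=
  ∃ h ∈ Λ.idx, ∃ hi f : ℕ, b h < Λ.width h ∧ K h ≤ 2 ^ b h ∧ f < 2 ^ b h ∧
    hi < 2 ^ (Λ.width h - 1 - b h) ∧ x = (Λ.base h + (2 ^ b h * hi + f), false, false) ∧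
    y = (Λ.base h + (2 ^ b h * hi + if K h ≤ f then f - K h else f), decide (K h ≤ f), false)

theorem Layout.mImpl_split (Λ : Layout L T H) {D : ℕ} (hT : T ≤ L) (hS : 0 < S) (hD : L = S * D)
    (b K : H → ℕ) :
    MImpl L S (Λ.SplitRel b K) (2 * (Λ.idx.card * (13 * (L + S + 6) + 6 * 2 ^ (T + 2))) +
      2 * (D * (S * (6 * 2 ^ (T + 2)) + 260 * L + 210))) := by
  -- Comparison by overflow. `rotDown` brings the vacant top bit of the interval to place b, just
  -- above the field; adding 2^b - K carries into it exactly when K ≤ f; `exchangeUp` moves the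
  -- carry to the flag and a vacant bit back to the top; if there was no carry, 2^b - K is
  -- subtracted again.
  have h1 := Λ.mImpl_block (S := S) hT (R := fun h x y => (b h < Λ.width h ∧ Λ.width h ≤ L) ∧
      ∃ hbt : b h < Λ.width h, ∀ i < L + 2, cbit L y i = cbit L x (rotDown _ _ hbt i))
    (ℓ := 13 * (L + S + 6)) fun h _ => CtrlImpl.of_imp fun hbt => by
      refine (ctrlImpl_perm (rotDown _ _ hbt.1) ?_).mono ?_ le_rfl
      · intro i hi; simp only [rotDown, Equiv.coe_fn_mk]; split_ifs <;> omega
      · rintro x y - - ⟨_, h⟩; exact h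
  have h2 := Λ.mImpl_add hT hS hD (fun h _ _ => 2 ^ b h - K h)
  have h3 := Λ.mImpl_block (S := S) hT (R := fun h x y => (b h < Λ.width h ∧ Λ.width h ≤ L) ∧
      ∃ (hbt : b h < Λ.width h) (hL : Λ.width h ≤ L), ∀ i < L + 2,
        cbit L y i = cbit L x (exchangeUp _ _ L hbt hL i))
    (ℓ := 13 * (L + S + 6)) fun h _ => CtrlImpl.of_imp fun hbt => by
      refine (ctrlImpl_perm (exchangeUp _ _ L hbt.1 hbt.2) ?_).mono ?_ le_rfl
      · intro i hi; simp only [exchangeUp, Equiv.coe_fn_mk]; split_ifs <;> omega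
      · rintro x y - - ⟨_, _, h⟩; exact h
  have h4 := (Λ.mImpl_add hT hS hD (fun h e _ => if e then 0 else 2 ^ b h - K h)).inv
  refine (h1.comp (h2.comp (h3.comp h4))).mono ?_ (by omega)
  rintro x y hx hy ⟨h, hh, hi, f, hbt, hK, hf, hhi, rfl, rfl⟩
  obtain ⟨β, hβ⟩ := Λ.dvd_base h hh
  have hwL := Λ.width_le h hh
  have hbase : ∀ c, c < 2 ^ Λ.width h → Λ.Mem h (Λ.base h + c) := fun c hc =>
    Layout.mem_base_add hc
  have hlt : ∀ c, c < 2 ^ Λ.width h → Λ.base h + c < 2 ^ L := fun c hc =>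
    (hbase c hc).lt hh
  generalize hb : b h = b' at *
  generalize hKK : K h = k at *
  generalize ht : Λ.width h = t at *
  have hhi' : hi < 2 ^ (t - (b' + 1)) := by rwa [Nat.sub_right_comm, Nat.sub_sub] at hhi
  have hhi2 : hi < 2 ^ (t - b') := hhi'.trans_le (Nat.pow_le_pow_right (by norm_num) (by omega))
  have hp : 2 ^ (b' + 1) = 2 ^ b' + 2 ^ b' := by rw [pow_succ]; ring
  set g := f + (2 ^ b' - k) with hg
  have hg' : g < 2 ^ (b' + 1) := by omega
  set g0 := if k ≤ f then f - k else g with hg0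
  have hg0lt : g0 < 2 ^ b' := by rw [hg0]; split_ifs <;> omega
  have hgg : g = 2 ^ b' * (decide (k ≤ f)).toNat + g0 := by
    rw [hg0]
    by_cases h : k ≤ f
    · simp only [h, if_true, decide_true, Bool.toNat_true]; omega
    · simp only [h, if_false, decide_false, Bool.toNat_false]; omega
  have m1 := fields_lt hbt hg' hhi'
  have m0 := fields_lt (t := t) hbt (f := f) (by omega) hhi'
  have m2 := fields_lt hbt.le hf hhi2
  have m3 := fields_lt hbt.le hg0lt hhi2
  refine ⟨(Λ.base h + (2 ^ (b' + 1) * hi + f), false, false), hlt _ m0,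
    ⟨h, hh, hbase _ m2, hbase _ m0, ?_, ?_⟩,
    (Λ.base h + (2 ^ (b' + 1) * hi + g), false, false), hlt _ m1,
    ⟨h, hh, hbase _ m0, hbase _ m1, ?_⟩,
    (Λ.base h + (2 ^ b' * hi + g0), decide (k ≤ f), false), hlt _ m3,
    ⟨h, hh, hbase _ m1, hbase _ m3, ?_⟩,
    ⟨h, hh, ?_, hbase _ m3, ?_⟩⟩
  · rw [hb, ht]; exact ⟨hbt, hwL⟩
  · subst hb ht
    refine ⟨hbt, fun i _ => ?_⟩
    simp only [hβ, cbit]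
    have hr : i < L ↔ rotDown _ _ hbt i < L := by
      simp only [rotDown, Equiv.coe_fn_mk]; split_ifs <;> omega
    by_cases h : i < L
    · rw [if_pos h, if_pos (hr.1 h), testBit_rotDown hbt hf hhi']
    · rw [if_neg h, if_neg fun h' => h (hr.2 h')]
      simp
  · rw [hb, hKK]
    simp only [Prod.mk.injEq, and_true]
    omega
  · subst hb ht
    refine ⟨⟨hbt, hwL⟩, hbt, hwL, fun i _ => ?_⟩
    simp only [hβ]
    rw [hgg]
    exact cbit_exchangeUp hbt hwL hg0lt hhi' i
  · refine hbase _ ?_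
    split_ifs
    · exact fields_lt hbt.le (by omega) hhi2
    · exact m2
  · rw [hb, hKK, hg0]
    by_cases h : k ≤ f
    · simp [h]
    · simp only [h, if_false, decide_false, Bool.false_eq_true, Prod.mk.injEq, and_true]
      omega

/-- The base has no binary digits below place t and the offset has none from t on, so addition and
xor coincide. -/
theorem xor_base {t β c : ℕ} (hc : c < 2 ^ t) : (2 ^ t * β + c) ^^^ (2 ^ t * β) = c := by
  refine Nat.eq_of_testBit_eq fun i => ?_
  have h0 := Nat.testBit_two_pow_mul_add β (show 0 < 2 ^ t by positivity) i
  rw [add_zero] at h0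
  rw [Nat.testBit_xor, Nat.testBit_two_pow_mul_add _ hc, h0]
  split_ifs with h
  · simp
  · rw [Nat.testBit_eq_false_of_lt (hc.trans_le (Nat.pow_le_pow_right (by norm_num) (by omega)))]
    simp

theorem add_eq_xor {t β c : ℕ} (hc : c < 2 ^ t) : 2 ^ t * β + c = c ^^^ (2 ^ t * β) := by
  calc 2 ^ t * β + c = ((2 ^ t * β + c) ^^^ (2 ^ t * β)) ^^^ (2 ^ t * β) := by
        rw [Nat.xor_assoc, Nat.xor_self, Nat.xor_zero]
    _ = _ := by rw [xor_base hc]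

/-- The relation between labels in intervals of two layouts whose contents are `q` and `r`,
separated at different bits. -/
def MoveRel {H₁ H₂ G : Type} (Λ : Layout L T H₁) (Λ' : Layout L T H₂) (src : G → H₁) (tgt : G → H₂)
    (e e' : G → Bool) (s s' : G → ℕ) (g : G) (x y : Cfg) : Prop :=
  src g ∈ Λ.idx ∧ tgt g ∈ Λ'.idx ∧ s' g ≤ s g ∧ s g ≤ L ∧ ∃ q r : ℕ, r < 2 ^ s' g ∧
    2 ^ s g * q + r < 2 ^ Λ.width (src g) ∧ 2 ^ s' g * q + r < 2 ^ Λ'.width (tgt g) ∧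
    x = (Λ.base (src g) + (2 ^ s g * q + r), e g, false) ∧
    y = (Λ'.base (tgt g) + (2 ^ s' g * q + r), e' g, true)

theorem mImpl_move {H₁ H₂ G : Type} (Λ : Layout L T H₁) (Λ' : Layout L T H₂) (hT : T ≤ L)
    (src : G → H₁) (tgt : G → H₂) (e e' : G → Bool) (s s' : G → ℕ) (I : Finset G)
    (hsrc : ∀ g ∈ I, ∀ g' ∈ I, src g = src g' → e g = e g' → g = g')
    (htgt : ∀ g ∈ I, ∀ g' ∈ I, tgt g = tgt g' → e' g = e' g' → g = g') 
    (hI : ∀ g ∈ I, src g ∈ Λ.idx) (hI' : ∀ g ∈ I, tgt g ∈ Λ'.idx) :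
    MImpl L S (fun x y => ∃ g ∈ I, MoveRel Λ Λ' src tgt e e' s s' g x y)
      (I.card * (15 * (L + S + 6) + 6 * 2 ^ (T + 2))) := by
  rw [← Finset.length_toList]
  have hc : ∀ g ∈ I.toList, CtrlImpl L S (MoveRel Λ Λ' src tgt e e' s s' g)
      (15 * (L + S + 6)) := by
    intro g _
    refine CtrlImpl.mono (CtrlImpl.of_imp (P := src g ∈ Λ.idx ∧ tgt g ∈ Λ'.idx ∧ s' g ≤ s g ∧
      s g ≤ L) (R := MoveRel Λ Λ' src tgt e e' s s' g)
      fun hP => ?_) (fun x y _ _ h => ⟨⟨h.1, h.2.1, h.2.2.1, h.2.2.2.1⟩, h⟩) le_rfl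
    obtain ⟨h1, h2, h3, h4⟩ := hP
    -- The old base and flag are stripped, `q` is shifted from place s down over the digits [s', s),
    -- which vanish because r < 2^s', and the new base and flags are put on.
    refine CtrlImpl.mono ((ctrlImpl_xor (L := L) (S := S) (Λ.base (src g)) (e g) false).comp
      ((ctrlImpl_perm (shiftDown (s' g) (s g) L h3 h4) ?_).comp
      (ctrlImpl_xor (Λ'.base (tgt g)) (e' g) true))) ?_ (by omega)
    · intro i hi
      simp only [shiftDown, Equiv.coe_fn_mk]
      split_ifs <;> omega
    · rintro x y hx hy ⟨-, -, -, -, q, r, hr, hq, hq', rfl, rfl⟩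
      obtain ⟨β, hβ⟩ := Λ.dvd_base _ h1
      obtain ⟨γ, hγ⟩ := Λ'.dvd_base _ h2
      have l1 : 2 ^ s g * q + r < 2 ^ L :=
        hq.trans_le (Nat.pow_le_pow_right (by norm_num) (Λ.width_le _ h1))
      have l2 : 2 ^ s' g * q + r < 2 ^ L :=
        hq'.trans_le (Nat.pow_le_pow_right (by norm_num) (Λ'.width_le _ h2))
      refine ⟨(2 ^ s g * q + r, false, false), l1, ?_, (2 ^ s' g * q + r, false, false), l2, ?_, ?_⟩
      · rw [hβ, xor_base hq]; simp
      · have hrs : r < 2 ^ s g := hr.trans_le (Nat.pow_le_pow_right (by norm_num) h3)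
        intro i _
        simp only [cbit, shiftDown, Equiv.coe_fn_mk, Nat.testBit_two_pow_mul_add _ hr,
          Nat.testBit_two_pow_mul_add _ hrs]
        have hqs : q < 2 ^ (L - s g) := by
          have : 2 ^ L = 2 ^ s g * 2 ^ (L - s g) := by rw [← pow_add, Nat.add_sub_cancel' h4]
          rw [this] at l1
          exact lt_of_mul_lt_mul_left (lt_of_le_of_lt (Nat.le_add_right _ _) l1) (Nat.zero_le _)
        split_ifs <;> first | rfl | omega | skip
        · congr 1; omega
        · rw [Nat.testBit_eq_false_of_lt (hqs.trans_le (Nat.pow_le_pow_right (by norm_num) _)),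
            Nat.testBit_eq_false_of_lt (hr.trans_le (Nat.pow_le_pow_right (by norm_num) _))]
          all_goals omega
      · rw [hγ]
        simp only [Bool.false_bne, Prod.mk.injEq, and_true]
        exact add_eq_xor hq'
  -- Intervals of the two layouts may share labels. The second flag marks what has been moved, so
  -- that no block mistakes a new label for an old one.
  refine (MImpl.list I.toList (Finset.nodup_toList _) fun g hg =>
    MImpl.block hT (hc g hg)
      (fun Y ε w => decide (Λ.Mem (src g) (Y * 2 ^ (L - T))) && (ε == e g) && !w)
      (fun Y ε w => decide (Λ'.Mem (tgt g) (Y * 2 ^ (L - T))) && (ε == e' g) && w)).mono ?_ le_rfl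
  rintro x y hx hy ⟨g, hg, hR⟩
  have hR' := hR
  obtain ⟨h1, h2, h3, h4, q, r, hr, hq, hq', rfl, rfl⟩ := hR'
  have mx : Λ.Mem (src g) (Λ.base (src g) + (2 ^ s g * q + r)) := Layout.mem_base_add hq
  have my : Λ'.Mem (tgt g) (Λ'.base (tgt g) + (2 ^ s' g * q + r)) := Layout.mem_base_add hq'
  refine Or.inr ⟨g, Finset.mem_toList.2 hg, Or.inl ⟨?_, ?_, hR⟩, ?_⟩
  · simpa [Layout.mem_top h1] using mx
  · simpa [Layout.mem_top h2] using my
  · intro g' hg' hne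
    rw [Finset.mem_toList] at hg'
    refine ⟨Or.inr ⟨?_, by simp, rfl⟩, Or.inr ⟨by simp, ?_, rfl⟩⟩
    · simp only [Layout.mem_top (hI g' hg'), Bool.not_false, Bool.and_true,
        Bool.and_eq_false_iff, decide_eq_false_iff_not, beq_eq_false_iff_ne]
      by_contra! hcon
      exact hne (hsrc g' hg' g hg (Layout.Mem.unique (hI g' hg') h1 hcon.1 mx) hcon.2.symm)
    · simp only [Layout.mem_top (hI' g' hg'), Bool.and_true,
        Bool.and_eq_false_iff, decide_eq_false_iff_not, beq_eq_false_iff_ne]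
      by_contra! hcon
      exact hne (htgt g' hg' g hg (Layout.Mem.unique (hI' g' hg') h2 hcon.1 my) hcon.2.symm)

/-- This is used to clear the mark that `mImpl_move` leaves. -/
theorem mImpl_resetFlag : MImpl L S (fun x y => y = (x.1, x.2.1, !x.2.2)) 2 := by
  refine (impl_not (qubit L S (L + 1) (by omega))).mono ?_ le_rfl
  rintro s t ⟨x, y, hx, hy, rfl, rfl, rfl⟩
  funext i
  simp only [Function.update_apply, cfgState_apply, cbit, Fin.ext_iff]
  split_ifs <;> first | rfl | omega

end Layouts

/-! ### Lexicographic ranks of strings of fixed weight -/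

section Ranks

/-- The rank of a list of bits among the lists of the same length and the same weight. -/
def listRank : List Bool → ℕ
  | [] => 0
  | b :: l => (if b then l.length.choose (l.count true + 1) else 0) + listRank l

theorem listRank_lt (l : List Bool) : listRank l < l.length.choose (l.count true) := by
  induction l with
  | nil => simp [listRank]
  | cons b l ih =>
    cases b
    · simp only [listRank, Bool.false_eq_true, if_false, zero_add, List.length_cons]
      rw [List.count_cons_of_ne (by simp)]
      exact ih.trans_le (Nat.choose_le_choose _ (Nat.le_succ _))
    · simp only [listRank, if_true, List.length_cons, List.count_cons_self]
      rw [Nat.choose_succ_succ]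
      simp only [Nat.succ_eq_add_one]
      omega

/-- At the first difference, the string with a one gains the number of completions of a zero at that
place, which exceeds the rank of any such completion by `listRank_lt`. -/
theorem listRank_lt_listRank {l l' : List Bool} (hlen : l.length = l'.length)
    (hc : l.count true = l'.count true) (h : l < l') : listRank l < listRank l' := by
  induction l generalizing l' with
  | nil =>
    cases l'
    · exact absurd h (lt_irrefl _)
    · simp at hlen
  | cons b l ih =>
    cases l' with
    | nil => simp at hlen
    | cons b' l' =>
      simp only [List.length_cons, add_left_inj] at hlen
      rw [List.cons_lt_cons_iff] at h
      rcases h with h | ⟨rfl, h⟩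
      · have hb : b = false ∧ b' = true := by revert h; cases b <;> cases b' <;> simp
        obtain ⟨rfl, rfl⟩ := hb
        rw [List.count_cons_self, List.count_cons_of_ne (by simp)] at hc
        simp only [listRank, Bool.false_eq_true, if_false, if_true, zero_add]
        have := listRank_lt l
        rw [hlen, hc] at this
        omega
      · have hc' : l.count true = l'.count true := by
          simpa [List.count_cons] using hc
        have := ih hlen hc' h
        simp only [listRank, hlen, hc']
        omega

/-- Greedy expansion: the first bit is one exactly when `r` reaches the number of strings that begin
with zero. -/
theorem exists_listRank {n c r : ℕ} (hr : r < n.choose c) :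
    ∃ l : List Bool, l.length = n ∧ l.count true = c ∧ listRank l = r := by
  induction n generalizing c r with
  | zero =>
    cases c with
    | zero => exact ⟨[], rfl, rfl, by simp at hr; simp [listRank, hr]⟩
    | succ c => simp at hr
  | succ n ih =>
    by_cases h : r < n.choose c
    · obtain ⟨l, h1, h2, h3⟩ := ih h
      refine ⟨false :: l, by simp [h1], ?_, by simp [listRank, h3]⟩
      rw [List.count_cons_of_ne (by simp), h2]
    · cases c with
      | zero => simp at hr h; omega
      | succ c =>
        rw [Nat.choose_succ_succ] at hr
        simp only [Nat.succ_eq_add_one] at hr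
        obtain ⟨l, h1, h2, h3⟩ := ih (c := c) (r := r - n.choose (c + 1)) (by omega)
        refine ⟨true :: l, by simp [h1], by simp [h2], ?_⟩
        simp only [listRank, if_true, h1, h2, h3]
        omega

theorem listRank_injective {l l' : List Bool} (hlen : l.length = l'.length)
    (hc : l.count true = l'.count true) (h : listRank l = listRank l') : l = l' := by
  rcases lt_trichotomy l l' with h1 | h1 | h1
  · exact absurd (listRank_lt_listRank hlen hc h1) (by omega)
  · exact h1
  · exact absurd (listRank_lt_listRank hlen.symm hc.symm h1) (by omega)

theorem listRank_lt_iff {l l' : List Bool} (hlen : l.length = l'.length)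
    (hc : l.count true = l'.count true) : listRank l < listRank l' ↔ l < l' := by
  refine ⟨fun h => ?_, listRank_lt_listRank hlen hc⟩
  rcases lt_trichotomy l l' with h1 | h1 | h1
  · exact h1
  · subst h1; exact absurd h (lt_irrefl _)
  · exact absurd (listRank_lt_listRank hlen.symm hc.symm h1) (by omega)

theorem append_lt_append_iff {a a' b b' : List Bool} (h : a.length = a'.length) :
    a ++ b < a' ++ b' ↔ a < a' ∨ (a = a' ∧ b < b') := by
  induction a generalizing a' with
  | nil =>
    cases a' with
    | nil => simp
    | cons => simp at h
  | cons c a ih =>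
    cases a' with
    | nil => simp at h
    | cons c' a' =>
      simp only [List.length_cons, add_left_inj] at h
      simp only [List.cons_append, List.cons_lt_cons_iff, ih h, List.cons.injEq]
      tauto

variable {M : ℕ}

/-- The reversal of the prefix of length `j`. -/
def pre (j : ℕ) (x : BitString M) : List Bool := ((List.ofFn x).take j).reverse

/-- The suffix after the first `j` bits. -/
def suf (j : ℕ) (x : BitString M) : List Bool := (List.ofFn x).drop j

theorem length_pre {j : ℕ} (hj : j ≤ M) (x : BitString M) : (pre j x).length = j := by
  simp [pre, hj]

theorem length_suf (j : ℕ) (x : BitString M) : (suf j x).length = M - j := by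
  simp [suf]

theorem suffixWeight_eq (j : ℕ) (x : BitString M) : suffixWeight j x = (suf j x).count true := by
  induction M generalizing j with
  | zero => simp [suffixWeight, suf]
  | succ M ih =>
    unfold suffixWeight
    rw [Fin.card_filter_univ_succ]
    cases j with
    | zero =>
      have := ih 0 (fun i => x i.succ)
      simp only [suffixWeight, suf, Nat.zero_le, true_and, List.drop_zero] at this
      simp only [suf, Nat.zero_le, true_and, List.drop_zero, List.ofFn_succ, List.count_cons]
      rw [← this]
      cases x 0 <;> simp
    | succ j =>
      have := ih j (fun i => x i.succ)
      simp only [suffixWeight, suf] at this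
      simp only [suf, List.ofFn_succ, List.drop_succ_cons]
      rw [← this]
      simp

theorem weight_eq_suffixWeight (x : BitString M) : weight x = suffixWeight 0 x := by
  simp [weight, suffixWeight]

theorem weight_eq (j : ℕ) (x : BitString M) :
    weight x = (pre j x).count true + (suf j x).count true := by
  rw [weight_eq_suffixWeight, suffixWeight_eq, suf, List.drop_zero, pre, List.count_reverse, suf,
    ← List.count_append, List.take_append_drop]

theorem pre_succ (j : Fin M) (x : BitString M) : pre (j + 1) x = x j :: pre j x := by
  simp only [pre]
  rw [List.take_succ_eq_append_getElem (by simp)]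
  simp

theorem suf_eq_cons (j : Fin M) (x : BitString M) : suf j x = x j :: suf (j + 1) x := by
  simp only [suf]
  rw [List.drop_eq_getElem_cons (by simp)]
  simp

theorem ext_pre_suf {j : ℕ} {x y : BitString M} (h : pre j x = pre j y) (h' : suf j x = suf j y) :
    x = y := by
  apply List.ofFn_injective
  rw [← List.take_append_drop j (List.ofFn x), ← List.take_append_drop j (List.ofFn y)]
  simp only [pre, List.reverse_inj] at h
  simp only [suf] at h'
  rw [h, h']

theorem exists_pre_suf {j : ℕ} (hj : j ≤ M) {p t : List Bool} (hp : p.length = j)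
    (ht : t.length = M - j) : ∃ x : BitString M, pre j x = p ∧ suf j x = t := by
  have hl : (p.reverse ++ t).length = M := by simp; omega
  have hof : List.ofFn (fun i : Fin M => (p.reverse ++ t)[(i : ℕ)]'(by omega)) = p.reverse ++ t := by
    apply List.ext_getElem
    · simp; omega
    · intro i h1 h2; simp
  refine ⟨fun i => (p.reverse ++ t)[(i : ℕ)]'(by omega), ?_, ?_⟩
  · rw [pre, hof, List.take_left' (by simp [hp]), List.reverse_reverse]
  · rw [suf, hof, List.drop_left' (by simp [hp])]

theorem pre_eq_iff {j : ℕ} {x y : BitString M} :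
    pre j x = pre j y ↔ ∀ i : Fin M, (i : ℕ) < j → x i = y i := by
  simp only [pre, List.reverse_inj]
  constructor
  · intro h i hi
    have := congrArg (fun l => l[(i : ℕ)]?) h
    simpa [List.getElem?_take, hi] using this
  · intro h
    apply List.ext_getElem?
    intro i
    simp only [List.getElem?_take, List.getElem?_ofFn]
    by_cases hi : i < j
    · by_cases hM : i < M
      · simp [hi, hM, h ⟨i, hM⟩ hi]
      · simp [hM]
    · simp [hi]

theorem suf_eq_of {j : ℕ} {x y : BitString M} (h : ∀ i : Fin M, j ≤ (i : ℕ) → x i = y i) :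
    suf j x = suf j y := by
  simp only [suf]
  apply List.ext_getElem?
  intro i
  simp only [List.getElem?_drop, List.getElem?_ofFn]
  by_cases hM : j + i < M
  · simp [hM, h ⟨j + i, hM⟩ (by simp)]
  · simp [hM]

theorem pre_bitFlip (j : Fin M) (x : BitString M) : pre j (bitFlip j x) = pre j x :=
  pre_eq_iff.2 fun i hi => bitFlip_of_ne (fun h => by subst h; omega) x

theorem suf_bitFlip (j : Fin M) (x : BitString M) :
    suf (j + 1) (bitFlip j x) = suf (j + 1) x :=
  suf_eq_of fun i hi => bitFlip_of_ne (fun h => by subst h; omega) x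

theorem sameBlock_iff {j : ℕ} {x y : BitString M} :
    SameBlock j x y ↔ weight x = weight y ∧ pre j x = pre j y := by
  rw [SameBlock, pre_eq_iff]

theorem layerLT_iff {j : ℕ} {x y : BitString M} : layerLT j x y ↔ weight x < weight y ∨
    (weight x = weight y ∧ suffixWeight j x < suffixWeight j y) ∨
    (weight x = weight y ∧ suffixWeight j x = suffixWeight j y ∧
      (pre j x < pre j y ∨ pre j x = pre j y ∧ suf j x < suf j y)) := by
  have hl : (pre j x).length = (pre j y).length := by simp [pre]
  rw [← append_lt_append_iff hl]
  rfl

theorem mem_configs {F k : ℕ} {x : BitString M} :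
    x ∈ configs M F k ↔ F ≤ weight x + k ∧ weight x ≤ F + k := by
  simp [configs]

end Ranks

/-! ### Keys, and labels composed of ranks -/

section Labels

/-- The lexicographic order on triples of a weight, a suffix weight, and a bit. -/
def keyLT (h h' : ℕ × ℕ × Bool) : Prop :=
  h.1 < h'.1 ∨ (h.1 = h'.1 ∧ (h.2.1 < h'.2.1 ∨ (h.2.1 = h'.2.1 ∧ h.2.2 < h'.2.2)))

instance : DecidableRel keyLT := fun h h' => by unfold keyLT; infer_instance

theorem keyLT_irrefl (h : ℕ × ℕ × Bool) : ¬ keyLT h h := by simp [keyLT]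

theorem keyLT_trans {a b c : ℕ × ℕ × Bool} (h : keyLT a b) (h' : keyLT b c) : keyLT a c := by
  obtain ⟨a1, a2, a3⟩ := a
  obtain ⟨b1, b2, b3⟩ := b
  obtain ⟨c1, c2, c3⟩ := c
  simp only [keyLT] at *
  rcases h with h | ⟨rfl, h | ⟨rfl, h⟩⟩ <;> rcases h' with h' | ⟨rfl, h' | ⟨rfl, h'⟩⟩ <;>
    first
    | exact Or.inl (by omega)
    | exact Or.inr ⟨rfl, Or.inl (by omega)⟩
    | exact Or.inr ⟨rfl, Or.inr ⟨rfl, h.trans h'⟩⟩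

theorem keyLT_total {a b : ℕ × ℕ × Bool} (h : a ≠ b) : keyLT a b ∨ keyLT b a := by
  obtain ⟨a1, a2, a3⟩ := a
  obtain ⟨b1, b2, b3⟩ := b
  simp only [keyLT, ne_eq, Prod.mk.injEq] at *
  rcases lt_trichotomy a1 b1 with h1 | h1 | h1 <;> rcases lt_trichotomy a2 b2 with h2 | h2 | h2 <;>
    rcases lt_trichotomy a3 b3 with h3 | h3 | h3 <;> simp_all

variable {M F k : ℕ}

/-- The weight, the weight of the suffix after `j` bits, and the last bit before this suffix
(`false` if `j = 0`). -/
def key (j : ℕ) (x : BitString M) : ℕ × ℕ × Bool :=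
  (weight x, suffixWeight j x, (pre j x).headD false)

/-- The rank of the prefix of length `j - 1`, reversed. -/
def prefixRank (j : ℕ) (x : BitString M) : ℕ := listRank (pre j x).tail

/-- The rank of the suffix after `j` bits. -/
def suffixRank (j : ℕ) (x : BitString M) : ℕ := listRank (suf j x)

theorem key_bit_add (j : ℕ) (x : BitString M) :
    weight x = suffixWeight j x + ((key j x).2.2.toNat + (pre j x).tail.count true) := by
  rw [weight_eq j x, suffixWeight_eq, key]
  cases pre j x with
  | nil => simp
  | cons b l => cases b <;> simp <;> omega

theorem prefixRank_lt {j : ℕ} (hj : j ≤ M) (x : BitString M) :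
    prefixRank j x < (j - 1).choose (weight x - suffixWeight j x - (key j x).2.2.toNat) := by
  have h := listRank_lt (pre j x).tail
  have h' := key_bit_add j x
  rw [List.length_tail, length_pre hj] at h
  rw [prefixRank]
  convert h using 2
  omega

theorem suffixRank_lt (j : ℕ) (x : BitString M) :
    suffixRank j x < (M - j).choose (suffixWeight j x) := by
  have h := listRank_lt (suf j x)
  rwa [length_suf, ← suffixWeight_eq] at h

/-- The key accounts for the weight, the suffix weight and the head of the reversed prefix; the two
ranks account for the rest of the order. A block has a single key and prefix rank, so labels within
it differ exactly as suffix ranks do. -/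
theorem isLayerLabelling_of {j : ℕ} (hj : j ≤ M) (base : ℕ × ℕ × Bool → ℕ) (s : ℕ → ℕ)
    (l : BitString M → ℕ)
    (hl : ∀ x ∈ configs M F k, l x = base (key j x) +
      (2 ^ s (suffixWeight j x) * prefixRank j x + suffixRank j x))
    (hs : ∀ x ∈ configs M F k, suffixRank j x < 2 ^ s (suffixWeight j x))
    (hlex : ∀ x ∈ configs M F k, ∀ y ∈ configs M F k, keyLT (key j x) (key j y) → l x < l y) :
    IsLayerLabelling M F k j l := by
  have hsc : ∀ x y : BitString M, suffixWeight j x = suffixWeight j y →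
      (suf j x).length = (suf j y).length ∧ (suf j x).count true = (suf j y).count true :=
    fun x y h => ⟨by simp [suf], by rw [← suffixWeight_eq, h, suffixWeight_eq]⟩
  have mono : ∀ x ∈ configs M F k, ∀ y ∈ configs M F k, layerLT j x y → l x < l y := by
    intro x hx y hy h
    rw [layerLT_iff] at h
    rcases h with h | ⟨h1, h⟩ | ⟨h1, h2, h | ⟨h3, h⟩⟩
    · exact hlex x hx y hy (Or.inl h)
    · exact hlex x hx y hy (Or.inr ⟨h1, Or.inl h⟩)
    -- The last prefix bit is the most significant one after reversal: if it differs, the keys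
    -- decide; otherwise the tails do.
    · by_cases he : (key j x).2.2 = (key j y).2.2
      · have hk : key j x = key j y := Prod.ext h1 (Prod.ext h2 he)
        have e1 := key_bit_add j x
        have e2 := key_bit_add j y
        have hq : prefixRank j x < prefixRank j y := by
          refine listRank_lt_listRank (by simp [pre]) ?_ ?_
          · rw [he] at e1; omega
          · have hlen : (pre j x).length = (pre j y).length := by simp [pre]
            simp only [key] at he
            revert h hlen he
            cases pre j x <;> cases pre j y <;> simp [List.cons_lt_cons_iff]
            intro h h' _
            subst h'
            simpa using h
        have hlt := hs x hx
        rw [hl x hx, hl y hy, hk, ← h2]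
        have : 2 ^ s (suffixWeight j x) * (prefixRank j x + 1) ≤
            2 ^ s (suffixWeight j x) * prefixRank j y := Nat.mul_le_mul_left _ hq
        rw [mul_add, mul_one] at this
        omega
      · refine hlex x hx y hy (Or.inr ⟨h1, Or.inr ⟨h2, ?_⟩⟩)
        have hlen : (pre j x).length = (pre j y).length := by simp [pre]
        simp only [key] at he ⊢
        revert h hlen he
        cases pre j x <;> cases pre j y <;> simp [List.cons_lt_cons_iff]
        tauto
    · have hk : key j x = key j y := Prod.ext h1 (Prod.ext h2 (by simp [key, h3]))
      have hq : prefixRank j x = prefixRank j y := by simp [prefixRank, h3]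
      have hr : suffixRank j x < suffixRank j y :=
        listRank_lt_listRank (hsc x y h2).1 (hsc x y h2).2 h
      rw [hl x hx, hl y hy, hk, hq, h2]
      omega
  have tri : ∀ x y : BitString M, layerLT j x y ∨ x = y ∨ layerLT j y x := by
    intro x y
    simp only [layerLT_iff]
    rcases lt_trichotomy (weight x) (weight y) with h | h | h
    · tauto
    · rcases lt_trichotomy (suffixWeight j x) (suffixWeight j y) with h1 | h1 | h1
      · tauto
      · rcases lt_trichotomy (pre j x) (pre j y) with h2 | h2 | h2
        · tauto
        · rcases lt_trichotomy (suf j x) (suf j y) with h3 | h3 | h3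
          · tauto
          · exact Or.inr (Or.inl (ext_pre_suf h2 h3))
          · exact Or.inr (Or.inr (Or.inr (Or.inr ⟨h.symm, h1.symm, Or.inr ⟨h2.symm, h3⟩⟩)))
        · exact Or.inr (Or.inr (Or.inr (Or.inr ⟨h.symm, h1.symm, Or.inl h2⟩)))
      · exact Or.inr (Or.inr (Or.inr (Or.inl ⟨h.symm, h1⟩)))
    · tauto
  have lt_iff : ∀ x ∈ configs M F k, ∀ y ∈ configs M F k, (l x < l y ↔ layerLT j x y) := by
    intro x hx y hy
    refine ⟨fun h => ?_, mono x hx y hy⟩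
    rcases tri x y with h1 | rfl | h1
    · exact h1
    · exact absurd h (lt_irrefl _)
    · exact absurd (mono y hy x hx h1) (by omega)
  have block : ∀ x ∈ configs M F k, ∀ z ∈ configs M F k, SameBlock j x z →
      suffixWeight j z = suffixWeight j x ∧ l z + suffixRank j x = l x + suffixRank j z := by
    intro x hx z hz h
    rw [sameBlock_iff] at h
    have e1 := weight_eq j x
    have e2 := weight_eq j z
    rw [← suffixWeight_eq] at e1 e2
    rw [h.2] at e1
    have hf : suffixWeight j z = suffixWeight j x := by omega
    have hk : key j z = key j x := Prod.ext h.1.symm (Prod.ext hf (by simp [key, h.2]))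
    have hq : prefixRank j z = prefixRank j x := by simp [prefixRank, h.2]
    rw [hl x hx, hl z hz, hk, hq, hf]
    exact ⟨rfl, by omega⟩
  refine ⟨lt_iff, fun x hx y hy hb hxy => ?_⟩
  have hb' := block x hx y hy hb
  have hlt := mono x hx y hy hxy
  classical
  suffices hcard : ((configs M F k).filter fun z =>
      SameBlock j x z ∧ ¬ layerLT j z x ∧ layerLT j z y).card =
      (Finset.Ico (suffixRank j x) (suffixRank j y)).card by
    convert_to l y = l x + ((configs M F k).filter fun z =>
      SameBlock j x z ∧ ¬ layerLT j z x ∧ layerLT j z y).card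
    rw [hcard, Nat.card_Ico]
    omega
  -- Every suffix of the right length and weight occurs in the block, so its suffix ranks have no
  -- gaps.
  refine Finset.card_nbij (suffixRank j) ?_ ?_ ?_
  · intro z hz
    simp only [Finset.coe_filter, Set.mem_ofPred_eq] at hz
    obtain ⟨hz, h1, h2, h3⟩ := hz
    have := block x hx z hz h1
    rw [← lt_iff z hz x hx] at h2
    rw [← lt_iff z hz y hy] at h3
    rw [Finset.coe_Ico, Set.mem_Ico]
    omega
  · intro z hz z' hz' h
    simp only [Finset.coe_filter, Set.mem_ofPred_eq] at hz hz'
    have h1 := (sameBlock_iff.1 hz.2.1).2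
    have h2 := (sameBlock_iff.1 hz'.2.1).2
    have f1 := (block x hx z hz.1 hz.2.1).1
    have f2 := (block x hx z' hz'.1 hz'.2.1).1
    have h3 := hsc z z' (by rw [f1, f2])
    exact ext_pre_suf (h1.symm.trans h2) (listRank_injective h3.1 h3.2 h)
  · intro r hr
    simp only [Finset.coe_Ico, Set.mem_Ico] at hr
    have hry := suffixRank_lt j y
    rw [hb'.1] at hry
    obtain ⟨t, t1, t2, t3⟩ := exists_listRank (hr.2.trans hry)
    obtain ⟨z, hz1, hz2⟩ := exists_pre_suf hj (length_pre hj x) t1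
    have hw : weight z = weight x := by
      rw [weight_eq j z, weight_eq j x, hz1, hz2, t2, suffixWeight_eq]
    have hzc : z ∈ configs M F k := by
      rw [mem_configs, hw]; exact mem_configs.1 hx
    have hzb : SameBlock j x z := sameBlock_iff.2 ⟨hw.symm, hz1.symm⟩
    have hzr : suffixRank j z = r := by rw [suffixRank, hz2, t3]
    refine ⟨z, ?_, hzr⟩
    have := block x hx z hzc hzb
    simp only [Finset.coe_filter, Set.mem_ofPred_eq]
    rw [← lt_iff z hzc x hx, ← lt_iff z hzc y hy]
    exact ⟨hzc, hzb, by omega, by omega⟩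

/-- The number of configurations of smaller weight. -/
def below (M F k m : ℕ) : ℕ := ((configs M F k).filter fun y => weight y < m).card

/-- All smaller weights come first; within the same weight the rank is that of the whole string,
viewed as the suffix at level 0. -/
theorem initialRank_eq {x : BitString M} (hx : x ∈ configs M F k) :
    initialRank M F k x = below M F k (weight x) + suffixRank 0 x := by
  classical
  have h1 : ∀ y : BitString M, layerLT 0 y x ↔ weight y < weight x ∨
      (weight y = weight x ∧ suffixRank 0 y < suffixRank 0 x) := by
    intro y
    rw [layerLT_iff, ← weight_eq_suffixWeight, ← weight_eq_suffixWeight]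
    have hp : pre 0 y = pre 0 x := by simp [pre]
    have hr : weight y = weight x → (suffixRank 0 y < suffixRank 0 x ↔ suf 0 y < suf 0 x) := by
      intro h
      refine listRank_lt_iff (by simp [suf]) ?_
      rw [← suffixWeight_eq, ← suffixWeight_eq, ← weight_eq_suffixWeight, h,
        weight_eq_suffixWeight]
    rw [hp]
    simp only [lt_irrefl, false_or, true_and]
    constructor
    · rintro (h | ⟨h, h'⟩ | ⟨h, -, h'⟩)
      · exact Or.inl h
      · omega
      · exact Or.inr ⟨h, (hr h).2 h'⟩
    · rintro (h | ⟨h, h'⟩)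
      · exact Or.inl h
      · exact Or.inr (Or.inr ⟨h, h, (hr h).1 h'⟩)
  have h2 : ((configs M F k).filter fun y => weight y = weight x ∧
      suffixRank 0 y < suffixRank 0 x).card = (Finset.range (suffixRank 0 x)).card := by
    refine Finset.card_nbij (suffixRank 0) ?_ ?_ ?_
    · intro z hz
      simp only [Finset.coe_filter, Set.mem_ofPred_eq] at hz
      simpa using hz.2.2
    · intro z hz z' hz' h
      simp only [Finset.coe_filter, Set.mem_ofPred_eq] at hz hz'
      refine ext_pre_suf (j := 0) (by simp [pre]) (listRank_injective (by simp [suf]) ?_ h)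
      rw [← suffixWeight_eq, ← suffixWeight_eq, ← weight_eq_suffixWeight,
        ← weight_eq_suffixWeight, hz.2.1, hz'.2.1]
    · intro r hr
      simp only [Finset.coe_range, Set.mem_Iio] at hr
      obtain ⟨t, t1, t2, t3⟩ := exists_listRank (hr.trans (suffixRank_lt 0 x))
      obtain ⟨z, hz1, hz2⟩ := exists_pre_suf (Nat.zero_le M) (p := []) rfl t1
      have hw : weight z = weight x := by
        rw [weight_eq_suffixWeight, suffixWeight_eq, hz2, t2, ← weight_eq_suffixWeight]
      have hzr : suffixRank 0 z = r := by rw [suffixRank, hz2, t3]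
      refine ⟨z, ?_, hzr⟩
      simp only [Finset.coe_filter, Set.mem_ofPred_eq, mem_configs, hw, hzr]
      exact ⟨mem_configs.1 hx, trivial, hr⟩
  rw [Finset.card_range] at h2
  rw [below]
  conv_rhs => rw [← h2]
  rw [← Finset.card_union_of_disjoint, ← Finset.filter_or]
  · unfold initialRank
    congr 1
    ext y
    simp only [Finset.mem_filter, h1]
  · rw [Finset.disjoint_filter]
    rintro y - h ⟨h', -⟩
    omega

theorem card_weight_eq {m : ℕ} (h1 : F ≤ m + k) (h2 : m ≤ F + k) :
    ((configs M F k).filter fun y => weight y = m).card = M.choose m := by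
  classical
  rw [← Finset.card_range (M.choose m)]
  refine Finset.card_nbij (suffixRank 0) ?_ ?_ ?_
  · intro z hz
    simp only [Finset.coe_filter, Set.mem_ofPred_eq] at hz
    have := suffixRank_lt 0 z
    rw [← weight_eq_suffixWeight, hz.2] at this
    simpa using this
  · intro z hz z' hz' h
    simp only [Finset.coe_filter, Set.mem_ofPred_eq] at hz hz'
    refine ext_pre_suf (j := 0) (by simp [pre]) (listRank_injective (by simp [suf]) ?_ h)
    rw [← suffixWeight_eq, ← suffixWeight_eq, ← weight_eq_suffixWeight,
      ← weight_eq_suffixWeight, hz.2, hz'.2]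
  · intro r hr
    simp only [Finset.coe_range, Set.mem_Iio] at hr
    obtain ⟨t, t1, t2, t3⟩ := exists_listRank hr
    obtain ⟨z, hz1, hz2⟩ := exists_pre_suf (M := M) (Nat.zero_le M) (p := []) rfl t1
    have hw : weight z = m := by
      rw [weight_eq_suffixWeight, suffixWeight_eq, hz2, t2]
    refine ⟨z, ?_, by rw [suffixRank, hz2, t3]⟩
    simp only [Finset.coe_filter, Set.mem_ofPred_eq, mem_configs, hw]
    exact ⟨⟨h1, h2⟩, trivial⟩

theorem below_succ {m : ℕ} (h1 : F ≤ m + k) (h2 : m ≤ F + k) :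
    below M F k (m + 1) = below M F k m + M.choose m := by
  classical
  rw [← card_weight_eq h1 h2, below, below, ← Finset.card_union_of_disjoint, ← Finset.filter_or]
  · congr 1
    ext y
    simp only [Finset.mem_filter, Nat.lt_succ_iff_lt_or_eq]
  · rw [Finset.disjoint_filter]
    rintro y - h h'
    omega

theorem below_mono {m m' : ℕ} (h : m ≤ m') : below M F k m ≤ below M F k m' :=
  Finset.card_le_card fun y hy => by
    simp only [Finset.mem_filter] at hy ⊢
    exact ⟨hy.1, by omega⟩

theorem below_eq_zero {m : ℕ} (h : m ≤ F - k) : below M F k m = 0 := by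
  rw [below, Finset.card_eq_zero, Finset.filter_eq_empty_iff]
  intro y hy
  have := mem_configs.1 hy
  omega

theorem suffixRank_zero_lt (x : BitString M) : suffixRank 0 x < M.choose (weight x) := by
  have := suffixRank_lt 0 x
  rwa [← weight_eq_suffixWeight] at this

/-- At level 0 the prefix is empty, and the dense ranks have the form required by
`isLayerLabelling_of` with the unaligned bases `below`. -/
theorem isLayerLabelling_initialRank :
    IsLayerLabelling M F k 0 (initialRank M F k) := by
  refine isLayerLabelling_of (Nat.zero_le M) (fun h => below M F k h.1)
    (fun f => Nat.clog 2 (M.choose f)) _ ?_ ?_ ?_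
  · intro x hx
    rw [initialRank_eq hx]
    simp [key, prefixRank, pre, listRank]
  · intro x hx
    rw [← weight_eq_suffixWeight]
    exact (suffixRank_zero_lt x).trans_le (Nat.le_pow_clog (by norm_num) _)
  · intro x hx y hy h
    have h' : weight x < weight y := by
      rcases h with h | ⟨h, h' | ⟨-, h'⟩⟩
      · exact h
      · simp only [key, ← weight_eq_suffixWeight] at h h'; omega
      · simp [key, pre] at h'
    rw [initialRank_eq hx, initialRank_eq hy]
    have h1 := suffixRank_zero_lt x
    have h2 := below_succ (M := M) (mem_configs.1 hx).1 (mem_configs.1 hx).2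
    have h3 := below_mono (M := M) (F := F) (k := k) (show weight x + 1 ≤ weight y from h')
    omega

end Labels

/-! ### Padded intervals at each level, and how ranks change between levels -/

section Levels

/-- The least multiple of `2 ^ t` that is at least `u`. -/
def alignUp (u t : ℕ) : ℕ := 2 ^ t * ((u + (2 ^ t - 1)) / 2 ^ t)

theorem le_alignUp (u t : ℕ) : u ≤ alignUp u t := by
  have h : 0 < 2 ^ t := by positivity
  have h1 := Nat.div_add_mod (u + (2 ^ t - 1)) (2 ^ t)
  have h2 := Nat.mod_lt (u + (2 ^ t - 1)) h
  unfold alignUp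
  omega

theorem alignUp_lt (u t : ℕ) : alignUp u t < u + 2 ^ t := by
  have h : 0 < 2 ^ t := by positivity
  have h1 := Nat.div_add_mod (u + (2 ^ t - 1)) (2 ^ t)
  unfold alignUp
  omega

/-- The space that intervals of the given widths occupy before the interval `h`. -/
def spaceBefore (idx : Finset (ℕ × ℕ × Bool)) (w : ℕ × ℕ × Bool → ℕ) (h : ℕ × ℕ × Bool) : ℕ :=
  ∑ h' ∈ idx.filter (keyLT · h), 2 ^ (w h' + 1)

theorem spaceBefore_add_le {idx : Finset (ℕ × ℕ × Bool)} (w : ℕ × ℕ × Bool → ℕ)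
    {h h' : ℕ × ℕ × Bool} (hh : h ∈ idx) (hlt : keyLT h h') :
    spaceBefore idx w h + 2 ^ (w h + 1) ≤ spaceBefore idx w h' := by
  have hn : h ∉ idx.filter (keyLT · h) := by simp [keyLT_irrefl]
  rw [spaceBefore, add_comm, ← Finset.sum_insert (f := fun a => 2 ^ (w a + 1)) hn]
  refine Finset.sum_le_sum_of_subset fun a ha => ?_
  rcases Finset.mem_insert.1 ha with rfl | ha
  · exact Finset.mem_filter.2 ⟨hh, hlt⟩
  · rw [Finset.mem_filter] at ha ⊢
    exact ⟨ha.1, keyLT_trans ha.2 hlt⟩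

theorem spaceBefore_add_le_sum {idx : Finset (ℕ × ℕ × Bool)} (w : ℕ × ℕ × Bool → ℕ)
    {h : ℕ × ℕ × Bool} (hh : h ∈ idx) :
    spaceBefore idx w h + 2 ^ (w h + 1) ≤ ∑ h' ∈ idx, 2 ^ (w h' + 1) := by
  have hn : h ∉ idx.filter (keyLT · h) := by simp [keyLT_irrefl]
  rw [spaceBefore, add_comm, ← Finset.sum_insert (f := fun a => 2 ^ (w a + 1)) hn]
  refine Finset.sum_le_sum_of_subset fun a ha => ?_
  rcases Finset.mem_insert.1 ha with rfl | ha
  · exact hh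
  · exact (Finset.mem_filter.1 ha).1

/-- The first label of an interval, when the intervals are laid out in lexicographic order. -/
def alignedBase (idx : Finset (ℕ × ℕ × Bool)) (w : ℕ × ℕ × Bool → ℕ) (h : ℕ × ℕ × Bool) : ℕ :=
  alignUp (spaceBefore idx w h) (w h)

/-- Each interval reserves twice its length; rounding its base up to a multiple of the length uses
less than one of the two shares. -/
theorem alignedBase_add_le {idx : Finset (ℕ × ℕ × Bool)} (w : ℕ × ℕ × Bool → ℕ)
    {h h' : ℕ × ℕ × Bool} (hh : h ∈ idx) (hlt : keyLT h h') :
    alignedBase idx w h + 2 ^ w h ≤ alignedBase idx w h' := by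
  have h1 := spaceBefore_add_le w hh hlt
  have h2 := alignUp_lt (spaceBefore idx w h) (w h)
  have h3 := le_alignUp (spaceBefore idx w h') (w h')
  rw [pow_succ] at h1
  unfold alignedBase
  omega

theorem alignedBase_add_le_sum {idx : Finset (ℕ × ℕ × Bool)} (w : ℕ × ℕ × Bool → ℕ)
    {h : ℕ × ℕ × Bool} (hh : h ∈ idx) :
    alignedBase idx w h + 2 ^ w h ≤ ∑ h' ∈ idx, 2 ^ (w h' + 1) := by
  have h1 := spaceBefore_add_le_sum w hh
  have h2 := alignUp_lt (spaceBefore idx w h) (w h)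
  rw [pow_succ] at h1
  unfold alignedBase
  omega

/-- Intervals of given widths, laid out in lexicographic order. -/
def Layout.ofWidths {L T : ℕ} (idx : Finset (ℕ × ℕ × Bool)) (w : ℕ × ℕ × Bool → ℕ)
    (hw : ∀ h ∈ idx, L - T ≤ w h) (hsum : ∑ h ∈ idx, 2 ^ (w h + 1) ≤ 2 ^ L) :
    Layout L T (ℕ × ℕ × Bool) where
  idx := idx
  base := alignedBase idx w
  width := w
  le_width := hw
  width_le h hh := by
    have := (alignedBase_add_le_sum w hh).trans hsum
    exact (Nat.pow_le_pow_iff_right (by norm_num)).1 ((Nat.le_add_left _ _).trans this)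
  dvd_base h _ := Dvd.intro _ rfl
  base_add_le h hh := (alignedBase_add_le_sum w hh).trans hsum
  disjoint h hh h' hh' hne := by
    rcases keyLT_total hne with hlt | hlt
    · exact Or.inl (alignedBase_add_le w hh hlt)
    · exact Or.inr (alignedBase_add_le w hh' hlt)

variable {M F k L S T : ℕ}

/-- The number of strings with a given key. -/
def keyCount (M j : ℕ) (h : ℕ × ℕ × Bool) : ℕ :=
  (j - 1).choose (h.1 - h.2.1 - h.2.2.toNat) * (M - j).choose h.2.1

/-- The number of bits for the rank of the suffix. -/
def suffixBits (M j f : ℕ) : ℕ := Nat.clog 2 ((M - j).choose f)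

/-- The keys that occur at the level `j`. -/
def levelIdx (M F k j : ℕ) : Finset (ℕ × ℕ × Bool) :=
  (Finset.range (F + k + 1) ×ˢ Finset.range (F + k + 1) ×ˢ Finset.univ).filter fun h =>
    F ≤ h.1 + k ∧ h.2.1 + h.2.2.toNat ≤ h.1 ∧ j ≤ M ∧ 0 < keyCount M j h

/-- The binary logarithm of the length of an interval of labels. -/
def levelWidth (M N j : ℕ) (h : ℕ × ℕ × Bool) : ℕ :=
  -- Two fields for the two ranks, and one vacant bit that `Layout.mImpl_split` needs for the carry.
  -- With N = L - T the lower bound makes the interval visible to the T topmost bits.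
  max N (Nat.clog 2 ((j - 1).choose (h.1 - h.2.1 - h.2.2.toNat)) + suffixBits M j h.2.1 + 1)

/-- The intervals of labels fit in half of the space of labels. -/
def LevelsFit (M F k L T : ℕ) : Prop :=
  ∀ j, ∑ h ∈ levelIdx M F k j, 2 ^ (levelWidth M (L - T) j h + 1) ≤ 2 ^ (L - 1)

theorem mem_levelIdx {j : ℕ} {h : ℕ × ℕ × Bool} : h ∈ levelIdx M F k j ↔ h.1 ≤ F + k ∧
    F ≤ h.1 + k ∧ h.2.1 + h.2.2.toNat ≤ h.1 ∧ j ≤ M ∧ 0 < keyCount M j h := by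
  simp only [levelIdx, Finset.mem_filter, Finset.mem_product, Finset.mem_range, Finset.mem_univ,
    and_true]
  omega

/-- The layout of the labels at the level `j`. -/
def level (hf : LevelsFit M F k L T) (j : ℕ) : Layout L T (ℕ × ℕ × Bool) :=
  Layout.ofWidths (levelIdx M F k j) (levelWidth M (L - T) j) (fun _ _ => le_max_left _ _)
    ((hf j).trans (Nat.pow_le_pow_right (by norm_num) (Nat.sub_le _ _)))

variable (hf : LevelsFit M F k L T)

theorem level_width (j : ℕ) : (level hf j).width = levelWidth M (L - T) j := rfl

theorem level_base_add_le (j : ℕ) {h : ℕ × ℕ × Bool} (hh : h ∈ levelIdx M F k j) :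
    (level hf j).base h + 2 ^ levelWidth M (L - T) j h ≤ 2 ^ (L - 1) :=
  (alignedBase_add_le_sum _ hh).trans (hf j)

theorem level_base_lt (j : ℕ) {h h' : ℕ × ℕ × Bool} (hh : h ∈ levelIdx M F k j)
    (hlt : keyLT h h') :
    (level hf j).base h + 2 ^ levelWidth M (L - T) j h ≤ (level hf j).base h' :=
  alignedBase_add_le _ hh hlt

theorem suffixWeight_add_toNat_le (j : ℕ) (x : BitString M) :
    suffixWeight j x + (key j x).2.2.toNat ≤ weight x := by
  have := key_bit_add j x
  omega

theorem key_mem {j : ℕ} (hj : j ≤ M) {x : BitString M} (hx : x ∈ configs M F k) :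
    key j x ∈ levelIdx M F k j := by
  rw [mem_levelIdx]
  have h := mem_configs.1 hx
  refine ⟨h.2, h.1, suffixWeight_add_toNat_le j x, hj, ?_⟩
  exact Nat.mul_pos (lt_of_le_of_lt (Nat.zero_le _) (prefixRank_lt hj x))
    (lt_of_le_of_lt (Nat.zero_le _) (suffixRank_lt j x))

theorem suffixRank_lt_pow (j : ℕ) (x : BitString M) :
    suffixRank j x < 2 ^ suffixBits M j (suffixWeight j x) :=
  (suffixRank_lt j x).trans_le (Nat.le_pow_clog (by norm_num) _)

/-- The position of the label of a string within its interval. -/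
def labelOffset (j : ℕ) (x : BitString M) : ℕ :=
  2 ^ suffixBits M j (suffixWeight j x) * prefixRank j x + suffixRank j x

theorem prefixRank_lt_pow {j : ℕ} (hj : j ≤ M) (x : BitString M) (N : ℕ) :
    prefixRank j x <
      2 ^ (levelWidth M N j (key j x) - 1 - suffixBits M j (suffixWeight j x)) := by
  refine ((prefixRank_lt hj x).trans_le (Nat.le_pow_clog (by norm_num) _)).trans_le
    (Nat.pow_le_pow_right (by norm_num) ?_)
  simp only [levelWidth, key]
  omega

theorem suffixBits_lt (j N : ℕ) (h : ℕ × ℕ × Bool) :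
    suffixBits M j h.2.1 < levelWidth M N j h := by
  simp only [levelWidth]
  omega

theorem labelOffset_lt {j : ℕ} (hj : j ≤ M) (x : BitString M) (N : ℕ) :
    labelOffset j x < 2 ^ (levelWidth M N j (key j x) - 1) := by
  have h1 := prefixRank_lt_pow hj x N
  have h2 := suffixBits_lt (M := M) j N (key j x)
  exact fields_lt (Nat.le_sub_one_of_lt h2) (suffixRank_lt_pow j x) h1

theorem labelOffset_lt' {j : ℕ} (hj : j ≤ M) (x : BitString M) (N : ℕ) :
    labelOffset j x < 2 ^ levelWidth M N j (key j x) :=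
  (labelOffset_lt hj x N).trans_le (Nat.pow_le_pow_right (by norm_num) (Nat.sub_le _ _))

/-- The aligned labels of the level `j`. -/
def alignedLabel (j : ℕ) (x : BitString M) : ℕ := (level hf j).base (key j x) + labelOffset j x

theorem alignedLabel_mem {j : ℕ} (hj : j ≤ M) (x : BitString M) :
    (level hf j).Mem (key j x) (alignedLabel hf j x) :=
  Layout.mem_base_add (labelOffset_lt' hj x _)

theorem alignedLabel_lt {j : ℕ} (hj : j ≤ M) {x : BitString M} (hx : x ∈ configs M F k) :
    alignedLabel hf j x < 2 ^ (L - 1) :=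
  (alignedLabel_mem hf hj x).2.trans_le (level_base_add_le hf j (key_mem hj hx))

theorem isLayerLabelling_alignedLabel {j : ℕ} (hj : j ≤ M) :
    IsLayerLabelling M F k j (alignedLabel hf j) := by
  refine isLayerLabelling_of hj (level hf j).base (suffixBits M j) _ (fun x _ => rfl)
    (fun x _ => suffixRank_lt_pow j x) fun x hx y hy h => ?_
  have h1 := (alignedLabel_mem hf hj x).2
  have h2 := (alignedLabel_mem hf hj y).1
  have h3 := level_base_lt hf j (key_mem hj hx) h
  exact (h1.trans_le h3).trans_le h2

theorem alignedLabel_mem_iff {j : ℕ} (hj : j ≤ M) {x : BitString M} (hx : x ∈ configs M F k)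
    {h : ℕ × ℕ × Bool} (hh : h ∈ levelIdx M F k j) :
    (level hf j).Mem h (alignedLabel hf j x) ↔ key j x = h := by
  constructor
  · intro hm
    exact Layout.Mem.unique (Λ := level hf j) (key_mem hj hx) hh (alignedLabel_mem hf hj x) hm
  · rintro rfl
    exact alignedLabel_mem hf hj x

/-! ### From one level to the next -/

theorem key_succ (j : Fin M) (x : BitString M) :
    key (j + 1) x = (weight x, suffixWeight (j + 1) x, x j) := by
  rw [key, pre_succ]; rfl

theorem suffixWeight_succ (j : Fin M) (x : BitString M) :
    suffixWeight j x = suffixWeight (j + 1) x + (x j).toNat := by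
  rw [suffixWeight_eq, suffixWeight_eq, suf_eq_cons]
  cases x j <;> simp

theorem suffixRank_succ (j : Fin M) (x : BitString M) :
    suffixRank j x = (if x j then (M - j - 1).choose (suffixWeight j x) else 0) +
      suffixRank (j + 1) x := by
  have h := suffixWeight_succ j x
  rw [suffixRank, suf_eq_cons, listRank, suffixRank, length_suf, ← suffixWeight_eq]
  cases hx : x j
  · simp
  · rw [hx, Bool.toNat_true] at h
    rw [h, Nat.sub_sub]

/-- The binomial coefficient counts the suffixes of this weight that begin with zero, and these have
the smallest ranks. The comparison extracts the bit that leaves the suffix. -/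
theorem suffixRank_compare (j : Fin M) (x : BitString M) :
    (M - j - 1).choose (suffixWeight j x) ≤ suffixRank j x ↔ x j = true := by
  rw [suffixRank_succ]
  cases hx : x j
  · have h := suffixRank_lt (j + 1) x
    have h' := suffixWeight_succ j x
    rw [hx, Bool.toNat_false, add_zero] at h'
    rw [h', Nat.sub_sub]
    simpa using h
  · simp

/-- The bit that was part of the key at level j becomes the head of the list ranked at level j + 1,
so this is one step of `listRank`. -/
theorem prefixRank_succ (j : Fin M) (x : BitString M) :
    prefixRank (j + 1) x = (if (key j x).2.2 then
      ((j : ℕ) - 1).choose (weight x - suffixWeight (j + 1) x - (x j).toNat) else 0) +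
      prefixRank j x := by
  have h1 := weight_eq j x
  have h2 := suffixWeight_succ j x
  have h3 := length_pre j.2.le x
  rw [← suffixWeight_eq] at h1
  rw [prefixRank, pre_succ, List.tail_cons, prefixRank, key]
  have h4 : weight x - suffixWeight (j + 1) x - (x j).toNat = (pre j x).count true := by omega
  have h5 : (j : ℕ) - 1 = (pre j x).length - 1 := by rw [h3]
  rw [h4, h5]
  generalize pre j x = p
  cases p with
  | nil => simp [listRank]
  | cons b l => cases b <;> simp [listRank]

/-- The threshold is a multiple of 2^s, so the lower field `r` cannot affect the comparison. It
recovers the old key bit from the label at level j + 1, which makes the reordering reversible. -/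
theorem prefixRank_compare (j : Fin M) (x : BitString M) {r s : ℕ} (hr : r < 2 ^ s) :
    ((j : ℕ) - 1).choose (weight x - suffixWeight (j + 1) x - (x j).toNat) * 2 ^ s ≤
      2 ^ s * prefixRank (j + 1) x + r ↔ (key j x).2.2 = true := by
  rw [prefixRank_succ, mul_comm _ (2 ^ s)]
  cases hx : (key j x).2.2
  · have h := prefixRank_lt j.2.le x
    have h' := suffixWeight_succ j x
    rw [hx, Bool.toNat_false, Nat.sub_zero, h', ← Nat.sub_sub] at h
    have h2 : 2 ^ s * (prefixRank j x + 1) ≤ 2 ^ s * ((j : ℕ) - 1).choose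
        (weight x - suffixWeight (j + 1) x - (x j).toNat) := Nat.mul_le_mul_left _ h
    simp only [Bool.false_eq_true, if_false, zero_add, iff_false, not_le]
    rw [mul_add, mul_one] at h2
    omega
  · simp only [if_true, iff_true, mul_add]
    omega

end Levels

/-! ### Reordering, flips and signs on aligned labels -/

section Reorder

variable {M F k L S T : ℕ} (hf : LevelsFit M F k L T)

theorem Layout.SplitRel.intro {H : Type} {Λ : Layout L T H} {b K : H → ℕ} {h : H}
    (hh : h ∈ Λ.idx) {hi f g : ℕ} {e : Bool} (hb : b h < Λ.width h) (hK : K h ≤ 2 ^ b h)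
    (hfb : f < 2 ^ b h) (hhi : hi < 2 ^ (Λ.width h - 1 - b h)) (he : K h ≤ f ↔ e = true)
    (hg : f = (if e then K h else 0) + g) :
    Λ.SplitRel b K (Λ.base h + (2 ^ b h * hi + f), false, false)
      (Λ.base h + (2 ^ b h * hi + g), e, false) := by
  refine ⟨h, hh, hi, f, hb, hK, hfb, hhi, rfl, ?_⟩
  cases e
  · have hn : ¬ K h ≤ f := by simp [he]
    simp only [Bool.false_eq_true, if_false, zero_add] at hg
    rw [if_neg hn, decide_eq_false hn, hg]
  · have hn : K h ≤ f := by simp [he]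
    simp only [if_true] at hg
    simp only [hn, if_true, decide_true, Prod.mk.injEq, and_true]
    omega

theorem splitRel_suffix (j : Fin M) {x : BitString M} (hx : x ∈ configs M F k) :
    (level hf j).SplitRel (fun h => suffixBits M j h.2.1) (fun h => (M - j - 1).choose h.2.1)
      (alignedLabel hf j x, false, false)
      ((level hf j).base (key j x) + (2 ^ suffixBits M j (suffixWeight j x) * prefixRank j x +
        suffixRank (j + 1) x), x j, false) :=
  Layout.SplitRel.intro (Λ := level hf j) (key_mem j.2.le hx) (suffixBits_lt _ _ _)
    ((Nat.choose_le_choose _ (Nat.sub_le _ _)).trans (Nat.le_pow_clog (by norm_num) _))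
    (suffixRank_lt_pow _ _) (prefixRank_lt_pow j.2.le x _) (suffixRank_compare j x)
    (suffixRank_succ j x)

/-- Read backwards, this inserts the old key bit into the prefix rank. The field is the whole offset
below the vacant top bit, with nothing above it, so the threshold is scaled by the size of the
suffix field. -/
theorem splitRel_prefix (j : Fin M) {x : BitString M} (hx : x ∈ configs M F k) :
    (level hf (j + 1)).SplitRel (fun h => levelWidth M (L - T) (j + 1) h - 1)
      (fun h => ((j : ℕ) - 1).choose (h.1 - h.2.1 - h.2.2.toNat) * 2 ^ suffixBits M (j + 1) h.2.1)
      (alignedLabel hf (j + 1) x, false, false)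
      ((level hf (j + 1)).base (key (j + 1) x) +
        (2 ^ suffixBits M (j + 1) (suffixWeight (j + 1) x) * prefixRank j x +
        suffixRank (j + 1) x), (key j x).2.2, false) := by
  have hlt := labelOffset_lt (j := j + 1) j.2 x (L - T)
  have hs := suffixRank_lt_pow (j + 1) x
  have hb := suffixBits_lt (M := M) (j + 1) (L - T) (key (j + 1) x)
  have hK : ((j : ℕ) - 1).choose (weight x - suffixWeight (j + 1) x - (x j).toNat) *
      2 ^ suffixBits M (j + 1) (suffixWeight (j + 1) x) ≤
      2 ^ (levelWidth M (L - T) (j + 1) (weight x, suffixWeight (j + 1) x, x j) - 1) := by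
    have h1 : ((j : ℕ) - 1).choose (weight x - suffixWeight (j + 1) x - (x j).toNat) ≤
        2 ^ Nat.clog 2 (((j : ℕ) + 1 - 1).choose
          (weight x - suffixWeight (j + 1) x - (x j).toNat)) :=
      (Nat.choose_le_choose _ (by omega)).trans (Nat.le_pow_clog (by norm_num) _)
    refine (Nat.mul_le_mul_right _ h1).trans ?_
    rw [← pow_add]
    refine Nat.pow_le_pow_right (by norm_num) ?_
    simp only [levelWidth]
    omega
  rw [← key_succ] at hK
  have hw : levelWidth M (L - T) (j + 1) (key (j + 1) x) - 1 <
      levelWidth M (L - T) (j + 1) (key (j + 1) x) := by omega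
  have := Layout.SplitRel.intro (Λ := level hf (j + 1)) (key_mem (j := j + 1) j.2 hx)
    (b := fun h => levelWidth M (L - T) (j + 1) h - 1)
    (K := fun h => ((j : ℕ) - 1).choose (h.1 - h.2.1 - h.2.2.toNat) *
      2 ^ suffixBits M (j + 1) h.2.1) (hi := 0) (f := labelOffset (j + 1) x)
    (g := 2 ^ suffixBits M (j + 1) (suffixWeight (j + 1) x) * prefixRank j x +
      suffixRank (j + 1) x) (e := (key j x).2.2) hw (by rw [key_succ] at hK ⊢; exact hK) hlt
    (by positivity) (by rw [key_succ]; exact prefixRank_compare j x hs) (by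
      rw [labelOffset, prefixRank_succ, key_succ, mul_add, add_assoc]
      congr 1
      split_ifs
      · rw [mul_comm]
      · rfl)
  rw [mul_zero, zero_add, zero_add] at this
  exact this

/-- The keys at a level, with the next bit. -/
def moveIdx (M F k j : ℕ) : Finset ((ℕ × ℕ × Bool) × Bool) :=
  (levelIdx M F k j ×ˢ Finset.univ).filter fun g =>
    g.2.toNat ≤ g.1.2.1 ∧ (g.1.1, g.1.2.1 - g.2.toNat, g.2) ∈ levelIdx M F k (j + 1)

theorem card_moveIdx_le (j : ℕ) : (moveIdx M F k j).card ≤ 2 * (levelIdx M F k j).card := by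
  refine (Finset.card_filter_le _ _).trans ?_
  rw [Finset.card_product]
  simp [mul_comm]

/-- Shortening the suffix does not lengthen its field, so the shift in `mImpl_move` goes downwards
only. -/
theorem suffixBits_succ_le (j : Fin M) (x : BitString M) :
    suffixBits M (j + 1) (suffixWeight (j + 1) x) ≤ suffixBits M j (suffixWeight j x) := by
  refine Nat.clog_mono_right _ ?_
  rw [suffixWeight_succ]
  have h : M - j = M - (j + 1) + 1 := by have := j.2; omega
  cases x j
  · exact Nat.choose_le_choose _ (by omega)
  · rw [h, Bool.toNat_true, Nat.choose_succ_succ]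
    exact Nat.le_add_right _ _

/-- The circuit that leads from one level of aligned labels to the next. -/
theorem mImpl_reorder {D : ℕ} (hT : T ≤ L) (hS : 0 < S) (hD : L = S * D) (j : Fin M) {c : ℕ}
    (hc : (levelIdx M F k j).card ≤ c) (hc' : (levelIdx M F k (j + 1)).card ≤ c) :
    MImpl L S (fun a b => ∃ x ∈ configs M F k, a = (alignedLabel hf j x, false, false) ∧
      b = (alignedLabel hf (j + 1) x, false, false))
      (6 * (c * (15 * (L + S + 6) + 6 * 2 ^ (T + 2))) +
        4 * (D * (S * (6 * 2 ^ (T + 2)) + 260 * L + 210)) + 2) := by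
  -- The leaving bit is split off the suffix rank into the flag. The move finds the new interval
  -- from the old key and this bit, and puts the old key bit into the flag. The reversed split
  -- absorbs that one into the prefix rank.
  have h1 := (level hf j).mImpl_split hT hS hD (fun h => suffixBits M j h.2.1)
    (fun h => (M - j - 1).choose h.2.1)
  have h2 := mImpl_move (S := S) (level hf j) (level hf (j + 1)) hT (fun g => g.1)
    (fun g : (ℕ × ℕ × Bool) × Bool => (g.1.1, g.1.2.1 - g.2.toNat, g.2)) (fun g => g.2)
    (fun g => g.1.2.2) (fun g => suffixBits M j g.1.2.1)
    (fun g => suffixBits M (j + 1) (g.1.2.1 - g.2.toNat)) (moveIdx M F k j)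
    (fun g _ g' _ h h' => Prod.ext h h')
    -- The new key gives the weight, the new bit and, by adding this bit, the old suffix weight; the
    -- flag gives the old key bit.
    (by
      rintro ⟨⟨m, f, e⟩, e'⟩ hg ⟨⟨n, g, d⟩, d'⟩ hg' h h'
      simp only [moveIdx, Finset.mem_filter] at hg hg'
      simp only [Prod.mk.injEq] at h h' ⊢
      obtain ⟨rfl, h1, rfl⟩ := h
      exact ⟨⟨rfl, by omega, h'⟩, rfl⟩)
    (fun g hg => (Finset.mem_product.1 (Finset.mem_filter.1 hg).1).1)
    (fun g hg => (Finset.mem_filter.1 hg).2.2)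
  have h3 := mImpl_resetFlag (L := L) (S := S)
  have h4 := ((level hf (j + 1)).mImpl_split hT hS hD
    (fun h => levelWidth M (L - T) (j + 1) h - 1)
    (fun h => ((j : ℕ) - 1).choose (h.1 - h.2.1 - h.2.2.toNat) *
      2 ^ suffixBits M (j + 1) h.2.1)).inv
  refine (h1.comp (h2.comp (h3.comp h4))).mono ?_ ?_
  · rintro a b ha hb ⟨x, hx, rfl, rfl⟩
    have hs : suffixRank (j + 1) x < 2 ^ suffixBits M (j + 1) (suffixWeight (j + 1) x) :=
      suffixRank_lt_pow _ _
    have hw : suffixWeight j x - (x j).toNat = suffixWeight (j + 1) x := by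
      rw [suffixWeight_succ]; omega
    have hle := suffixBits_succ_le j x
    have hk : (key j x, x j).1.1 = weight x := rfl
    have o1 : 2 ^ suffixBits M j (suffixWeight j x) * prefixRank j x + suffixRank (j + 1) x <
        2 ^ levelWidth M (L - T) j (key j x) := by
      refine lt_of_le_of_lt (Nat.add_le_add_left ?_ _) (labelOffset_lt' j.2.le x (L - T))
      rw [suffixRank_succ]; exact Nat.le_add_left _ _
    have o2 : 2 ^ suffixBits M (j + 1) (suffixWeight (j + 1) x) * prefixRank j x +
        suffixRank (j + 1) x < 2 ^ levelWidth M (L - T) (j + 1) (key (j + 1) x) := by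
      refine lt_of_le_of_lt (Nat.add_le_add_right (Nat.mul_le_mul_left _ ?_) _)
        (labelOffset_lt' (j := j + 1) j.2 x (L - T))
      rw [prefixRank_succ]; exact Nat.le_add_left _ _
    have m1 := key_mem j.2.le hx
    have m2 : key (j + 1) x ∈ levelIdx M F k (j + 1) := key_mem j.2 hx
    have hg : (weight x, suffixWeight j x - (x j).toNat, x j) = key (j + 1) x := by
      rw [key_succ, hw]
    refine ⟨_, ?_, splitRel_suffix hf j hx,
      ((level hf (j + 1)).base (key (j + 1) x) +
        (2 ^ suffixBits M (j + 1) (suffixWeight (j + 1) x) * prefixRank j x +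
        suffixRank (j + 1) x), (key j x).2.2, true), ?_,
      ⟨(key j x, x j), ?_, m1, ?_, ?_, ?_, prefixRank j x, suffixRank (j + 1) x, ?_, o1, ?_, rfl,
        ?_⟩,
      _, ?_, rfl, ?_⟩
    · exact Layout.Mem.lt (Λ := level hf j) m1 (Layout.mem_base_add o1)
    · exact Layout.Mem.lt (Λ := level hf (j + 1)) m2 (Layout.mem_base_add o2)
    · simp only [moveIdx, Finset.mem_filter, Finset.mem_product, Finset.mem_univ, and_true]
      refine ⟨m1, ?_, ?_⟩
      · change _ ≤ suffixWeight j x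
        rw [suffixWeight_succ]; omega
      · change (weight x, suffixWeight j x - (x j).toNat, x j) ∈ _
        rw [hg]; exact m2
    · change (weight x, suffixWeight j x - (x j).toNat, x j) ∈ levelIdx M F k (j + 1)
      rw [hg]; exact m2
    · change suffixBits M (j + 1) (suffixWeight j x - (x j).toNat) ≤
        suffixBits M j (suffixWeight j x)
      rw [hw]; exact hle
    · exact (suffixBits_lt _ _ _).le.trans ((level hf j).width_le _ m1)
    · change _ < 2 ^ suffixBits M (j + 1) (suffixWeight j x - (x j).toNat)
      rw [hw]; exact hs
    · change 2 ^ suffixBits M (j + 1) (suffixWeight j x - (x j).toNat) * _ + _ <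
        2 ^ levelWidth M (L - T) (j + 1) (weight x, suffixWeight j x - (x j).toNat, x j)
      rw [hg, hw]; exact o2
    · change _ = ((level hf (j + 1)).base (weight x, suffixWeight j x - (x j).toNat, x j) +
        (2 ^ suffixBits M (j + 1) (suffixWeight j x - (x j).toNat) * _ + _), _, _)
      rw [hg, hw]
    · exact Layout.Mem.lt (Λ := level hf (j + 1)) m2 (Layout.mem_base_add o2)
    · exact splitRel_prefix hf j hx
  · have e1 : ∀ i (hi : (levelIdx M F k i).card ≤ c), (level hf i).idx.card *
        (13 * (L + S + 6) + 6 * 2 ^ (T + 2)) ≤ c * (15 * (L + S + 6) + 6 * 2 ^ (T + 2)) :=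
      fun i hi => Nat.mul_le_mul hi (by omega)
    have e2 : (moveIdx M F k j).card * (15 * (L + S + 6) + 6 * 2 ^ (T + 2)) ≤
        2 * (c * (15 * (L + S + 6) + 6 * 2 ^ (T + 2))) := by
      rw [← mul_assoc]
      exact Nat.mul_le_mul_right _ ((card_moveIdx_le _).trans (by omega))
    have e3 := e1 j hc
    have e4 := e1 (j + 1) hc'
    omega

/-! ### Flips and signs -/

/-- The flip changes only the head of the reversed prefix, which belongs to the key; the tail and
the suffix, hence both ranks, stay. -/
theorem bitFlip_labels (j : Fin M) {x : BitString M} (hx : x j = false) :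
    key (j + 1) (bitFlip j x) = (weight x + 1, suffixWeight (j + 1) x, true) ∧
      labelOffset (j + 1) (bitFlip j x) = labelOffset (j + 1) x := by
  have h1 := pre_succ j (bitFlip j x)
  have h2 := pre_succ j x
  rw [pre_bitFlip, bitFlip_self, hx, Bool.not_false] at h1
  rw [hx] at h2
  have h3 := suf_bitFlip j x
  have hw : suffixWeight (j + 1) (bitFlip j x) = suffixWeight (j + 1) x := by
    rw [suffixWeight_eq, suffixWeight_eq, h3]
  refine ⟨?_, ?_⟩
  · rw [key, hw, h1, weight_eq (j + 1) (bitFlip j x), weight_eq (j + 1) x, h1, h2, h3]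
    simp; omega
  · simp only [labelOffset, hw, prefixRank, suffixRank, h1, h2, h3, List.tail_cons]

theorem levelWidth_flip (j m f N : ℕ) :
    levelWidth M N j (m + 1, f, true) = levelWidth M N j (m, f, false) := by
  simp only [levelWidth, Bool.toNat_true, Bool.toNat_false]
  rw [show m + 1 - f - 1 = m - f - 0 by omega]

/-- The pairs of keys that are exchanged by a flip. -/
def flipIdx (M F k j : ℕ) : Finset (ℕ × ℕ) :=
  (Finset.range (F + k + 1) ×ˢ Finset.range (F + k + 1)).filter fun g =>
    (g.1, g.2, false) ∈ levelIdx M F k j ∧ (g.1 + 1, g.2, true) ∈ levelIdx M F k j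

theorem mem_flipIdx {j : ℕ} {g : ℕ × ℕ} : g ∈ flipIdx M F k j ↔
    (g.1, g.2, false) ∈ levelIdx M F k j ∧ (g.1 + 1, g.2, true) ∈ levelIdx M F k j := by
  simp only [flipIdx, Finset.mem_filter, Finset.mem_product, Finset.mem_range,
    and_iff_right_iff_imp]
  rintro ⟨h, -⟩
  rw [mem_levelIdx] at h
  simp only at h
  omega

theorem card_flipIdx_le (j : ℕ) : (flipIdx M F k j).card ≤ (levelIdx M F k j).card := by
  refine Finset.card_le_card_of_injOn (fun g => (g.1, g.2, false)) ?_ ?_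
  · intro g hg
    exact (mem_flipIdx.1 hg).1
  · intro g _ g' _ h
    simp only [Prod.mk.injEq] at h
    exact Prod.ext h.1 h.2.1

/-- The key belongs to the pair of keys. -/
def InPair (g : ℕ × ℕ) (h : ℕ × ℕ × Bool) : Prop :=
  h = (g.1, g.2, false) ∨ h = (g.1 + 1, g.2, true)

/-- Paired intervals have the same length and are aligned to it, so they are exchanged by xor with
the sum of their bases. Membership in the pair is invariant under the exchange, so the same
condition sets and clears the control qubit. -/
theorem mImpl_flip (hT : T ≤ L) (j : Fin M) :
    MImpl L S (fun a b => ∃ x ∈ configs M F k, a = (alignedLabel hf (j + 1) x, false, false) ∧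
      ((bitFlip j x ∈ configs M F k ∧
        b = (alignedLabel hf (j + 1) (bitFlip j x), false, false)) ∨
      (bitFlip j x ∉ configs M F k ∧ b = a)))
      ((levelIdx M F k (j + 1)).card * (L + S + 6 + 6 * 2 ^ (T + 2))) := by
  classical
  set Λ := level hf (j + 1) with hΛ
  set p : ℕ × ℕ → ℕ → Bool → Bool → Bool := fun g Y _ _ =>
    decide (Λ.Mem (g.1, g.2, false) (Y * 2 ^ (L - T)) ∨
      Λ.Mem (g.1 + 1, g.2, true) (Y * 2 ^ (L - T))) with hp
  have hpx : ∀ g ∈ flipIdx M F k (j + 1), ∀ x ∈ configs M F k,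
      (p g (alignedLabel hf (j + 1) x / 2 ^ (L - T)) false false = true ↔
        InPair g (key (j + 1) x)) := by
    intro g hg x hx
    have h := mem_flipIdx.1 hg
    simp only [hp, decide_eq_true_iff]
    rw [Layout.mem_top (Λ := Λ) h.1, Layout.mem_top (Λ := Λ) h.2,
      alignedLabel_mem_iff hf j.2 hx h.1, alignedLabel_mem_iff hf j.2 hx h.2]
    rfl
  have huniq : ∀ g g' h, InPair g h → InPair g' h → g = g' := by
    rintro ⟨m, f⟩ ⟨m', f'⟩ h (rfl | rfl) (h' | h') <;> simp at h' ⊢ <;> exact h'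
  refine (MImpl.list (flipIdx M F k (j + 1)).toList (Finset.nodup_toList _) fun g _ =>
    MImpl.block hT (ctrlImpl_xor (L := L) (S := S)
      (Λ.base (g.1, g.2, false) ^^^ Λ.base (g.1 + 1, g.2, true)) false false) (p g) (p g)).mono ?_ ?_
  · have hswap : ∀ x ∈ configs M F k, x j = false → bitFlip j x ∈ configs M F k →
        (weight x, suffixWeight (j + 1) x) ∈ flipIdx M F k (j + 1) ∧
        InPair (weight x, suffixWeight (j + 1) x) (key (j + 1) x) ∧
        InPair (weight x, suffixWeight (j + 1) x) (key (j + 1) (bitFlip j x)) ∧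
        alignedLabel hf (j + 1) (bitFlip j x) = alignedLabel hf (j + 1) x ^^^
          (Λ.base (weight x, suffixWeight (j + 1) x, false) ^^^
            Λ.base (weight x + 1, suffixWeight (j + 1) x, true)) := by
      intro x hx hxj hx'
      have h1 := bitFlip_labels j hxj
      have h2 := key_succ j x
      rw [hxj] at h2
      have m1 : key (j + 1) x ∈ levelIdx M F k (j + 1) := key_mem j.2 hx
      have m2 : key (j + 1) (bitFlip j x) ∈ levelIdx M F k (j + 1) := key_mem j.2 hx'
      have l1 : labelOffset (j + 1) x < _ := labelOffset_lt' (j := j + 1) j.2 x (L - T)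
      rw [h2] at m1 l1
      rw [h1.1] at m2
      refine ⟨mem_flipIdx.2 ⟨m1, m2⟩, Or.inl h2, Or.inr h1.1, ?_⟩
      obtain ⟨β, hβ⟩ := Λ.dvd_base _ m1
      obtain ⟨γ, hγ⟩ := Λ.dvd_base _ m2
      have hw : Λ.width (weight x + 1, suffixWeight (j + 1) x, true) =
        Λ.width (weight x, suffixWeight (j + 1) x, false) := levelWidth_flip _ _ _ _
      rw [alignedLabel, alignedLabel, h1.1, h1.2, h2, ← hΛ, hγ, hβ, hw, ← Nat.xor_assoc]
      rw [hΛ, level_width, xor_base l1, add_eq_xor l1]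
    have hcase : ∀ x ∈ configs M F k, bitFlip j x ∈ configs M F k →
        ∃ g ∈ flipIdx M F k (j + 1), InPair g (key (j + 1) x) ∧
        InPair g (key (j + 1) (bitFlip j x)) ∧
        alignedLabel hf (j + 1) (bitFlip j x) = alignedLabel hf (j + 1) x ^^^
          (Λ.base (g.1, g.2, false) ^^^ Λ.base (g.1 + 1, g.2, true)) := by
      intro x hx hx'
      cases hxj : x j
      · exact ⟨_, hswap x hx hxj hx'⟩
      · obtain ⟨h1, h2, h3, h4⟩ := hswap (bitFlip j x) hx'
          (by rw [bitFlip_self, hxj]; rfl) (by rwa [bitFlip_bitFlip])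
        rw [bitFlip_bitFlip] at h3 h4
        refine ⟨_, h1, h3, h2, ?_⟩
        rw [h4, Nat.xor_assoc, Nat.xor_self, Nat.xor_zero]
    rintro a b ha hb ⟨x, hx, rfl, ⟨hx', rfl⟩ | ⟨hx', rfl⟩⟩
    · obtain ⟨g, hg, p1, p2, he⟩ := hcase x hx hx'
      refine Or.inr ⟨g, Finset.mem_toList.2 hg, Or.inl ⟨(hpx g hg x hx).2 p1,
        (hpx g hg _ hx').2 p2, by simp [he]⟩, fun g' hg' hne => ?_⟩
      rw [Finset.mem_toList] at hg'
      have n1 : ¬ InPair g' (key (j + 1) x) := fun h => hne (huniq _ _ _ h p1)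
      have n2 : ¬ InPair g' (key (j + 1) (bitFlip j x)) := fun h => hne (huniq _ _ _ h p2)
      rw [← hpx g' hg' _ hx] at n1
      rw [← hpx g' hg' _ hx'] at n2
      simp only [Bool.not_eq_true] at n1 n2
      exact ⟨Or.inr ⟨n1, n1, rfl⟩, Or.inr ⟨n2, n2, rfl⟩⟩
    -- If the key belonged to a pair, the partner key would have a weight within the capacity, and
    -- so would the flipped string. Hence no block acts.
    · refine Or.inl ⟨rfl, fun g hg => ?_⟩
      rw [Finset.mem_toList] at hg
      have n1 : ¬ InPair g (key (j + 1) x) := by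
        intro h
        apply hx'
        obtain ⟨h1, h2⟩ := mem_flipIdx.1 hg
        rw [mem_levelIdx] at h1 h2
        simp only at h1 h2
        rw [mem_configs]
        rw [InPair, key_succ] at h
        simp only [Prod.mk.injEq] at h
        cases hxj : x j
        · have h3 := (bitFlip_labels j hxj).1
          have h4 : weight (bitFlip j x) = weight x + 1 := congrArg Prod.fst h3
          rw [h4]
          simp only [hxj] at h
          rcases h with h | h
          · omega
          · simp at h
        · have h3 := (bitFlip_labels j (x := bitFlip j x) (by rw [bitFlip_self, hxj]; rfl)).1
          rw [bitFlip_bitFlip] at h3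
          have h4 : weight x = weight (bitFlip j x) + 1 := congrArg Prod.fst h3
          simp only [hxj] at h
          rcases h with h | h
          · simp at h
          · omega
      rw [← hpx g hg _ hx] at n1
      simp only [Bool.not_eq_true] at n1
      exact Or.inr ⟨n1, n1, rfl⟩
  · rw [Finset.length_toList]
    exact Nat.mul_le_mul_right _ (card_flipIdx_le _)

/-- At level j + 1 the bit is the last component of the key, hence a function of the interval. -/
theorem exists_phase_circuit (hT : T ≤ L) (j : Fin M) :
    ∃ c : Circuit (L + S + 6), c.length ≤ 6 * 2 ^ (T + 2) + 1 ∧ ∀ x ∈ configs M F k,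
      c.run (ket (bits (L + S + 6) (alignedLabel hf (j + 1) x))) = (-1 : ℂ) ^ (x j).toNat •
        (ket (bits (L + S + 6) (alignedLabel hf (j + 1) x)) : QubitSpace (L + S + 6)) := by
  classical
  obtain ⟨c, hc, h⟩ := exists_sign_circuit (S := S) hT fun Y _ _ =>
    decide (∃ h ∈ levelIdx M F k (j + 1),
      (level hf (j + 1)).Mem h (Y * 2 ^ (L - T)) ∧ h.2.2 = true)
  refine ⟨c, hc, fun x hx => ?_⟩
  have hlt : alignedLabel hf (j + 1) x < 2 ^ L := (alignedLabel_lt hf (j := j + 1) j.2 hx).trans_le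
    (Nat.pow_le_pow_right (by norm_num) (Nat.sub_le _ _))
  have hx' := h (alignedLabel hf (j + 1) x, false, false) hlt
  rw [cfgState_eq_bits hlt] at hx'
  rw [hx']
  congr 3
  rw [Bool.eq_iff_iff, decide_eq_true_iff]
  constructor
  · rintro ⟨h, hh, hm, he⟩
    rw [Layout.mem_top (Λ := level hf (j + 1)) hh,
      alignedLabel_mem_iff hf (j := j + 1) j.2 hx hh, key_succ] at hm
    rw [← hm] at he
    exact he
  · intro hxj
    have m1 : key (j + 1) x ∈ levelIdx M F k (j + 1) := key_mem j.2 hx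
    refine ⟨key (j + 1) x, m1, ?_, by rw [key_succ]; exact hxj⟩
    rw [Layout.mem_top (Λ := level hf (j + 1)) m1]
    exact alignedLabel_mem hf (j := j + 1) j.2 x

theorem flipIsBlockSwap_alignedLabel (j : Fin M) :
    FlipIsBlockSwap M F k j (alignedLabel hf (j + 1)) := by
  intro m f hm hm'
  set Λ := level hf (j + 1) with hΛ
  by_cases hg : (m, f) ∈ flipIdx M F k (j + 1)
  · obtain ⟨h1, h2⟩ := mem_flipIdx.1 hg
    have hw : Λ.width (m + 1, f, true) = Λ.width (m, f, false) := levelWidth_flip _ _ _ _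
    refine ⟨Λ.base (m, f, false), Λ.base (m + 1, f, true), 2 ^ Λ.width (m, f, false),
      level_base_lt hf (j + 1) h1 (Or.inl (Nat.lt_succ_self m)), fun x hx => ?_⟩
    have i1 := alignedLabel_mem_iff hf (j := j + 1) j.2 hx h1
    have i2 := alignedLabel_mem_iff hf (j := j + 1) j.2 hx h2
    have i1' : alignedLabel hf (j + 1) x ∈ Set.Ico (Λ.base (m, f, false))
        (Λ.base (m, f, false) + 2 ^ Λ.width (m, f, false)) ↔ key (j + 1) x = (m, f, false) := i1
    have i2' : alignedLabel hf (j + 1) x ∈ Set.Ico (Λ.base (m + 1, f, true))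
        (Λ.base (m + 1, f, true) + 2 ^ Λ.width (m, f, false)) ↔
        key (j + 1) x = (m + 1, f, true) := by rw [← hw]; exact i2
    rw [i1', i2', key_succ]
    simp only [Prod.mk.injEq, true_and]
    rintro ⟨rfl, rfl, hxj⟩
    have h3 := bitFlip_labels j hxj
    have h4 := key_succ j x
    rw [hxj] at h4
    rw [alignedLabel, alignedLabel, h3.1, h3.2, h4, ← hΛ]
    omega
  -- The two keys have equal counts and both weights are within the capacity, so if the pair is
  -- missing then neither key occurs, and empty intervals will do.
  · refine ⟨0, 0, 0, le_rfl, fun x hx => ?_⟩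
    have hk : key (j + 1) x ∈ levelIdx M F k (j + 1) := key_mem j.2 hx
    have hcount : keyCount M (j + 1) (m + 1, f, true) = keyCount M (j + 1) (m, f, false) := by
      simp only [keyCount, Bool.toNat_true, Bool.toNat_false]
      rw [show m + 1 - f - 1 = m - f - 0 by omega]
    rw [mem_flipIdx, mem_levelIdx, mem_levelIdx, hcount] at hg
    rw [key_succ, mem_levelIdx] at hk
    simp only [add_zero, Set.Ico_self, Set.mem_empty_iff_false, iff_false, false_implies,
      and_true]
    simp only [Bool.toNat_true, Bool.toNat_false] at hg
    constructor
    · rintro ⟨rfl, rfl, hxj⟩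
      rw [hxj] at hk
      simp only [Bool.toNat_false] at hk
      exact hg ⟨⟨by omega, by omega, by omega, by omega, hk.2.2.2.2⟩,
        by omega, by omega, by omega, by omega, hk.2.2.2.2⟩
    · rintro ⟨h1, rfl, hxj⟩
      rw [hxj, h1, hcount] at hk
      simp only [Bool.toNat_true] at hk
      exact hg ⟨⟨by omega, by omega, by omega, by omega, hk.2.2.2.2⟩,
        by omega, by omega, by omega, by omega, hk.2.2.2.2⟩

theorem phaseIsCompare_alignedLabel (j : Fin M) :
    PhaseIsCompare M F k j (alignedLabel hf (j + 1)) := by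
  intro m f
  by_cases hg : (m, f, true) ∈ levelIdx M F k (j + 1)
  · refine ⟨(level hf (j + 1)).base (m, f, true), 2 ^ (level hf (j + 1)).width (m, f, true),
      fun x hx => ?_⟩
    have i1 : alignedLabel hf (j + 1) x ∈ Set.Ico _ _ ↔ _ :=
      alignedLabel_mem_iff hf (j := j + 1) j.2 hx hg
    rw [i1, key_succ]
    simp only [Prod.mk.injEq]
  · refine ⟨0, 0, fun x hx => ?_⟩
    have hk : key (j + 1) x ∈ levelIdx M F k (j + 1) := key_mem j.2 hx
    rw [key_succ] at hk
    simp only [add_zero, Set.Ico_self, Set.mem_empty_iff_false, iff_false]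
    rintro ⟨rfl, rfl, hxj⟩
    rw [hxj] at hk
    exact hg hk

end Reorder

/-! ### From dense ranks to aligned labels -/

section Alignment

variable {M F k L S T : ℕ}

/-- Comparison of a label with a constant. -/
theorem mImpl_compare {D : ℕ} (hT0 : 0 < T) (hT : T ≤ L) (hS : 0 < S) (hD : L = S * D) {a : ℕ}
    (ha : a ≤ 2 ^ (L - 1)) :
    MImpl L S (fun x y => ∃ v < 2 ^ (L - 1), x = (v, false, false) ∧
      y = (v, decide (a ≤ v), false))
      (2 * (D * (S * (6 * 2 ^ (T + 2)) + 260 * L + 210)) + (L + S + 6 + 6 * 2 ^ (T + 2))) := by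
  -- Labels occupy only the lower half of the range, so the translated label has its top bit set
  -- exactly when a ≤ v. The bit is copied to the flag and the translation is undone.
  have h1 := mImpl_add hT hS hD (fun _ _ _ => 2 ^ (L - 1) - a)
  have h2 := MImpl.block hT (ctrlImpl_xor (L := L) (S := S) 0 true false)
    (fun Y _ _ => decide (2 ^ (T - 1) ≤ Y)) (fun Y _ _ => decide (2 ^ (T - 1) ≤ Y))
  refine (h1.comp (h2.comp h1.inv)).mono ?_ (by omega)
  rintro x y hx hy ⟨v, hv, rfl, rfl⟩
  have hp : 2 ^ L = 2 ^ (L - 1) + 2 ^ (L - 1) := by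
    rw [← two_mul, ← pow_succ', Nat.sub_add_cancel (by omega)]
  have hlt : v + (2 ^ (L - 1) - a) < 2 ^ L := by omega
  refine ⟨(v + (2 ^ (L - 1) - a), false, false), hlt, ⟨fun _ _ => rfl, rfl⟩,
    (v + (2 ^ (L - 1) - a), decide (a ≤ v), false), hlt, ?_, fun _ _ => rfl, rfl⟩
  have hiff : 2 ^ (T - 1) ≤ (v + (2 ^ (L - 1) - a)) / 2 ^ (L - T) ↔ a ≤ v := by
    rw [Nat.le_div_iff_mul_le (by positivity), ← pow_add, show T - 1 + (L - T) = L - 1 by omega]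
    omega
  by_cases h : a ≤ v
  · exact Or.inl ⟨decide_eq_true (hiff.2 h), decide_eq_true (hiff.2 h), by simp [h]⟩
  · exact Or.inr ⟨decide_eq_false (fun h' => h (hiff.1 h')),
      decide_eq_false (fun h' => h (hiff.1 h')), by simp [h]⟩

/-- Adds a constant to the labels above a threshold. -/
theorem mImpl_threshold {D : ℕ} (hT0 : 0 < T) (hT : T ≤ L) (hS : 0 < S) (hD : L = S * D)
    {a δ : ℕ} (ha : a + δ ≤ 2 ^ (L - 1)) :
    MImpl L S (fun x y => ∃ v, v + δ < 2 ^ (L - 1) ∧ x = (v, false, false) ∧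
      y = (if a ≤ v then v + δ else v, false, false))
      (5 * (D * (S * (6 * 2 ^ (T + 2)) + 260 * L + 210)) +
        2 * (L + S + 6 + 6 * 2 ^ (T + 2))) := by
  have h1 := mImpl_compare hT0 hT hS hD (a := a) (by omega)
  have h2 := mImpl_add hT hS hD (fun _ e _ => if e then δ else 0)
  -- The results reach a + δ exactly when the arguments reach a, so comparison with the shifted
  -- threshold clears the flag.
  have h3 := (mImpl_compare hT0 hT hS hD ha).inv
  refine (h1.comp (h2.comp h3)).mono ?_ (by omega)
  rintro x y hx hy ⟨v, hv, rfl, rfl⟩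
  have hp : 2 ^ (L - 1) ≤ 2 ^ L := Nat.pow_le_pow_right (by norm_num) (Nat.sub_le _ _)
  by_cases h : a ≤ v
  · refine ⟨(v, true, false), by simp only; omega, ⟨v, by omega, rfl, by simp [h]⟩,
      (v + δ, true, false), by simp only; omega, ⟨fun _ _ => rfl, rfl⟩, v + δ, hv, ?_, ?_⟩
    · rw [if_pos h]
    · simp [h]
  · refine ⟨(v, false, false), by simp only; omega, ⟨v, by omega, rfl, by simp [h]⟩,
      (v, false, false), by simp only; omega, ⟨fun _ _ => rfl, rfl⟩, v, by omega, ?_, ?_⟩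
    · rw [if_neg h]
    · rw [decide_eq_false (by omega)]

/-- Adds to the labels in consecutive intervals an amount that grows from interval to interval. -/
theorem mImpl_shifts {D : ℕ} (hT0 : 0 < T) (hT : T ≤ L) (hS : 0 < S) (hD : L = S * D)
    (A G : ℕ → ℕ) (n : ℕ) (hG : ∀ i < n, G i ≤ G (i + 1)) (hA : ∀ i < n, A i ≤ A (i + 1))
    (hb : ∀ i ≤ n, A i + G i ≤ 2 ^ (L - 1)) :
    MImpl L S (fun x y => ∃ w v, A w ≤ v ∧ (∀ i < w, A (i + 1) ≤ v) ∧
      (∀ i, w ≤ i → i < n → v < A (i + 1)) ∧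
      v + G (max w n) < 2 ^ (L - 1) ∧ G n ≤ G (max w n) ∧ G 0 ≤ G w ∧
      x = (v + (G (max w n) - G n), false, false) ∧ y = (v + (G w - G 0), false, false))
      (n * (5 * (D * (S * (6 * 2 ^ (T + 2)) + 260 * L + 210)) +
        2 * (L + S + 6 + 6 * 2 ^ (T + 2)))) := by
  induction n with
  | zero =>
    refine MImpl.id.mono ?_ (by omega)
    rintro x y hx hy ⟨w, v, -, -, -, -, -, -, rfl, rfl⟩
    rw [Nat.max_zero]
  | succ n ih =>
    have h1 := mImpl_threshold hT0 hT hS hD (a := A (n + 1)) (δ := G (n + 1) - G n)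
      (by have := hb (n + 1) le_rfl; omega)
    have h2 := ih (fun i hi => hG i (by omega)) (fun i hi => hA i (by omega))
      (fun i hi => hb i (by omega))
    -- Thresholds are applied from the highest down: a label of interval w meets those above w
    -- unshifted and afterwards only ones that it has reached anyway, so its shifts telescope.
    refine (h1.comp h2).mono ?_ (le_of_eq (by ring))
    rintro x y hx hy ⟨w, v, hv, hv1, hv2, hlt, hn, h0, rfl, rfl⟩
    have hg := hG n (by omega)
    have hp : 2 ^ (L - 1) ≤ 2 ^ L := Nat.pow_le_pow_right (by norm_num) (Nat.sub_le _ _)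
    by_cases hw : w ≤ n
    · rw [Nat.max_eq_right (show w ≤ n + 1 by omega)] at hlt hn ⊢
      have := hv2 n hw (by omega)
      refine ⟨(v, false, false), by simp only; omega, ⟨v, by omega, by simp, ?_⟩, w, v, hv,
        hv1, fun i hi hi' => hv2 i hi (by omega), ?_, ?_, h0, ?_, rfl⟩
      · rw [if_neg (by omega)]
      · rw [Nat.max_eq_right hw]; omega
      · rw [Nat.max_eq_right hw]
      · rw [Nat.max_eq_right hw]; simp
    · rw [Nat.max_eq_left (show n + 1 ≤ w by omega)] at hlt hn ⊢
      have := hv1 n (by omega)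
      refine ⟨(v + (G w - G n), false, false), by simp only; omega,
        ⟨v + (G w - G (n + 1)), by omega, rfl, ?_⟩, w, v, hv,
        hv1, fun i hi hi' => hv2 i hi (by omega), ?_, ?_, h0, ?_, rfl⟩
      · rw [if_pos (by omega)]
        simp only [Prod.mk.injEq, and_true]; omega
      · rw [Nat.max_eq_left (by omega)]; exact hlt
      · rw [Nat.max_eq_left (by omega)]; omega
      · rw [Nat.max_eq_left (by omega)]

variable (hf : LevelsFit M F k L T)

theorem key_zero (x : BitString M) : key 0 x = (weight x, weight x, false) := by
  simp [key, pre, ← weight_eq_suffixWeight]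

theorem alignedLabel_zero (x : BitString M) :
    alignedLabel hf 0 x = (level hf 0).base (weight x, weight x, false) + suffixRank 0 x := by
  simp [alignedLabel, labelOffset, key_zero, prefixRank, pre, listRank]

theorem key_zero_mem {m : ℕ} (h1 : F ≤ m + k) (h2 : m ≤ F + k) (h3 : m ≤ M) :
    (m, m, false) ∈ levelIdx M F k 0 := by
  rw [mem_levelIdx]
  refine ⟨h2, h1, by simp, Nat.zero_le _, ?_⟩
  simp only [keyCount, Bool.toNat_false, Nat.sub_self, Nat.sub_zero, Nat.choose_zero_right, one_mul]
  exact Nat.choose_pos h3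

/-- Aligned bases are at least as far apart as dense ones, so the shift from rank to label grows
with the weight, as `mImpl_shifts` requires. -/
theorem base_zero_step {m : ℕ} (h1 : F ≤ m + k) (h2 : m ≤ F + k) (h3 : m ≤ M) :
    (level hf 0).base (m, m, false) + M.choose m ≤
      (level hf 0).base (m + 1, m + 1, false) := by
  refine le_trans (Nat.add_le_add_left ?_ _) (level_base_lt hf 0 (key_zero_mem h1 h2 h3)
    (Or.inl (Nat.lt_succ_self m)))
  refine (Nat.le_pow_clog (b := 2) (by norm_num) _).trans (Nat.pow_le_pow_right (by norm_num) ?_)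
  simp only [levelWidth, suffixBits, Nat.sub_zero]
  omega

theorem below_le_base {m : ℕ} (h1 : F ≤ m + k) (h2 : m ≤ F + k) (h3 : m ≤ M) :
    below M F k m ≤ (level hf 0).base (m, m, false) := by
  induction m with
  | zero => rw [below_eq_zero (by omega)]; exact Nat.zero_le _
  | succ m ih =>
    by_cases h : F ≤ m + k
    · have := ih h (by omega) (by omega)
      have h4 := base_zero_step hf h (by omega) (by omega)
      rw [below_succ h (by omega)]
      omega
    · rw [below_eq_zero (by omega)]; exact Nat.zero_le _

theorem weight_le (x : BitString M) : weight x ≤ M := by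
  have := Finset.card_filter_le (Finset.univ : Finset (Fin M)) (fun i => x i = true)
  simpa [weight] using this

theorem initialRank_le {x : BitString M} (hx : x ∈ configs M F k) :
    initialRank M F k x ≤ alignedLabel hf 0 x := by
  have h := mem_configs.1 hx
  rw [initialRank_eq hx, alignedLabel_zero]
  exact Nat.add_le_add_right (below_le_base hf h.1 h.2 (weight_le x)) _

/-- The circuit that turns ranks into aligned labels. -/
theorem mImpl_align {D : ℕ} (hT0 : 0 < T) (hT : T ≤ L) (hS : 0 < S) (hD : L = S * D)
    (hFM : F ≤ M) :
    MImpl L S (fun a b => ∃ x ∈ configs M F k, a = (initialRank M F k x, false, false) ∧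
      b = (alignedLabel hf 0 x, false, false))
      (2 * k * (5 * (D * (S * (6 * 2 ^ (T + 2)) + 260 * L + 210)) +
        2 * (L + S + 6 + 6 * 2 ^ (T + 2))) +
        D * (S * (6 * 2 ^ (T + 2)) + 260 * L + 210)) := by
  set m₀ := F - k with hm₀
  -- One threshold for each weight above the least one, at most 2k of them; the truncation of F - k
  -- at 0 only lowers the number.
  set n := min (F + k) M - m₀ with hn
  set B : ℕ → ℕ := fun m => (level hf 0).base (m, m, false) with hB
  have hle : ∀ i ≤ n, below M F k (m₀ + i) ≤ B (m₀ + i) := fun i hi =>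
    below_le_base hf (by omega) (by omega) (by omega)
  have hG : ∀ i < n, B (m₀ + i) - below M F k (m₀ + i) ≤
      B (m₀ + (i + 1)) - below M F k (m₀ + (i + 1)) := by
    intro i hi
    have e1 := base_zero_step hf (m := m₀ + i) (by omega) (by omega) (by omega)
    have e2 := below_succ (M := M) (F := F) (k := k) (m := m₀ + i) (by omega) (by omega)
    have e3 : B (m₀ + i) + M.choose (m₀ + i) ≤ B (m₀ + (i + 1)) := e1
    rw [← add_assoc]
    rw [← add_assoc] at e3
    omega
  have h1 := mImpl_shifts hT0 hT hS hD (fun i => below M F k (m₀ + i))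
    (fun i => B (m₀ + i) - below M F k (m₀ + i)) n hG (fun i _ => below_mono (by omega))
    (fun i hi => by
      have e1 := hle i hi
      have e2 := (Nat.le_add_right _ _).trans <| level_base_add_le hf 0 (key_zero_mem (M := M) (F := F) (k := k)
        (m := m₀ + i) (by omega) (by omega) (by omega))
      have e3 : B (m₀ + i) = (level hf 0).base (m₀ + i, m₀ + i, false) := rfl
      omega)
  -- The shifts are relative to the least weight, whose own base is added to all labels at the end.
  have h2 := mImpl_add hT hS hD (fun _ _ _ => B m₀)
  refine (h1.comp h2).mono ?_ (Nat.add_le_add_right (Nat.mul_le_mul_right _ (by omega)) _)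
  rintro a b ha hb ⟨x, hx, rfl, rfl⟩
  have hc := mem_configs.1 hx
  have hM := weight_le x
  obtain ⟨w, hw⟩ : ∃ w, weight x = m₀ + w := ⟨weight x - m₀, by omega⟩
  have hwn : w ≤ n := by omega
  have e1 := initialRank_eq hx
  have e2 := alignedLabel_zero hf x
  have e3 := alignedLabel_lt hf (Nat.zero_le M) hx
  have e4 := suffixRank_zero_lt x
  have e5 : alignedLabel hf 0 x = B (m₀ + w) + suffixRank 0 x := by rw [e2, hw]
  have e6 := hle w hwn
  have e8 : below M F k m₀ = 0 := below_eq_zero le_rfl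
  rw [hw] at e1 e4 hM
  have hmono : ∀ i ≤ n, B m₀ - below M F k m₀ ≤ B (m₀ + i) - below M F k (m₀ + i) := by
    intro i hi
    induction i with
    | zero => exact le_rfl
    | succ i ih => exact (ih (by omega)).trans (hG i (by omega))
  have e9 := hmono w hwn
  rw [e8, Nat.sub_zero] at e9
  have hp : 2 ^ (L - 1) ≤ 2 ^ L := Nat.pow_le_pow_right (by norm_num) (Nat.sub_le _ _)
  refine ⟨(initialRank M F k x + ((B (m₀ + w) - below M F k (m₀ + w)) - B m₀), false, false), ?_,
    ⟨w, initialRank M F k x, ?_, ?_, ?_, ?_, ?_, ?_, ?_, ?_⟩, fun _ _ => rfl, ?_⟩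
  · simp only; omega
  · omega
  · intro i hi
    have := below_mono (M := M) (F := F) (k := k) (show m₀ + (i + 1) ≤ m₀ + w by omega)
    omega
  · intro i hi hi'
    have := below_mono (M := M) (F := F) (k := k) (show m₀ + w + 1 ≤ m₀ + (i + 1) by omega)
    have h3 := below_succ (M := M) (F := F) (k := k) (m := m₀ + w) (by omega) (by omega)
    omega
  · rw [Nat.max_eq_right hwn]
    by_cases hlt : w = n
    · rw [← hlt]; omega
    · have h3 := below_mono (M := M) (F := F) (k := k) (show m₀ + w + 1 ≤ m₀ + n by omega)
      have h4 := below_succ (M := M) (F := F) (k := k) (m := m₀ + w) (by omega) (by omega)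
      have h5 := (Nat.le_add_right _ _).trans <| level_base_add_le hf 0 (key_zero_mem (M := M) (F := F) (k := k)
        (m := m₀ + n) (by omega) (by omega) (by omega))
      have h6 : B (m₀ + n) = (level hf 0).base (m₀ + n, m₀ + n, false) := rfl
      have h7 := hle n le_rfl
      omega
  · rw [Nat.max_eq_right hwn]
  · simp only [add_zero, e8, Nat.sub_zero]; exact e9
  · rw [Nat.max_eq_right hwn]; simp
  · simp only [add_zero, e8, Nat.sub_zero]
  · simp only [Prod.mk.injEq, and_true]; omega

end Alignment

/-! ### Assembling the data structure -/

section Assembly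

variable {M F k n : ℕ}

theorem bits_injOn {v w : ℕ} (hv : v < 2 ^ n) (hw : w < 2 ^ n) (h : bits n v = bits n w) :
    v = w := by
  refine Nat.eq_of_testBit_eq fun i => ?_
  by_cases hi : i < n
  · exact congrFun h ⟨i, hi⟩
  · have hp : 2 ^ n ≤ 2 ^ i := Nat.pow_le_pow_right (by norm_num) (by omega)
    rw [Nat.testBit_eq_false_of_lt (hv.trans_le hp), Nat.testBit_eq_false_of_lt (hw.trans_le hp)]

/-- The encoding that stores configurations under given labels. -/
def labelEncoding (M F k n : ℕ) (l : BitString M → ℕ) : FockSpace M F k →ₗ[ℂ] QubitSpace n :=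
  (EuclideanSpace.basisFun {b : BitString M // b ∈ configs M F k} ℂ).toBasis.constr ℂ
    fun b => ket (bits n (l b))

theorem labelEncoding_fockState (l : BitString M → ℕ) (b : BitString M)
    (hb : b ∈ configs M F k) :
    labelEncoding M F k n l (fockState b hb) = ket (bits n (l b)) := by
  have h : fockState b hb =
      (EuclideanSpace.basisFun {b : BitString M // b ∈ configs M F k} ℂ).toBasis ⟨b, hb⟩ := by
    rw [OrthonormalBasis.coe_toBasis, EuclideanSpace.basisFun_apply, fockState]
  rw [h, labelEncoding, Module.Basis.constr_basis]

theorem labelEncoding_injective (l : BitString M → ℕ)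
    (hlt : ∀ x ∈ configs M F k, l x < 2 ^ n)
    (hl : ∀ x ∈ configs M F k, ∀ y ∈ configs M F k, l x = l y → x = y) :
    Function.Injective (labelEncoding M F k n l) := by
  refine Module.Basis.injective_constr_of_linearIndependent _ ?_
  have h := (EuclideanSpace.orthonormal_single (𝕜 := ℂ) (ι := BitString n)).linearIndependent
  refine h.comp (fun b : {b : BitString M // b ∈ configs M F k} => bits n (l b)) ?_
  rintro ⟨x, hx⟩ ⟨y, hy⟩ hxy
  exact Subtype.ext (hl x hx y hy (bits_injOn (hlt x hx) (hlt y hy) hxy))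

theorem sends_ascend {P : ℕ → Circuit n} {l : ℕ → BitString M → ℕ} {x : BitString M}
    (hP : ∀ j < M, Sends (P j) (bits n (l j x)) (bits n (l (j + 1) x))) :
    ∀ j ≤ M, Sends (ascend P j) (bits n (l 0 x)) (bits n (l j x))
  | 0, _ => Sends.nil _
  | j + 1, hj => (sends_ascend hP j (by omega)).append (hP j hj)

theorem run_ascendWith {P Z : ℕ → Circuit n} {l : ℕ → BitString M → ℕ} {x : BitString M}
    (hP : ∀ j < M, Sends (P j) (bits n (l j x)) (bits n (l (j + 1) x)))
    (hZ : ∀ j : Fin M, (Z (j + 1)).run (ket (bits n (l (j + 1) x))) =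
      (-1 : ℂ) ^ (x j).toNat • (ket (bits n (l (j + 1) x)) : QubitSpace n)) (j : ℕ) (hj : j ≤ M) :
    (ascendWith P Z j).run (ket (bits n (l 0 x))) =
      (∏ i ∈ Finset.univ.filter fun i : Fin M => (i : ℕ) < j, (-1 : ℂ) ^ (x i).toNat) •
        (ket (bits n (l j x)) : QubitSpace n) := by
  induction j with
  | zero => simp [ascendWith, run_nil]
  | succ j ih =>
    have hins : (Finset.univ.filter fun i : Fin M => (i : ℕ) < j + 1) =
        insert ⟨j, hj⟩ (Finset.univ.filter fun i : Fin M => (i : ℕ) < j) := by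
      ext i
      simp only [Finset.mem_filter, Finset.mem_univ, true_and, Finset.mem_insert, Fin.ext_iff]
      omega
    rw [ascendWith, run_append, run_append, ih (by omega), map_smul, map_smul, hP j hj,
      hZ ⟨j, hj⟩, smul_smul, hins, Finset.prod_insert (by simp), mul_comm]

theorem length_ascend {P : ℕ → Circuit n} {p : ℕ} (hP : ∀ j, (P j).length ≤ p) (j : ℕ) :
    (ascend P j).length ≤ j * p := by
  induction j with
  | zero => simp [ascend]
  | succ j ih =>
    rw [ascend, List.length_append, Nat.succ_mul]
    exact Nat.add_le_add ih (hP j)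

theorem length_ascendWith {P Z : ℕ → Circuit n} {p z : ℕ} (hP : ∀ j, (P j).length ≤ p)
    (hZ : ∀ j, (Z j).length ≤ z) (j : ℕ) :
    (ascendWith P Z j).length ≤ j * (p + z) := by
  induction j with
  | zero => simp [ascendWith]
  | succ j ih =>
    rw [ascendWith, List.length_append, List.length_append, Nat.succ_mul]
    have := hP j
    have := hZ (j + 1)
    omega

/-- Circuits that act in the required way on labels make up a data structure. -/
theorem exists_dataStructure_of_circuits (l : ℕ → BitString M → ℕ) (P X Z : ℕ → Circuit n)
    (hlt : ∀ j ≤ M, ∀ x ∈ configs M F k, l j x < 2 ^ n)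
    (hzero : ∀ x ∈ configs M F k, l 0 x = initialRank M F k x)
    (hlab : ∀ j ≤ M, IsLayerLabelling M F k j (l j))
    (hswap : ∀ j : Fin M, FlipIsBlockSwap M F k j (l (j + 1)))
    (hcomp : ∀ j : Fin M, PhaseIsCompare M F k j (l (j + 1)))
    (hP : ∀ j < M, ∀ x ∈ configs M F k, Sends (P j) (bits n (l j x)) (bits n (l (j + 1) x)))
    (hX : ∀ j : Fin M, ∀ x ∈ configs M F k, bitFlip j x ∈ configs M F k →
      Sends (X (j + 1)) (bits n (l (j + 1) x)) (bits n (l (j + 1) (bitFlip j x))))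
    (hX' : ∀ j : Fin M, ∀ x ∈ configs M F k, bitFlip j x ∉ configs M F k →
      Sends (X (j + 1)) (bits n (l (j + 1) x)) (bits n (l (j + 1) x)))
    (hZ : ∀ j : Fin M, ∀ x ∈ configs M F k, (Z (j + 1)).run (ket (bits n (l (j + 1) x))) =
      (-1 : ℂ) ^ (x j).toNat • (ket (bits n (l (j + 1) x)) : QubitSpace n))
    {p c z : ℕ} (hp : ∀ j, (P j).length ≤ p) (hc : ∀ j, (X j).length ≤ c)
    (hz : ∀ j, (Z j).length ≤ z) :
    ∃ D : FermionDataStructure M F k n, D.gateComplexity ≤ M * (2 * p + z) + c ∧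
      CyclesThroughOrderings D l P X Z := by
  have hinj : ∀ x ∈ configs M F k, ∀ y ∈ configs M F k, l 0 x = l 0 y → x = y := by
    intro x hx y hy h
    have h1 := (hlab 0 (Nat.zero_le _)).lt_iff x hx y hy
    have h2 := (hlab 0 (Nat.zero_le _)).lt_iff y hy x hx
    rw [layerLT_iff] at h1 h2
    have hp : pre 0 x = pre 0 y := by simp [pre]
    rw [hp] at h1 h2
    rcases lt_trichotomy (weight x) (weight y) with hw | hw | hw
    · have := h1.2 (Or.inl hw); omega
    · have hw' := hw
      rw [weight_eq_suffixWeight, weight_eq_suffixWeight] at hw'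
      rcases lt_trichotomy (suf 0 x) (suf 0 y) with hs | hs | hs
      · have := h1.2 (Or.inr (Or.inr ⟨hw, hw', Or.inr ⟨rfl, hs⟩⟩)); omega
      · exact ext_pre_suf hp hs
      · have := h2.2 (Or.inr (Or.inr ⟨hw.symm, hw'.symm, Or.inr ⟨rfl, hs⟩⟩)); omega
    · have := h2.2 (Or.inl hw); omega
  let D : FermionDataStructure M F k n :=
    { enc := labelEncoding M F k n (l 0)
      enc_injective := labelEncoding_injective _ (hlt 0 (Nat.zero_le _)) hinj
      enc_fockState := fun b hb => ⟨_, labelEncoding_fockState _ b hb⟩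
      flipCircuit := fun j => ascend P (j + 1) ++ X (j + 1) ++ Circuit.inv (ascend P (j + 1))
      rankCircuit := fun j => ascendWith P Z (j + 1) ++ Circuit.inv (ascend P (j + 1))
      flip_spec := by
        intro j b hb hb'
        rw [labelEncoding_fockState, labelEncoding_fockState]
        -- The descent after the flip is the reversed ascent of the flipped string.
        exact ((sends_ascend (fun i hi => hP i hi b hb) _ j.2).append (hX j b hb hb')).append
          (sends_ascend (fun i hi => hP i hi _ hb') _ j.2).inv
      rank_spec := by
        intro j b hb
        have h2 : (Circuit.inv (ascend P (j + 1))).run (ket (bits n (l (j + 1) b))) =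
          (ket (bits n (l 0 b)) : QubitSpace n) :=
          (sends_ascend (fun i hi => hP i hi b hb) (j + 1) j.2).inv
        rw [labelEncoding_fockState, run_append,
          run_ascendWith (fun i hi => hP i hi b hb) (fun i => hZ i b hb) (j + 1) j.2, map_smul, h2,
          sgnRank]
        congr 2
        ext i
        simp only [Finset.mem_filter, Finset.mem_univ, true_and, Finset.mem_Iic, Fin.le_def]
        omega }
  refine ⟨D, Finset.sup_le fun j _ => ?_, ?_⟩
  · have h1 := length_ascend hp (j + 1)
    have h2 := length_ascendWith hp hz (j + 1)
    have h3 := hc (j + 1)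
    have h4 : (j + 1) * p ≤ M * p := Nat.mul_le_mul_right _ j.2
    have h5 : (j + 1) * (p + z) ≤ M * (p + z) := Nat.mul_le_mul_right _ j.2
    have h6 : M * (2 * p + z) = M * p + M * (p + z) := by ring
    have h7 : M * (p + z) = M * p + M * z := by ring
    refine max_le ?_ ?_
    · simp only [D, List.length_append, length_inv]
      omega
    · simp only [D, List.length_append, length_inv]
      omega
  · exact
      { label_lt := hlt
        label_zero := hzero
        labelling := hlab
        enc_eq := fun b hb => labelEncoding_fockState _ b hb
        swap := hswap
        compare := hcomp
        reorder := hP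
        flip := hX
        flip_outside := hX'
        phase := hZ
        flipCircuit_eq := fun _ => rfl
        rankCircuit_eq := fun _ => rfl }

theorem MImpl.exists_sends {L S ℓ : ℕ} {R : Cfg → Cfg → Prop} (h : MImpl L S R ℓ) :
    ∃ c : Circuit (L + S + 6), c.length ≤ ℓ ∧ ∀ v w, v < 2 ^ L → w < 2 ^ L →
      R (v, false, false) (w, false, false) →
      Sends c (bits (L + S + 6) v) (bits (L + S + 6) w) := by
  obtain ⟨c, hc, h⟩ := h
  refine ⟨c, hc, fun v w hv hw hR => h _ _ ⟨_, _, hv, hw, hR, ?_, ?_⟩⟩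
  · rw [cfgState_eq_bits hv]
  · rw [cfgState_eq_bits hw]

/-- The data structure, provided that the intervals of labels fit. -/
theorem exists_dataStructure {L S T D c : ℕ} (hf : LevelsFit M F k L T) (hT0 : 0 < T)
    (hT : T ≤ L) (hS : 0 < S) (hD : L = S * D) (hFM : F ≤ M)
    (hc : ∀ j, (levelIdx M F k j).card ≤ c) :
    ∃ 𝒟 : FermionDataStructure M F k (L + S + 6),
      𝒟.gateComplexity ≤ M * (2 * ((10 * k + 5) * (D * (S * (6 * 2 ^ (T + 2)) + 260 * L + 210)) +
        (4 * k + 6 * c) * (15 * (L + S + 6) + 6 * 2 ^ (T + 2)) + 2) +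
        (15 * (L + S + 6) + 6 * 2 ^ (T + 2))) + c * (15 * (L + S + 6) + 6 * 2 ^ (T + 2)) ∧
      ∃ (l : ℕ → BitString M → ℕ) (P X Z : ℕ → Circuit (L + S + 6)),
        CyclesThroughOrderings 𝒟 l P X Z := by
  classical
  set n := L + S + 6 with hn
  set A := D * (S * (6 * 2 ^ (T + 2)) + 260 * L + 210) with hA
  set B := 15 * n + 6 * 2 ^ (T + 2) with hB
  set p := (10 * k + 5) * A + (4 * k + 6 * c) * B + 2 with hp
  set l : ℕ → BitString M → ℕ := fun j x => if j = 0 then initialRank M F k x else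
    alignedLabel hf j x with hl
  have hl0 : ∀ x, l 0 x = initialRank M F k x := fun x => if_pos rfl
  have hl1 : ∀ j x, l (j + 1) x = alignedLabel hf (j + 1) x := fun j x =>
    if_neg (Nat.succ_ne_zero j)
  have hL : ∀ j ≤ M, ∀ x ∈ configs M F k, alignedLabel hf j x < 2 ^ L := fun j hj x hx =>
    (alignedLabel_lt hf hj hx).trans_le (Nat.pow_le_pow_right (by norm_num) (Nat.sub_le _ _))
  have hL0 : ∀ x ∈ configs M F k, initialRank M F k x < 2 ^ L := fun x hx =>
    (initialRank_le hf hx).trans_lt (hL 0 (Nat.zero_le _) x hx)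
  have hreorder : ∀ j : Fin M, ∃ q : Circuit n, q.length ≤ 6 * (c * B) + 4 * A + 2 ∧
      ∀ x ∈ configs M F k, Sends q (bits n (alignedLabel hf j x))
        (bits n (alignedLabel hf (j + 1) x)) := by
    intro j
    obtain ⟨q, hq, h⟩ := (mImpl_reorder hf hT hS hD j (hc j) (hc (j + 1))).exists_sends
    exact ⟨q, hq, fun x hx => h _ _ (hL j j.2.le x hx) (hL _ j.2 x hx) ⟨x, hx, rfl, rfl⟩⟩
  obtain ⟨q₀, hq₀, h₀⟩ := (mImpl_align hf hT0 hT hS hD hFM).exists_sends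
  rw [← hA] at hq₀
  have hP : ∀ j, ∃ q : Circuit n, q.length ≤ p ∧ (j < M → ∀ x ∈ configs M F k,
      Sends q (bits n (l j x)) (bits n (l (j + 1) x))) := by
    intro j
    by_cases hj : j < M
    · obtain ⟨q, hq, h⟩ := hreorder ⟨j, hj⟩
      cases j with
      | zero =>
        -- The first reordering also turns dense ranks into aligned labels, so aligned labels are
        -- used from level 1 on.
        refine ⟨q₀ ++ q, ?_, fun _ x hx => ?_⟩
        · rw [List.length_append]
          refine (Nat.add_le_add hq₀ hq).trans ?_
          have e1 : L + S + 6 + 6 * 2 ^ (T + 2) ≤ B := by rw [hB, hn]; omega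
          have e2 : 2 * k * (5 * A + 2 * (L + S + 6 + 6 * 2 ^ (T + 2))) ≤
            2 * k * (5 * A + 2 * B) := by gcongr
          have e3 : p = 2 * k * (5 * A + 2 * B) + A + (6 * (c * B) + 4 * A + 2) := by
            rw [hp]; ring
          omega
        · rw [hl0, hl1]
          exact (h₀ _ _ (hL0 x hx) (hL 0 (Nat.zero_le _) x hx) ⟨x, hx, rfl, rfl⟩).append (h x hx)
      | succ j =>
        refine ⟨q, hq.trans ?_, fun _ x hx => ?_⟩
        · have e3 : p = 2 * k * (5 * A + 2 * B) + A + (6 * (c * B) + 4 * A + 2) := by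
            rw [hp]; ring
          omega
        · rw [hl1, hl1]; exact h x hx
    · exact ⟨[], by simp, fun h => absurd h hj⟩
  have hX : ∀ i : ℕ, ∃ q : Circuit n, q.length ≤ c * B ∧ ∀ j : Fin M, i = (j : ℕ) + 1 →
      ∀ x ∈ configs M F k,
      (bitFlip j x ∈ configs M F k → Sends q (bits n (l i x)) (bits n (l i (bitFlip j x)))) ∧
      (bitFlip j x ∉ configs M F k → Sends q (bits n (l i x)) (bits n (l i x))) := by
    intro i
    by_cases hi : ∃ j : Fin M, i = (j : ℕ) + 1
    · obtain ⟨j, rfl⟩ := hi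
      obtain ⟨q, hq, h⟩ := (mImpl_flip (S := S) hf hT j).exists_sends
      refine ⟨q, hq.trans (Nat.mul_le_mul (hc _) (by omega)), fun j' hj' x hx => ?_⟩
      have : j' = j := Fin.ext (by omega)
      subst this
      simp only [hl1]
      exact ⟨fun hx' => h _ _ (hL _ j'.2 x hx) (hL _ j'.2 _ hx')
          ⟨x, hx, rfl, Or.inl ⟨hx', rfl⟩⟩,
        fun hx' => h _ _ (hL _ j'.2 x hx) (hL _ j'.2 x hx) ⟨x, hx, rfl, Or.inr ⟨hx', rfl⟩⟩⟩
    · exact ⟨[], by simp, fun j hj => absurd ⟨j, hj⟩ hi⟩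
  have hZ : ∀ i : ℕ, ∃ q : Circuit n, q.length ≤ B ∧ ∀ j : Fin M, i = (j : ℕ) + 1 →
      ∀ x ∈ configs M F k, q.run (ket (bits n (l i x))) =
        (-1 : ℂ) ^ (x j).toNat • (ket (bits n (l i x)) : QubitSpace n) := by
    intro i
    by_cases hi : ∃ j : Fin M, i = (j : ℕ) + 1
    · obtain ⟨j, rfl⟩ := hi
      obtain ⟨q, hq, h⟩ := exists_phase_circuit (S := S) hf hT j
      refine ⟨q, hq.trans (by omega), fun j' hj' x hx => ?_⟩
      have : j' = j := Fin.ext (by omega)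
      subst this
      simp only [hl1]
      exact h x hx
    · exact ⟨[], by simp, fun j hj => absurd ⟨j, hj⟩ hi⟩
  choose P hP1 hP2 using hP
  choose X hX1 hX2 using hX
  choose Z hZ1 hZ2 using hZ
  have hLn : 2 ^ L ≤ 2 ^ n := Nat.pow_le_pow_right (by norm_num) (by omega)
  obtain ⟨𝒟, h1, h2⟩ := exists_dataStructure_of_circuits (F := F) (k := k) l P X Z
    (by
      intro j hj x hx
      cases j with
      | zero => rw [hl0]; exact (hL0 x hx).trans_le hLn
      | succ j => rw [hl1]; exact (hL _ hj x hx).trans_le hLn)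
    (fun x _ => hl0 x)
    (by
      intro j hj
      cases j with
      | zero => exact isLayerLabelling_initialRank
      | succ j => exact isLayerLabelling_alignedLabel hf hj)
    (fun j => flipIsBlockSwap_alignedLabel hf j)
    (fun j => phaseIsCompare_alignedLabel hf j)
    (fun j hj x hx => hP2 j hj x hx)
    (fun j x hx hx' => (hX2 _ j rfl x hx).1 hx')
    (fun j x hx hx' => (hX2 _ j rfl x hx).2 hx')
    (fun j x hx => hZ2 _ j rfl x hx) hP1 hX1 hZ1
  exact ⟨𝒟, h1, l, P, X, Z, h2⟩

end Assembly

/-! ### Counting keys and bounding binomial coefficients -/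

section Parameters

/-- A partial Vandermonde sum; the condition f ≤ m removes the terms in which the subtraction would
truncate. -/
theorem sum_choose_mul_choose_le (a b m R : ℕ) :
    ∑ f ∈ Finset.range R, (if f ≤ m then a.choose (m - f) * b.choose f else 0) ≤
      (a + b).choose m := by
  rw [add_comm a b, Nat.add_choose_eq, Finset.Nat.sum_antidiagonal_eq_sum_range_succ
    (fun i j => b.choose i * a.choose j), ← Finset.sum_filter]
  refine (Finset.sum_le_sum_of_subset (t := Finset.range m.succ) ?_).trans ?_
  · intro f hf
    rw [Finset.mem_filter] at hf
    exact Finset.mem_range.2 (Nat.lt_succ_of_le hf.2)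
  · exact Finset.sum_le_sum fun f _ => (mul_comm _ _).le

variable {M F k : ℕ}

theorem levelIdx_subset (j : ℕ) : levelIdx M F k j ⊆
    Finset.Icc (F - k) (F + k) ×ˢ Finset.range (F + k + 1) ×ˢ Finset.univ := by
  intro h hh
  rw [mem_levelIdx] at hh
  simp only [Finset.mem_product, Finset.mem_Icc, Finset.mem_range, Finset.mem_univ, and_true]
  omega

theorem card_levelIdx_le (j : ℕ) :
    (levelIdx M F k j).card ≤ (2 * k + 1) * ((F + k + 1) * 2) := by
  refine (Finset.card_le_card (levelIdx_subset j)).trans ?_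
  rw [Finset.card_product, Finset.card_product, Nat.card_Icc, Finset.card_range]
  simp only [Finset.card_univ, Fintype.card_bool]
  exact Nat.mul_le_mul_right _ (by omega)

/-- For fixed m and e, the remaining m - e ones lie in at most M places, so Vandermonde gives at
most M choose (m - e). The case e = 1, m = F - k is why the bound is needed down to weight F - k -
1. -/
theorem sum_keyCount_le {B : ℕ} (hB : ∀ m, F ≤ m + k + 1 → m ≤ F + k → M.choose m ≤ B) (j : ℕ) :
    ∑ h ∈ levelIdx M F k j, keyCount M j h ≤ (2 * k + 1) * (2 * B) := by
  by_cases hj : j ≤ M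
  swap
  · have : levelIdx M F k j = ∅ := by
      ext h
      simp only [mem_levelIdx, Finset.notMem_empty, iff_false]
      tauto
    simp [this]
  have h1 : ∑ h ∈ levelIdx M F k j, keyCount M j h ≤
      ∑ h ∈ Finset.Icc (F - k) (F + k) ×ˢ Finset.range (F + k + 1) ×ˢ Finset.univ,
        (if h.2.1 + h.2.2.toNat ≤ h.1 then keyCount M j h else 0) := by
    refine le_trans (le_of_eq ?_) (Finset.sum_le_sum_of_subset (levelIdx_subset (M := M) j))
    refine Finset.sum_congr rfl fun h hh => ?_
    rw [if_pos (mem_levelIdx.1 hh).2.2.1]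
  refine h1.trans ?_
  rw [Finset.sum_product]
  have h2 : ∀ m ∈ Finset.Icc (F - k) (F + k),
      ∑ y ∈ Finset.range (F + k + 1) ×ˢ (Finset.univ : Finset Bool),
        (if y.1 + y.2.toNat ≤ m then keyCount M j (m, y) else 0) ≤ 2 * B := by
    intro m hm
    rw [Finset.mem_Icc] at hm
    rw [Finset.sum_product_right, Fintype.sum_bool]
    simp only [keyCount, Bool.toNat_true, Bool.toNat_false, add_zero, Nat.sub_zero]
    have e0 := (sum_choose_mul_choose_le (j - 1) (M - j) m (F + k + 1)).trans
      ((Nat.choose_le_choose m (show j - 1 + (M - j) ≤ M by omega)).trans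
        (hB m (by omega) (by omega)))
    have e1 : ∑ f ∈ Finset.range (F + k + 1), (if f + 1 ≤ m then
        (j - 1).choose (m - f - 1) * (M - j).choose f else 0) ≤ B := by
      cases m with
      | zero => simp
      | succ m =>
        have := (sum_choose_mul_choose_le (j - 1) (M - j) m (F + k + 1)).trans
          ((Nat.choose_le_choose m (show j - 1 + (M - j) ≤ M by omega)).trans
            (hB m (by omega) (by omega)))
        refine le_trans (le_of_eq (Finset.sum_congr rfl fun f _ => ?_)) this
        simp only [Nat.add_le_add_iff_right]
        rw [show m + 1 - f - 1 = m - f by omega]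
    omega
  refine (Finset.sum_le_card_nsmul _ _ _ h2).trans ?_
  rw [smul_eq_mul, Nat.card_Icc]
  exact Nat.mul_le_mul_right _ (by omega)

theorem two_pow_clog_le {a : ℕ} (ha : 0 < a) : 2 ^ Nat.clog 2 a ≤ 2 * a := by
  rcases Nat.lt_or_ge 1 a with h | h
  · have := Nat.pow_pred_clog_lt_self (b := 2) (by norm_num) h
    have hc : 0 < Nat.clog 2 a := Nat.clog_pos (by norm_num) h
    have : 2 ^ Nat.clog 2 a = 2 * 2 ^ (Nat.clog 2 a).pred := by
      rw [← pow_succ', ← Nat.succ_eq_add_one, Nat.succ_pred_eq_of_pos hc]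
    omega
  · have : a = 1 := by omega
    subst this; simp

/-- A factor 2 for rounding each of the two binomial coefficients, one for the vacant bit and one
for alignment make 16; the other summand pays for intervals widened to the minimal length. -/
theorem two_pow_levelWidth_le (N j : ℕ) {h : ℕ × ℕ × Bool} (hh : 0 < keyCount M j h) :
    2 ^ (levelWidth M N j h + 1) ≤ 2 ^ (N + 1) + 16 * keyCount M j h := by
  have h1 := two_pow_clog_le (Nat.pos_of_mul_pos_right hh)
  have h2 := two_pow_clog_le (Nat.pos_of_mul_pos_left hh)
  rcases max_choice N (Nat.clog 2 ((j - 1).choose (h.1 - h.2.1 - h.2.2.toNat)) +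
    suffixBits M j h.2.1 + 1) with hw | hw
  · rw [levelWidth, hw]; exact Nat.le_add_right _ _
  · rw [levelWidth, hw, pow_succ, pow_succ, pow_add]
    have := Nat.mul_le_mul h1 h2
    calc _ ≤ (2 * (j - 1).choose (h.1 - h.2.1 - h.2.2.toNat) *
          (2 * (M - j).choose h.2.1)) * 2 * 2 :=
          Nat.mul_le_mul_right _ (Nat.mul_le_mul_right _ this)
      _ = 16 * keyCount M j h := by rw [keyCount]; ring
      _ ≤ _ := Nat.le_add_left _ _

/-- Intervals of minimal length and padded counts take at most a quarter of the 2^L labels each. -/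
theorem levelsFit {L T B : ℕ} (hB : ∀ m, F ≤ m + k + 1 → m ≤ F + k → M.choose m ≤ B)
    (hT : T ≤ L) (hL : 2 ≤ L) (hcard : ∀ j, (levelIdx M F k j).card * 8 ≤ 2 ^ T)
    (hBL : 128 * ((2 * k + 1) * B) ≤ 2 ^ L) : LevelsFit M F k L T := by
  intro j
  have h1 : ∑ h ∈ levelIdx M F k j, 2 ^ (levelWidth M (L - T) j h + 1) ≤
      ∑ h ∈ levelIdx M F k j, (2 ^ (L - T + 1) + 16 * keyCount M j h) :=
    Finset.sum_le_sum fun h hh => two_pow_levelWidth_le _ _ (mem_levelIdx.1 hh).2.2.2.2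
  rw [Finset.sum_add_distrib, Finset.sum_const, ← Finset.mul_sum, smul_eq_mul] at h1
  have h2 := sum_keyCount_le hB j
  have h3 : (levelIdx M F k j).card * 8 * 2 ^ (L - T) ≤ 2 ^ T * 2 ^ (L - T) :=
    Nat.mul_le_mul_right _ (hcard j)
  rw [← pow_add, Nat.add_sub_cancel' hT] at h3
  have h4 : (levelIdx M F k j).card * 2 ^ (L - T + 1) * 4 =
      (levelIdx M F k j).card * 8 * 2 ^ (L - T) := by rw [pow_succ]; ring
  have h5 : 2 ^ L = 2 * 2 ^ (L - 1) := by rw [← pow_succ', Nat.sub_add_cancel (by omega)]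
  have h6 : (2 * k + 1) * (2 * B) = 2 * ((2 * k + 1) * B) := by ring
  omega

/-! ### Bounds on binomial coefficients -/

/-- The ratio of the two coefficients is (M - m)/(m + 1), at most M/F. -/
theorem choose_succ_le {m S : ℕ} (hS : M ≤ F * 2 ^ S) (hF : F ≤ m) :
    M.choose (m + 1) ≤ M.choose m * 2 ^ S := by
  have h := Nat.choose_succ_right_eq M m
  have h1 : M - m ≤ (m + 1) * 2 ^ S :=
    (Nat.sub_le _ _).trans (hS.trans (Nat.mul_le_mul_right _ (by omega)))
  refine Nat.le_of_mul_le_mul_right (c := m + 1) ?_ (by omega)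
  rw [h, mul_assoc, mul_comm (2 ^ S)]
  exact Nat.mul_le_mul_left _ h1

/-- Downwards the ratio is (m + 1)/(M - m), at most F/(M - F), which stays bounded as long as F
keeps a proportional distance from M. -/
theorem choose_pred_le {m c : ℕ} (hc : F ≤ 2 ^ c * (M - F)) (hF : m + 1 ≤ F) (hM : F < M) :
    M.choose m ≤ M.choose (m + 1) * 2 ^ c := by
  have h := Nat.choose_succ_right_eq M m
  have h1 : m + 1 ≤ 2 ^ c * (M - m) :=
    hF.trans (hc.trans (Nat.mul_le_mul_left _ (by omega)))
  refine Nat.le_of_mul_le_mul_right (c := M - m) ?_ (by omega)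
  rw [← h, mul_assoc]
  exact Nat.mul_le_mul_left _ h1

theorem choose_le_near {S c : ℕ} (hS : M ≤ F * 2 ^ S) (hc : F ≤ 2 ^ c * (M - F)) (hM : F < M)
    (m : ℕ) (h1 : F ≤ m + k + 1) (h2 : m ≤ F + k) :
    M.choose m ≤ M.choose F * 2 ^ ((k + 1) * (S + c)) := by
  have up : ∀ i, M.choose (F + i) ≤ M.choose F * 2 ^ (i * S) := by
    intro i
    induction i with
    | zero => simp
    | succ i ih =>
      refine (choose_succ_le (F := F) (m := F + i) hS (by omega)).trans ?_
      rw [Nat.succ_mul, pow_add, ← mul_assoc]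
      exact Nat.mul_le_mul_right _ ih
  have down : ∀ i ≤ F, M.choose (F - i) ≤ M.choose F * 2 ^ (i * c) := by
    intro i
    induction i with
    | zero => simp
    | succ i ih =>
      intro hi
      have := choose_pred_le (m := F - (i + 1)) hc (by omega) hM
      rw [show F - (i + 1) + 1 = F - i by omega] at this
      refine this.trans ?_
      rw [Nat.succ_mul, pow_add, ← mul_assoc]
      exact Nat.mul_le_mul_right _ (ih (by omega))
  rcases le_total F m with h | h
  · have := up (m - F)
    rw [show F + (m - F) = m by omega] at this
    refine this.trans (Nat.mul_le_mul_left _ (Nat.pow_le_pow_right (by norm_num) ?_))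
    exact Nat.mul_le_mul (by omega) (by omega)
  · have := down (F - m) (by omega)
    rw [show F - (F - m) = m by omega] at this
    refine this.trans (Nat.mul_le_mul_left _ (Nat.pow_le_pow_right (by norm_num) ?_))
    exact Nat.mul_le_mul (by omega) (by omega)

/-- Factor by factor, M/F ≤ (M - i)/(F - i). It gives F log₂(M/F) ≤ I, by which F and log₂(M/F) are
bounded in terms of I. -/
theorem pow_le_choose_mul_pow (h : F ≤ M) : M ^ F ≤ M.choose F * F ^ F := by
  have key : ∀ i ≤ F, M ^ i * F.descFactorial i ≤ M.descFactorial i * F ^ i := by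
    intro i
    induction i with
    | zero => simp
    | succ i ih =>
      intro hi
      have h1 : M * (F - i) ≤ (M - i) * F := by
        rw [Nat.mul_sub, Nat.sub_mul]
        have : i * F ≤ M * i := by rw [mul_comm]; exact Nat.mul_le_mul_right _ h
        omega
      have := Nat.mul_le_mul (ih (by omega)) h1
      rw [Nat.descFactorial_succ, Nat.descFactorial_succ, pow_succ, pow_succ]
      calc _ = M ^ i * F.descFactorial i * (M * (F - i)) := by ring
        _ ≤ _ := this
        _ = _ := by ring
  have := key F le_rfl
  rw [Nat.descFactorial_self, Nat.descFactorial_eq_factorial_mul_choose] at this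
  refine le_of_mul_le_mul_left (a := F.factorial) ?_ (Nat.factorial_pos F)
  calc _ = M ^ F * F.factorial := mul_comm _ _
    _ ≤ _ := this
    _ = _ := by ring

/-- M^F/F! ≤ 2^(F S) F^F/F! ≤ 2^(F S) e^F, and e < 4. It is used to bound the number of digits I/S
by a multiple of F. -/
theorem choose_le_two_pow {S : ℕ} (hS : M ≤ F * 2 ^ S) : M.choose F ≤ 2 ^ (F * (S + 2)) := by
  have h1 : (M.choose F : ℝ) ≤ (M : ℝ) ^ F / F.factorial := Nat.choose_le_pow_div F M
  have h2 : (M : ℝ) ^ F ≤ ((F : ℝ) * 2 ^ S) ^ F := by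
    gcongr
    exact_mod_cast hS
  have h3 := Real.pow_div_factorial_le_exp (F : ℝ) (Nat.cast_nonneg F) F
  have h4 : Real.exp F ≤ 4 ^ F := by
    rw [← mul_one (F : ℝ), Real.exp_nat_mul]
    have := Real.exp_one_lt_d9
    gcongr
    linarith
  have h5 : (M.choose F : ℝ) ≤ ((2 : ℕ) ^ (F * (S + 2)) : ℕ) := by
    calc (M.choose F : ℝ) ≤ (M : ℝ) ^ F / F.factorial := h1
      _ ≤ ((F : ℝ) * 2 ^ S) ^ F / F.factorial := by gcongr
      _ = 2 ^ (F * S) * ((F : ℝ) ^ F / F.factorial) := by rw [mul_pow, ← pow_mul]; ring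
      _ ≤ 2 ^ (F * S) * 4 ^ F := by gcongr; exact h3.trans h4
      _ = _ := by
        push_cast
        rw [mul_add, pow_add, mul_comm F 2, pow_mul 2 2 F]; norm_num
  exact_mod_cast h5

theorem choose_le_two_pow_infoBound (h : F ≤ M) : M.choose F ≤ 2 ^ infoBound M F := by
  have hpos : (0 : ℝ) < M.choose F := by exact_mod_cast Nat.choose_pos h
  have h1 : Real.logb 2 (M.choose F) ≤ infoBound M F := Nat.le_ceil _
  rw [Real.logb_le_iff_le_rpow (by norm_num) hpos, Real.rpow_natCast] at h1
  exact_mod_cast h1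

theorem infoBound_le (h : F ≤ M) {e : ℕ} (he : M.choose F ≤ 2 ^ e) : infoBound M F ≤ e := by
  have hpos : (0 : ℝ) < M.choose F := by exact_mod_cast Nat.choose_pos h
  rw [infoBound, Nat.ceil_le, Real.logb_le_iff_le_rpow (by norm_num) hpos, Real.rpow_natCast]
  exact_mod_cast he

theorem mul_logb_le_infoBound (hF : 1 ≤ F) (h : F ≤ M) :
    F * Real.logb 2 ((M : ℝ) / F) ≤ infoBound M F := by
  have hF' : (0 : ℝ) < F := by exact_mod_cast hF
  have hM' : (0 : ℝ) < M := by exact_mod_cast hF.trans h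
  have hpos : (0 : ℝ) < M.choose F := by exact_mod_cast Nat.choose_pos h
  refine le_trans ?_ (Nat.le_ceil _)
  rw [← Real.logb_pow, div_pow]
  refine Real.logb_le_logb_of_le (by norm_num) (by positivity) ?_
  rw [div_le_iff₀ (by positivity)]
  exact_mod_cast pow_le_choose_mul_pow h

theorem succ_le_choose (h : F < M) : F + 1 ≤ M.choose F := by
  have h1 := Nat.choose_le_choose F (show F + 1 ≤ M by omega)
  rwa [Nat.choose_succ_self_right] at h1

end Parameters

/-! ### The register parameters and the gate count -/

section Bounds

variable {M F k : ℕ}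

theorem two_mul_succ_le (k : ℕ) : (2 * k + 1) ≤ 2 * 2 ^ k := by
  have : k < 2 ^ k := Nat.lt_two_pow_self
  omega

/-- A choice of parameters for which the intervals of labels fit. -/
theorem exists_parameters {S c : ℕ} (hS0 : 1 ≤ S) (hF : 1 ≤ F) (hM : F < M) (hS : M ≤ F * 2 ^ S)
    (hc : F ≤ 2 ^ c * (M - F)) : ∃ L T D : ℕ, LevelsFit M F k L T ∧ 0 < T ∧ T ≤ L ∧ L = S * D ∧
      (∀ j, (levelIdx M F k j).card ≤ 2 ^ T) ∧ 2 ^ T ≤ 2 ^ (2 * k + 7) * F ∧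
      D ≤ ((k + 1) * (1 + c) + 2 * k + 12) * F ∧
      L ≤ infoBound M F + (k + 1) * (S + c) + 2 * k + 8 + S := by
  set I := infoBound M F with hI
  -- The first two terms bound the logarithm of the largest binomial coefficient; the rest pays for
  -- the number of weights and the padding and leaves room for T. Rounding up to a multiple of S
  -- then gives L.
  set L₀ := I + (k + 1) * (S + c) + 2 * k + 8 with hL₀
  set T := Nat.clog 2 (F + 1) + (2 * k + 5) with hT
  have hL : L₀ < S * (L₀ / S + 1) := Nat.lt_mul_div_succ _ hS0
  have hCI : M.choose F ≤ 2 ^ I := choose_le_two_pow_infoBound hM.le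
  have hTL : T ≤ L₀ := by
    have : Nat.clog 2 (F + 1) ≤ I := Nat.clog_le_of_le_pow ((succ_le_choose hM).trans hCI)
    omega
  have hcard : ∀ j, (levelIdx M F k j).card * 8 ≤ 2 ^ T := by
    intro j
    have h1 : F + 1 ≤ 2 ^ Nat.clog 2 (F + 1) := Nat.le_pow_clog (by norm_num) _
    have h2 := two_mul_succ_le k
    have h3 : k + 1 ≤ 2 ^ k := Nat.lt_two_pow_self
    have h4 : F + k + 1 ≤ (F + 1) * (k + 1) := by
      have : (F + 1) * (k + 1) = F * k + F + k + 1 := by ring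
      omega
    calc (levelIdx M F k j).card * 8 ≤ (2 * k + 1) * ((F + k + 1) * 2) * 8 :=
          Nat.mul_le_mul_right _ (card_levelIdx_le j)
      _ ≤ (2 * 2 ^ k) * ((2 ^ Nat.clog 2 (F + 1) * 2 ^ k) * 2) * 8 :=
          Nat.mul_le_mul_right _ (Nat.mul_le_mul h2 (Nat.mul_le_mul_right _
            (h4.trans (Nat.mul_le_mul h1 h3))))
      _ = 2 ^ T := by rw [hT, pow_add, pow_add, pow_mul']; ring
  refine ⟨S * (L₀ / S + 1), T, L₀ / S + 1, ?_, by omega, by omega, rfl, ?_, ?_, ?_, ?_⟩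
  · refine levelsFit (choose_le_near hS hc hM) (by omega) (by omega) hcard ?_
    calc 128 * ((2 * k + 1) * (M.choose F * 2 ^ ((k + 1) * (S + c))))
        ≤ 2 ^ 7 * ((2 * 2 ^ k) * (2 ^ I * 2 ^ ((k + 1) * (S + c)))) :=
          Nat.mul_le_mul (by norm_num) (Nat.mul_le_mul (two_mul_succ_le k)
            (Nat.mul_le_mul_right _ hCI))
      _ = 2 ^ (I + (k + 1) * (S + c) + k + 8) := by
          rw [pow_add, pow_add, pow_add]; ring
      _ ≤ _ := Nat.pow_le_pow_right (by norm_num) (by omega)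
  · intro j
    have := hcard j
    omega
  · have h1 := two_pow_clog_le (Nat.succ_pos F)
    calc 2 ^ T = 2 ^ Nat.clog 2 (F + 1) * 2 ^ (2 * k + 5) := pow_add _ _ _
      _ ≤ (4 * F) * 2 ^ (2 * k + 5) := by
          refine Nat.mul_le_mul_right _ (h1.trans ?_)
          simp only [Nat.succ_eq_add_one]; omega
      _ = _ := by rw [show 2 * k + 7 = 2 * k + 5 + 2 by rfl, pow_add]; ring
  · have h1 : I ≤ F * (S + 2) := infoBound_le hM.le (choose_le_two_pow hS)
    have hFS : 1 ≤ F * S := Nat.mul_pos hF hS0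
    have h2 : L₀ / S ≤ (3 + (k + 1) * (1 + c) + 2 * k + 8) * F := by
      refine Nat.div_le_of_le_mul ?_
      have e1 : F * (S + 2) ≤ 3 * (F * S) := by nlinarith
      have e2 : (k + 1) * (S + c) ≤ (k + 1) * (1 + c) * (F * S) := by
        rw [mul_assoc]
        refine Nat.mul_le_mul_left _ ?_
        nlinarith [Nat.le_mul_of_pos_left S hF, Nat.le_mul_of_pos_right c hFS]
      have e3 : 2 * k + 8 ≤ (2 * k + 8) * (F * S) := Nat.le_mul_of_pos_right _ hFS
      calc L₀ ≤ 3 * (F * S) + (k + 1) * (1 + c) * (F * S) + (2 * k + 8) * (F * S) := by omega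
        _ = _ := by ring
    have h3 : ((k + 1) * (1 + c) + 2 * k + 12) * F =
      (3 + (k + 1) * (1 + c) + 2 * k + 8) * F + F := by ring
    omega
  · have := Nat.mul_div_le L₀ S
    rw [mul_add, mul_one]
    omega

/-- Loading all digits costs D S 2^T = L 2^T and adding them D L, both O(F I) because D and 2^T are
O(F) and L is O(I). The blocks cost 2^T (n + 2^T), again O(F I) because F = O(I). -/
theorem gateCount_le {I L S T D K : ℕ} (hF : 1 ≤ F) (hI : 1 ≤ I) (hM : 1 ≤ M) (hK : 1 ≤ K)
    (hFI : F ≤ K * I) (hn : L + S + 6 ≤ K * I) (hT : 2 ^ T ≤ K * F) (hD : D ≤ K * F)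
    (hL : L = S * D) :
    M * (2 * ((10 * k + 5) * (D * (S * (6 * 2 ^ (T + 2)) + 260 * L + 210)) +
        (4 * k + 6 * 2 ^ T) * (15 * (L + S + 6) + 6 * 2 ^ (T + 2)) + 2) +
        (15 * (L + S + 6) + 6 * 2 ^ (T + 2))) + 2 ^ T * (15 * (L + S + 6) + 6 * 2 ^ (T + 2)) ≤
      (2 * ((10 * k + 5) * (494 * K ^ 2) + (4 * k + 6 * K) * (39 * K ^ 2) + 2) + 39 * K ^ 2 +
        39 * K ^ 3) * (M * F * I) := by
  have hp : 2 ^ (T + 2) = 4 * 2 ^ T := by rw [pow_add]; ring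
  rw [hp]
  generalize 2 ^ T = V at *
  generalize hn' : L + S + 6 = n at *
  have hA : D * (S * (6 * (4 * V)) + 260 * L + 210) ≤ 494 * K ^ 2 * (F * I) := by
    calc D * (S * (6 * (4 * V)) + 260 * L + 210) = 24 * ((S * D) * V) + D * (260 * L + 210) := by
          ring
      _ ≤ 24 * ((K * I) * (K * F)) + (K * F) * (470 * (K * I)) := by
          rw [← hL]
          gcongr
          · omega
          · omega
      _ = _ := by ring
  have hB : 15 * n + 6 * (4 * V) ≤ 39 * K ^ 2 * I := by
    have h1 : V ≤ K ^ 2 * I := by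
      calc V ≤ K * F := hT
        _ ≤ K * (K * I) := Nat.mul_le_mul_left _ hFI
        _ = _ := by ring
    have h2 : K * I ≤ K ^ 2 * I := Nat.mul_le_mul_right _ (by nlinarith)
    have : 39 * K ^ 2 * I = 39 * (K ^ 2 * I) := by ring
    omega
  have hFI1 : 1 ≤ F * I := Nat.mul_pos hF hI
  have hIF : I ≤ F * I := Nat.le_mul_of_pos_left _ hF
  have hMF : F * I ≤ M * F * I := by
    rw [mul_assoc]; exact Nat.le_mul_of_pos_left _ hM
  generalize D * (S * (6 * (4 * V)) + 260 * L + 210) = A at *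
  generalize 15 * n + 6 * (4 * V) = B at *
  have hB' : B ≤ 39 * K ^ 2 * (F * I) := hB.trans (Nat.mul_le_mul_left _ hIF)
  have hVB : V * B ≤ 39 * K ^ 3 * (F * I) := by
    calc V * B ≤ (K * F) * (39 * K ^ 2 * I) := Nat.mul_le_mul hT hB
      _ = _ := by ring
  calc M * (2 * ((10 * k + 5) * A + (4 * k + 6 * V) * B + 2) + B) + V * B
      = M * (2 * ((10 * k + 5) * A + 4 * k * B + 6 * (V * B) + 2) + B) + V * B := by ring
    _ ≤ M * (2 * ((10 * k + 5) * (494 * K ^ 2 * (F * I)) + 4 * k * (39 * K ^ 2 * (F * I)) +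
        6 * (39 * K ^ 3 * (F * I)) + 2 * (F * I)) + 39 * K ^ 2 * (F * I)) +
        39 * K ^ 3 * (M * F * I) := by
        refine Nat.add_le_add ?_ (hVB.trans (Nat.mul_le_mul_left _ hMF))
        generalize V * B = W at *
        gcongr
        omega
    _ = _ := by ring

theorem qubits_le {I S L c : ℕ} (hI : 1 ≤ I) (hS : S ≤ I + I)
    (hL : L ≤ I + (k + 1) * (S + c) + 2 * k + 8 + S) :
    L + S + 6 ≤ (1 + (k + 1) * (2 + c) + 2 * k + 18) * I := by
  have e1 : (k + 1) * (S + c) ≤ (k + 1) * ((2 + c) * I) := by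
    refine Nat.mul_le_mul_left _ ?_
    have : c ≤ c * I := Nat.le_mul_of_pos_right _ hI
    have : (2 + c) * I = I + I + c * I := by ring
    omega
  have e2 : 2 * k + 14 ≤ (2 * k + 14) * I := Nat.le_mul_of_pos_right _ hI
  calc L + S + 6 ≤ I + (k + 1) * ((2 + c) * I) + (2 * k + 14) * I + 4 * I := by omega
    _ = _ := by ring

end Bounds

end FermionEncoding

end

/-! ### The constants C and C' -/

theorem theorem7 (ε : ℝ) (hε : 0 < ε) :
    ∃ C : ℝ, ∀ k : ℕ, 1 ≤ k → ∃ C' : ℝ, ∀ M F : ℕ, 1 ≤ F → (F : ℝ) ≤ (1 - ε) * M →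
      ∃ (n : ℕ) (D : FermionDataStructure M F k n),
        (n : ℝ) ≤ infoBound M F + C * (k * Real.logb 2 ((M : ℝ) / F)) ∧
        (D.gateComplexity : ℝ) ≤ C' * (M * F * infoBound M F) ∧
        ∃ (l : ℕ → BitString M → ℕ) (P X Z : ℕ → Circuit n),
          CyclesThroughOrderings D l P X Z := by
  rcases le_or_gt 1 ε with h1 | h1
  · refine ⟨0, fun k _ => ⟨0, fun M F hF hFM => ?_⟩⟩
    have hF' : (1 : ℝ) ≤ F := by exact_mod_cast hF
    have := mul_nonneg (sub_nonneg.2 h1) (Nat.cast_nonneg (α := ℝ) M)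
    linarith
  -- A positive lower bound of log₂(M/F), by which additive constants are absorbed into multiples of
  -- log₂(M/F).
  set lam := Real.logb 2 (1 / (1 - ε)) with hlam
  have hlam0 : 0 < lam := Real.logb_pos (by norm_num) (by
    rw [lt_div_iff₀ (by linarith)]; linarith)
  obtain ⟨c, hc⟩ := pow_unbounded_of_one_lt (1 / ε) (show (1 : ℝ) < 2 by norm_num)
  -- Chosen for F ≤ a I, which follows from F lam ≤ F log₂(M/F) ≤ I.
  set a := ⌈1 / lam⌉₊ with ha
  -- The excess over I is at most k(4S + 2c + 16); S ≤ t + 1 turns the bracket into 4t + 2c + 20,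
  -- and lam ≤ t absorbs the constant.
  refine ⟨4 + (2 * c + 20) / lam, fun k hk => ?_⟩
  have hbound : ∀ q r s : ℕ, ∃ K : ℕ, 1 ≤ K ∧ a ≤ K ∧ q ≤ K ∧ r ≤ K ∧ s ≤ K := fun q r s =>
    ⟨1 + a + q + r + s, by omega, by omega, by omega, by omega, by omega⟩
  obtain ⟨K, hK1, hKa, hKn, hKV, hKD⟩ := hbound (1 + (k + 1) * (2 + c) + 2 * k + 18)
    (2 ^ (2 * k + 7)) ((k + 1) * (1 + c) + 2 * k + 12)
  refine ⟨((2 * ((10 * k + 5) * (494 * K ^ 2) + (4 * k + 6 * K) * (39 * K ^ 2) + 2) + 39 * K ^ 2 +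
        39 * K ^ 3 : ℕ) : ℝ), fun M F hF hFM => ?_⟩
  have hF0 : (0 : ℝ) < F := by exact_mod_cast hF
  have hM0 : (0 : ℝ) < M := by
    rcases Nat.eq_zero_or_pos M with h | h
    · subst h; simp at hFM; linarith
    · exact_mod_cast h
  have hFM' : F < M := by
    have : (F : ℝ) < M := by nlinarith
    exact_mod_cast this
  set t := Real.logb 2 ((M : ℝ) / F) with ht
  have hlt : lam ≤ t := by
    refine Real.logb_le_logb_of_le (by norm_num) (by
      apply div_pos one_pos; linarith) ?_
    rw [div_le_div_iff₀ (by linarith) hF0]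
    linarith
  have ht0 : 0 < t := hlam0.trans_le hlt
  set S := ⌈t⌉₊ with hS
  have hS0 : 1 ≤ S := Nat.ceil_pos.2 ht0
  have hSt : (S : ℝ) ≤ t + 1 := (Nat.ceil_lt_add_one ht0.le).le
  have hMS : M ≤ F * 2 ^ S := by
    have h2 : t ≤ S := Nat.le_ceil t
    rw [ht, Real.logb_le_iff_le_rpow (by norm_num) (by positivity), Real.rpow_natCast,
      div_le_iff₀ hF0] at h2
    rw [mul_comm]
    exact_mod_cast h2
  have hFc : F ≤ 2 ^ c * (M - F) := by
    have h2 : (F : ℝ) ≤ 2 ^ c * ((M : ℝ) - F) := by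
      have h3 : 1 < 2 ^ c * ε := by rwa [div_lt_iff₀ hε] at hc
      have h4 : ε * M ≤ (M : ℝ) - F := by linarith
      have h5 : (2 : ℝ) ^ c * (ε * M) ≤ 2 ^ c * ((M : ℝ) - F) := by gcongr
      have h6 : (F : ℝ) ≤ M := by exact_mod_cast hFM'.le
      nlinarith
    rw [← Nat.cast_sub hFM'.le] at h2
    exact_mod_cast h2
  obtain ⟨L, T, D, hfit, hT0, hTL, hLSD, hcard, hV, hD, hL⟩ :=
    exists_parameters (k := k) hS0 hF hFM' hMS hFc
  obtain ⟨𝒟, hgate, hcyc⟩ := exists_dataStructure hfit hT0 hTL hS0 hLSD hFM'.le hcard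
  set I := infoBound M F with hI
  have hI1 : 1 ≤ I := by
    by_contra h
    have h2 := choose_le_two_pow_infoBound hFM'.le
    rw [← hI, show I = 0 by omega] at h2
    have h3 := succ_le_choose hFM'
    simp at h2
    omega
  have hFt : (F : ℝ) * t ≤ I := mul_logb_le_infoBound hF hFM'.le
  have htI : t ≤ I := by
    refine le_trans ?_ hFt
    have : (1 : ℝ) ≤ F := by exact_mod_cast hF
    nlinarith
  have hSI : S ≤ I + I := by
    have h2 : (1 : ℝ) ≤ I := by exact_mod_cast hI1
    have : (S : ℝ) ≤ ((I + I : ℕ) : ℝ) := by push_cast; linarith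
    exact_mod_cast this
  have hFI : F ≤ a * I := by
    have h2 : 1 / lam ≤ a := Nat.le_ceil _
    have h3 : (F : ℝ) * lam ≤ I := (by gcongr : (F : ℝ) * lam ≤ F * t).trans hFt
    have h4 : (F : ℝ) ≤ a * I := by
      calc (F : ℝ) = (F * lam) * (1 / lam) := by field_simp
        _ ≤ I * a := by gcongr
        _ = _ := mul_comm _ _
    exact_mod_cast h4
  refine ⟨L + S + 6, 𝒟, ?_, ?_, hcyc⟩
  · have hn : L + S + 6 ≤ I + k * (4 * S + 2 * c + 16) := by
      -- k ≥ 1 lets every part of the excess be bounded by a multiple of k.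
      have e1 : (k + 1) * (S + c) ≤ (2 * k) * (S + c) := Nat.mul_le_mul_right _ (by omega)
      have e2 : 2 * S ≤ k * (2 * S) := Nat.le_mul_of_pos_left _ hk
      have e3 : k * (4 * S + 2 * c + 16) = (2 * k) * (S + c) + k * (2 * S) + 16 * k := by ring
      omega
    have h2 : ((L + S + 6 : ℕ) : ℝ) ≤ I + k * (4 * S + 2 * c + 16) := by exact_mod_cast hn
    refine h2.trans (add_le_add_right ?_ _)
    have h3 : (4 * S + 2 * c + 16 : ℝ) ≤ (4 + (2 * c + 20) / lam) * t := by
      have h4 : (2 * c + 20 : ℝ) ≤ (2 * c + 20) / lam * t := by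
        rw [div_mul_eq_mul_div, le_div_iff₀ hlam0]
        gcongr
      linarith
    calc (k : ℝ) * (4 * S + 2 * c + 16) ≤ k * ((4 + (2 * c + 20) / lam) * t) := by gcongr
      _ = _ := by ring
  · have hg := gateCount_le (M := M) (k := k) hF hI1 (by omega) hK1
      (hFI.trans (Nat.mul_le_mul_right _ hKa))
      ((qubits_le hI1 hSI hL).trans (Nat.mul_le_mul_right _ hKn))
      (hV.trans (Nat.mul_le_mul_right _ hKV))
      (hD.trans (Nat.mul_le_mul_right _ hKD)) hLSD
    refine (Nat.cast_le.2 (hgate.trans hg)).trans (le_of_eq ?_)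
    rw [Nat.cast_mul, Nat.cast_mul, Nat.cast_mul]
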